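/- Setting. Let $(M,g)$ be a connected Lorentz surface (a $C^2$ metric of signature $(-,+)$), oriented and time oriented, which is spatially compact: it has a compact topological hypersurface that every inextensible causal curve meets exactly once. Let $\mathcal F_1,\mathcal F_2$ be the two foliations of $M$ by lightlike geodesics (distinguished by the orientation), let $F_i=M/\mathcal F_i$ be the spaces of leaves, and choose diffeomorphisms $F_1\simeq\mathbb S^1$, $F_2\simeq\mathbb S^1$, where $\mathbb S^1=\mathbb R/\mathbb Z$, oriented so that along future directed timelike curves the first coordinate decreases and the second one increases. They define a conformal immersion $p:M\to(\mathbb T^2=\mathbb R^2/\mathbb Z^2,\,dx\,dy)$. The group $\mathrm{Isom}(M,g)$ of isometries preserving the orientation and the time orientation acts on $F_1\simeq\mathbb S^1$, which gives a representation $\rho_1:\mathrm{Isom}(M,g)\to\mathrm{Homeo}(\mathbb S^1)$. Let $\tilde p:\widetilde M\to\mathbb R^2$ be a lift of $p$ to the universal cover $\widetilde M$ of $M$, and write $$\tilde p(\widetilde M)=\{(x,y)\mid \tilde h_\downarrow(x)<y<\tilde h_\uparrow(x)\}=\{(x,y)\mid \tilde h_\leftarrow(y)<x<\tilde h_\rightarrow(y)\}$$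 with $\tilde h_\downarrow,\tilde h_\uparrow,\tilde h_\leftarrow,\tilde h_\rightarrow:\mathbb R\to\mathbb R\cup\{\pm\infty\}$. The conformal boundary is called acausal if each of $\tilde h_\downarrow,\tilde h_\uparrow$ is either a homeomorphism of $\mathbb R$ or infinite. If moreover $(M,g)$ embeds conformally in $(\mathbb T^2,dx\,dy)$, these maps are finite and induce homeomorphisms $h_\downarrow,h_\uparrow,h_\leftarrow,h_\rightarrow$ of $\mathbb S^1$, with $h_\rightarrow=h_\downarrow^{-1}$ and $h_\leftarrow=h_\uparrow^{-1}$; put $h_{\rightarrow\uparrow}=h_\rightarrow\circ h_\uparrow$. Definition. For $a\neq b$ in $\mathbb S^1$ let $(a,b)$ be the open interval going from $a$ to $b$ in the positive direction, and let $(a,a)=\mathbb S^1\setminus\{a\}$. Let $k\ge 1$ and let $h\in\mathrm{Homeo}(\mathbb S^1)$ have rotation number $\frac1k$ (modulo $1$). A sequence $(f_n)$ in $\mathrm{Homeo}(\mathbb S^1)$ has the $(h,k)$-convergence property if there are $a,b\in\mathbb S^1$ with $h^k(a)=a$ and $h^k(b)=b$ such that, after passing to a subsequence, $f_n(x)\to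 h^i(b)$ for all $i\in\{0,\dots,k-1\}$ and all $x\in(h^i(a),h^{i+1}(a))$. A group $G\subset\mathrm{Homeo}(\mathbb S^1)$ is an $(h,k)$-convergence group if all its elements commute with $h$ and every sequence in $G$ either has the $(h,k)$-convergence property or has an equicontinuous subsequence. Proposition. Let $(M,g)$ be a spatially compact surface with an acausal conformal boundary that embeds conformally in $\mathbb T^2$. Assume that the rotation number of $h_{\rightarrow\uparrow}$ is $\frac1k$ for an integer $k\ge1$. Then $\rho_1(\mathrm{Isom}(M,g))$ is an $(h_{\rightarrow\uparrow},k)$-convergence group. -/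

import Mathlib

open scoped Manifold ContDiff Topology

noncomputable section

namespace LorentzConvergence

/-! ## Circle dynamics -/

/-- The circle `ℝ / ℤ`, with the cyclic order of Mathlib. -/
abbrev S1 : Type := AddCircle (1 : ℝ)

/-- The open interval `(a, b)` of the circle, travelled in the positive direction from `a` to `b`;
by convention `(a, a)` is the circle minus `a`. -/
def circleIoo (a b : S1) : Set S1 :=
  {x | if a = b then x ≠ a else sbtw a x b}

/-- The circle homeomorphism `h` is orientation preserving with rotation number `ρ ∈ ℝ / ℤ`:
it has a non decreasing lift to `ℝ` commuting with `x ↦ x + 1`, the translation number of which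
is `ρ` modulo `1`. -/
def HasRotationNumber (h : S1 ≃ₜ S1) (ρ : S1) : Prop :=
  ∃ f : CircleDeg1Lift, (∀ x : ℝ, ((f x : ℝ) : S1) = h (x : S1)) ∧
    ((CircleDeg1Lift.translationNumber f : ℝ) : S1) = ρ

/-- The `(h, k)`-convergence property of a sequence of circle homeomorphisms. -/
def HasConvergenceProperty (h : S1 ≃ₜ S1) (k : ℕ) (f : ℕ → (S1 ≃ₜ S1)) : Prop :=
  ∃ a b : S1, ∃ s : ℕ → ℕ, StrictMono s ∧ (h ^ k) a = a ∧ (h ^ k) b = b ∧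
    ∀ i < k, ∀ x ∈ circleIoo ((h ^ i) a) ((h ^ (i + 1)) a),
      Filter.Tendsto (fun n => f (s n) x) Filter.atTop (𝓝 ((h ^ i) b))

/-- `G` is an `(h, k)`-convergence group: all its elements commute with `h`, and every sequence
in `G` has the `(h, k)`-convergence property or an equicontinuous subsequence. -/
def IsConvergenceGroup (h : S1 ≃ₜ S1) (k : ℕ) (G : Subgroup (S1 ≃ₜ S1)) : Prop :=
  (∀ f ∈ G, f * h = h * f) ∧
    ∀ f : ℕ → (S1 ≃ₜ S1), (∀ n, f n ∈ G) →
      HasConvergenceProperty h k f ∨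
        ∃ s : ℕ → ℕ, StrictMono s ∧ Equicontinuous (fun n => (f (s n) : S1 → S1))

/-! ## Lorentz surfaces -/

/-- The model space of surfaces. -/
abbrev Plane : Type := EuclideanSpace ℝ (Fin 2)

/-- A curve parametrised by the whole line is inextensible if it has no end point in `X`. -/
def Inextensible {X : Type*} [TopologicalSpace X] (γ : ℝ → X) : Prop :=
  (¬ ∃ x, Filter.Tendsto γ Filter.atTop (𝓝 x)) ∧ ¬ ∃ x, Filter.Tendsto γ Filter.atBot (𝓝 x)

section Surface

variable (M : Type*) [TopologicalSpace M] [ChartedSpace Plane M] [IsManifold (𝓡 2) ∞ M]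

/-- An oriented and time oriented Lorentz surface: a `C²` symmetric bilinear form of signature
`(-, +)`, a continuous timelike vector field (the time orientation), and a continuous nowhere
vanishing `2`-form (the orientation). -/
structure LorentzSurface where
  /-- the metric -/
  metric (m : M) : TangentSpace (𝓡 2) m →L[ℝ] TangentSpace (𝓡 2) m →L[ℝ] ℝ
  symm (m : M) (u v : TangentSpace (𝓡 2) m) : metric m u v = metric m v u
  signature (m : M) : ∃ u v : TangentSpace (𝓡 2) m, metric m u u < 0 ∧ 0 < metric m v v
  contMDiff_metric : ContMDiff (𝓡 2) ((𝓡 2).prod 𝓘(ℝ, Plane →L[ℝ] Plane →L[ℝ] ℝ)) 2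
    (fun m => Bundle.TotalSpace.mk' (Plane →L[ℝ] Plane →L[ℝ] ℝ)
      (E := fun m : M => TangentSpace (𝓡 2) m →L[ℝ] TangentSpace (𝓡 2) m →L[ℝ] ℝ) m (metric m))
  /-- the time orientation -/
  time (m : M) : TangentSpace (𝓡 2) m
  timelike_time (m : M) : metric m (time m) (time m) < 0
  continuous_time : Continuous (fun m => (⟨m, time m⟩ : TangentBundle (𝓡 2) M))
  /-- the orientation -/
  area (m : M) : TangentSpace (𝓡 2) m →L[ℝ] TangentSpace (𝓡 2) m →L[ℝ] ℝ
  area_self (m : M) (u : TangentSpace (𝓡 2) m) : area m u u = 0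
  area_ne_zero (m : M) : area m ≠ 0
  contMDiff_area : ContMDiff (𝓡 2) ((𝓡 2).prod 𝓘(ℝ, Plane →L[ℝ] Plane →L[ℝ] ℝ)) 0
    (fun m => Bundle.TotalSpace.mk' (Plane →L[ℝ] Plane →L[ℝ] ℝ)
      (E := fun m : M => TangentSpace (𝓡 2) m →L[ℝ] TangentSpace (𝓡 2) m →L[ℝ] ℝ) m (area m))

end Surface

variable {M : Type*} [TopologicalSpace M] [ChartedSpace Plane M]

/-- The velocity of a curve. -/
def velocity (γ : ℝ → M) (t : ℝ) : TangentSpace (𝓡 2) (γ t) :=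
  mfderiv 𝓘(ℝ, ℝ) (𝓡 2) γ t (1 : ℝ)

/-- The differential of a real function, as a linear form on a tangent plane. -/
def differential (u : M → ℝ) (m : M) (a : TangentSpace (𝓡 2) m) : ℝ :=
  mfderiv (𝓡 2) 𝓘(ℝ, ℝ) u m a

variable [IsManifold (𝓡 2) ∞ M]

namespace LorentzSurface

variable (g : LorentzSurface M)

/-- Future directed (causal, non zero) tangent vectors. -/
def FutureDirected {m : M} (u : TangentSpace (𝓡 2) m) : Prop :=
  g.metric m u u ≤ 0 ∧ g.metric m u (g.time m) < 0

/-- `C¹` causal curves, parametrised by the whole line. -/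
def IsCausalCurve (γ : ℝ → M) : Prop :=
  ContMDiff 𝓘(ℝ, ℝ) (𝓡 2) 1 γ ∧
    ∀ t, velocity γ t ≠ 0 ∧ g.metric (γ t) (velocity γ t) (velocity γ t) ≤ 0

/-- A Cauchy hypersurface: a topological hypersurface that every inextensible causal curve meets
exactly once. -/
def IsCauchyHypersurface (S : Set M) : Prop :=
  Nonempty (ChartedSpace ℝ S) ∧
    ∀ γ : ℝ → M, g.IsCausalCurve γ → Inextensible γ → ∃! t, γ t ∈ S

/-- Spatially compact: globally hyperbolic with a compact Cauchy hypersurface. -/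
def SpatiallyCompact : Prop :=
  ∃ S : Set M, g.IsCauchyHypersurface S ∧ IsCompact S

/-! ### Conformal embeddings in the flat torus -/

/-- `(M, g)` embeds conformally in the flat torus `(ℝ² / ℤ², dx dy)`: there is an embedding that
is given by `C¹` functions `u, v` locally, with `g` a positive multiple of `du dv`. -/
def EmbedsInTorus : Prop :=
  ∃ f : M → S1 × S1, Topology.IsEmbedding f ∧
    ∀ m : M, ∃ u v : M → ℝ,
      ContMDiffAt (𝓡 2) 𝓘(ℝ, ℝ) 1 u m ∧ ContMDiffAt (𝓡 2) 𝓘(ℝ, ℝ) 1 v m ∧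
      (∀ᶠ m' in 𝓝 m, f m' = (((u m' : ℝ) : S1), ((v m' : ℝ) : S1))) ∧
      ∃ c : ℝ, 0 < c ∧ ∀ a : TangentSpace (𝓡 2) m,
        g.metric m a a = c * (differential u m a * differential v m a)

/-! ### The lightlike foliations -/

/-- Future directed lightlike vectors tangent to the foliation `i`. The two lightlike foliations
are told apart by the orientation: a future directed lightlike vector `u` belongs to the foliation
`0` if `(u, w)` is a positive basis for the future directed timelike vectors `w`, and to the
foliation `1` if `(w, u)` is a positive basis. -/
def Lightlike (i : Fin 2) {m : M} (u : TangentSpace (𝓡 2) m) : Prop :=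
  g.metric m u u = 0 ∧ g.FutureDirected u ∧
    ∀ w : TangentSpace (𝓡 2) m, g.metric m w w < 0 → g.FutureDirected w →
      if i = 0 then 0 < g.area m u w else 0 < g.area m w u

/-- `a` and `b` are joined by a curve tangent to the lightlike foliation `i`. -/
def LeafStep (i : Fin 2) (a b : M) : Prop :=
  ∃ γ : ℝ → M, ContMDiff 𝓘(ℝ, ℝ) (𝓡 2) 1 γ ∧ (∀ t, g.Lightlike i (velocity γ t)) ∧
    γ 0 = a ∧ γ 1 = b

/-- The space of leaves of the lightlike foliation `i`, with the quotient topology. -/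
def LeafSpace (i : Fin 2) : Type _ := Quot (g.LeafStep i)

instance (i : Fin 2) : TopologicalSpace (g.LeafSpace i) :=
  inferInstanceAs (TopologicalSpace (Quot (g.LeafStep i)))

/-- The projection of `M` onto the space of leaves. -/
def leaf (i : Fin 2) (m : M) : g.LeafSpace i := Quot.mk _ m

/-- A diffeomorphism `α` between the space of leaves and the circle, that is, a homeomorphism
such that `α ∘ leaf` is a `C¹` submersion. It is oriented so that the first coordinate decreases
and the second coordinate increases towards the future. -/
def IsCoordinate (i : Fin 2) (α : g.LeafSpace i ≃ₜ S1) : Prop :=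
  ∀ m : M, ∃ u : M → ℝ, ContMDiffAt (𝓡 2) 𝓘(ℝ, ℝ) 1 u m ∧
    (∀ᶠ m' in 𝓝 m, ((u m' : ℝ) : S1) = α (g.leaf i m')) ∧
    if i = 0 then differential u m (g.time m) < 0 else 0 < differential u m (g.time m)

/-- The conformal immersion of `M` in the torus given by the two projections. -/
def toTorus (α : g.LeafSpace 0 ≃ₜ S1) (β : g.LeafSpace 1 ≃ₜ S1) (m : M) : S1 × S1 :=
  (α (g.leaf 0 m), β (g.leaf 1 m))

/-! ### The isometry group and its action on the spaces of leaves -/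

/-- Isometries preserving the orientation and the time orientation. -/
structure IsIsometry (φ : M ≃ₜ M) : Prop where
  contMDiff : ContMDiff (𝓡 2) (𝓡 2) 1 φ
  contMDiff_symm : ContMDiff (𝓡 2) (𝓡 2) 1 φ.symm
  metric_eq (m : M) (a b : TangentSpace (𝓡 2) m) :
    g.metric (φ m) (mfderiv (𝓡 2) (𝓡 2) φ m a) (mfderiv (𝓡 2) (𝓡 2) φ m b) = g.metric m a b
  area_pos (m : M) (a b : TangentSpace (𝓡 2) m) :
    0 < g.area (φ m) (mfderiv (𝓡 2) (𝓡 2) φ m a) (mfderiv (𝓡 2) (𝓡 2) φ m b) ↔ 0 < g.area m a b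
  future (m : M) (a : TangentSpace (𝓡 2) m) :
    g.FutureDirected (m := φ m) (mfderiv (𝓡 2) (𝓡 2) φ m a) ↔ g.FutureDirected a

variable {g}

theorem isIsometry_one : g.IsIsometry 1 := by
  have h : ∀ m : M, mfderiv (𝓡 2) (𝓡 2) (1 : M ≃ₜ M) m
      = ContinuousLinearMap.id ℝ (TangentSpace (𝓡 2) m) := fun m => mfderiv_id
  refine ⟨contMDiff_id, contMDiff_id, fun m a b => ?_, fun m a b => ?_, fun m a => ?_⟩
  · rw [h]; rfl
  · rw [h]; rfl
  · rw [h]; rfl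

theorem IsIsometry.mul {φ ψ : M ≃ₜ M} (hφ : g.IsIsometry φ) (hψ : g.IsIsometry ψ) :
    g.IsIsometry (φ * ψ) := by
  have h : ∀ m : M, mfderiv (𝓡 2) (𝓡 2) (φ * ψ : M ≃ₜ M) m
      = (mfderiv (𝓡 2) (𝓡 2) φ (ψ m)).comp (mfderiv (𝓡 2) (𝓡 2) ψ m) := fun m =>
    mfderiv_comp m (hφ.contMDiff.mdifferentiable one_ne_zero _)
      (hψ.contMDiff.mdifferentiable one_ne_zero _)
  refine ⟨hφ.contMDiff.comp hψ.contMDiff, hψ.contMDiff_symm.comp hφ.contMDiff_symm,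
    fun m a b => ?_, fun m a b => ?_, fun m a => ?_⟩
  · rw [h]; exact (hφ.metric_eq (ψ m) _ _).trans (hψ.metric_eq m a b)
  · rw [h]; exact (hφ.area_pos (ψ m) _ _).trans (hψ.area_pos m a b)
  · rw [h]; exact (hφ.future (ψ m) _).trans (hψ.future m a)

theorem IsIsometry.mfderiv_symm_mfderiv {φ : M ≃ₜ M} (hφ : g.IsIsometry φ) (n : M)
    (a : TangentSpace (𝓡 2) n) :
    (mfderiv (𝓡 2) (𝓡 2) φ.symm (φ n) (mfderiv (𝓡 2) (𝓡 2) φ n a) : Plane) = a := by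
  have h1 := mfderiv_comp (I := 𝓡 2) (I' := 𝓡 2) (I'' := 𝓡 2) n (g := φ.symm) (f := φ)
    (hφ.contMDiff_symm.mdifferentiable one_ne_zero _)
    (hφ.contMDiff.mdifferentiable one_ne_zero _)
  have h2 : (φ.symm ∘ φ : M → M) = id := by ext x; simp
  rw [h2] at h1
  have h3 := congrArg (fun L : Plane →L[ℝ] Plane => L a) (h1.symm.trans mfderiv_id)
  exact h3

theorem IsIsometry.surjective_mfderiv {φ : M ≃ₜ M} (hφ : g.IsIsometry φ) (n : M) :
    Function.Surjective (mfderiv (𝓡 2) (𝓡 2) φ n) := by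
  have hl := hφ.mfderiv_symm_mfderiv
  let L : Plane →L[ℝ] Plane := mfderiv (𝓡 2) (𝓡 2) φ n
  have hinj : Function.Injective L := fun x y hxy =>
    (hl n x).symm.trans ((congrArg (mfderiv (𝓡 2) (𝓡 2) φ.symm (φ n)) hxy).trans (hl n y))
  exact LinearMap.surjective_of_injective (f := (L : Plane →ₗ[ℝ] Plane)) hinj

theorem IsIsometry.inv {φ : M ≃ₜ M} (hφ : g.IsIsometry φ) : g.IsIsometry φ⁻¹ := by
  have hl := hφ.mfderiv_symm_mfderiv
  have hs := hφ.surjective_mfderiv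
  have key : ∀ (n n' : M), n' = n → ∀ a b : Plane,
      g.metric n' a b = g.metric n a b ∧ g.area n' a b = g.area n a b ∧
      (g.FutureDirected (m := n') a ↔ g.FutureDirected (m := n) a) := by
    rintro n _ rfl a b
    exact ⟨rfl, rfl, Iff.rfl⟩
  have hb : ∀ n : M, (φ⁻¹ : M ≃ₜ M) (φ n) = n := φ.symm_apply_apply
  refine ⟨hφ.contMDiff_symm, hφ.contMDiff, fun m a b => ?_, fun m a b => ?_, fun m a => ?_⟩
  · obtain ⟨n, rfl⟩ := φ.surjective m
    obtain ⟨a, rfl⟩ := hs n a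
    obtain ⟨b, rfl⟩ := hs n b
    rw [hφ.metric_eq]
    refine (key n _ (hb n) _ _).1.trans ?_
    exact congrArg₂ (fun x y : Plane => g.metric n x y) (hl n a) (hl n b)
  · obtain ⟨n, rfl⟩ := φ.surjective m
    obtain ⟨a, rfl⟩ := hs n a
    obtain ⟨b, rfl⟩ := hs n b
    rw [hφ.area_pos]
    refine (iff_of_eq (congrArg (0 < ·) (key n _ (hb n) _ _).2.1)).trans ?_
    exact iff_of_eq (congrArg₂ (fun x y : Plane => 0 < g.area n x y) (hl n a) (hl n b))
  · obtain ⟨n, rfl⟩ := φ.surjective m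
    obtain ⟨a, rfl⟩ := hs n a
    rw [hφ.future]
    refine (key n _ (hb n) _ 0).2.2.trans ?_
    exact iff_of_eq (congrArg (fun x : Plane => g.FutureDirected (m := n) x) (hl n a))

theorem IsIsometry.lightlike {φ : M ≃ₜ M} (hφ : g.IsIsometry φ) (i : Fin 2) {m : M}
    {u : TangentSpace (𝓡 2) m} (hu : g.Lightlike i u) :
    g.Lightlike i (m := φ m) (mfderiv (𝓡 2) (𝓡 2) φ m u) := by
  refine ⟨(hφ.metric_eq m u u).trans hu.1, (hφ.future m u).2 hu.2.1, fun w hw hw' => ?_⟩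
  obtain ⟨w, rfl⟩ := hφ.surjective_mfderiv m w
  rw [hφ.metric_eq] at hw
  have := hu.2.2 w hw ((hφ.future m w).1 hw')
  split_ifs with h
  · rw [if_pos h] at this; exact (hφ.area_pos m u w).2 this
  · rw [if_neg h] at this; exact (hφ.area_pos m w u).2 this

theorem IsIsometry.leafStep {φ : M ≃ₜ M} (hφ : g.IsIsometry φ) (i : Fin 2) {a b : M}
    (h : g.LeafStep i a b) : g.LeafStep i (φ a) (φ b) := by
  obtain ⟨γ, hγ, hl, rfl, rfl⟩ := h
  refine ⟨φ ∘ γ, hφ.contMDiff.comp hγ, fun t => ?_, rfl, rfl⟩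
  have h := mfderiv_comp t (hφ.contMDiff.mdifferentiable one_ne_zero _)
    (hγ.mdifferentiable one_ne_zero t)
  have h' := hφ.lightlike i (hl t)
  unfold velocity
  rw [h]
  exact h'

variable (g)

/-- The group of isometries preserving the orientation and the time orientation. -/
def isom : Subgroup (M ≃ₜ M) where
  carrier := {φ | g.IsIsometry φ}
  mul_mem' := IsIsometry.mul
  one_mem' := isIsometry_one
  inv_mem' := IsIsometry.inv

/-- The action of the isometry group on the space of leaves of the foliation `i`. -/
def leafAction (i : Fin 2) : g.isom →* (g.LeafSpace i ≃ₜ g.LeafSpace i) where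
  toFun φ :=
    { toFun := Quot.map φ.1 fun _ _ => φ.2.leafStep i
      invFun := Quot.map φ.1.symm fun _ _ => IsIsometry.leafStep φ.2.inv i
      left_inv := by rintro ⟨m⟩; exact congrArg (Quot.mk _) (φ.1.symm_apply_apply m)
      right_inv := by rintro ⟨m⟩; exact congrArg (Quot.mk _) (φ.1.apply_symm_apply m)
      continuous_toFun := continuous_quot_lift _ (continuous_quot_mk.comp φ.1.continuous)
      continuous_invFun := continuous_quot_lift _ (continuous_quot_mk.comp φ.1.symm.continuous) }
  map_one' := by ext ⟨m⟩; rfl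
  map_mul' φ ψ := by ext ⟨m⟩; rfl

/-- The representation of the isometry group in the group of circle homeomorphisms obtained from
its action on the space of leaves of the foliation `i`, identified with the circle by `α`. -/
def rho (i : Fin 2) (α : g.LeafSpace i ≃ₜ S1) : g.isom →* (S1 ≃ₜ S1) where
  toFun φ := (α.symm.trans (g.leafAction i φ)).trans α
  map_one' := by ext x; simp
  map_mul' φ ψ := by ext x; simp

end LorentzSurface

/-! ## The conformal boundary -/

/-- The vertical slices of `U ⊂ ℝ²` are the non empty intervals `(lo x, hi x)`. -/
def SliceBounds (U : Set (ℝ × ℝ)) (lo hi : ℝ → EReal) : Prop :=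
  ∀ x : ℝ, lo x < hi x ∧ ∀ y : ℝ, (x, y) ∈ U ↔ lo x < (y : EReal) ∧ (y : EReal) < hi x

/-- `H : ℝ → ℝ ∪ {±∞}` is either a homeomorphism of `ℝ` or infinite. -/
def HomeoOrInfinite (H : ℝ → EReal) : Prop :=
  (∃ F : ℝ ≃ₜ ℝ, ∀ x, H x = (F x : EReal)) ∨ (∀ x, H x = ⊥) ∨ ∀ x, H x = ⊤

/-- The circle homeomorphism `h` is induced by the finite values of `H : ℝ → ℝ ∪ {±∞}`. -/
def Induces (H : ℝ → EReal) (h : S1 ≃ₜ S1) : Prop :=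
  ∀ x r : ℝ, H x = (r : EReal) → h (x : S1) = (r : S1)

end LorentzConvergence

end

open LorentzConvergence

set_option linter.unusedSectionVars false

noncomputable section

namespace LorentzConvergence

variable {M : Type*} [TopologicalSpace M] [ChartedSpace Plane M]

variable [IsManifold (𝓡 2) ∞ M]

/-! ### Local null coordinates and continuity of tensors along maps. -/

section

/-! The image of the universal cover is a region `D x < y < T x`, where `D` and `T` are increasing
homeomorphisms of the line commuting with `x ↦ x + 1` (`exists_boundedBy`). Infinite or decreasing
boundary functions would produce closed causal curves, which a Cauchy hypersurface forbids;
injectivity of the map to the torus gives `T ≤ D + 1`. Hence `H = D⁻¹ ∘ T` lifts `h_{→↑}` and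
satisfies `x < H x ≤ x + 1`.

In these coordinates the metric is `ρ dx dy` with `ρ` positive and continuous. An isometry lifts to
a product map `(F, F')` preserving the region, both boundary graphs and the area `ρ dx dy`
(`exists_areaPreserving`). So `F' = D ∘ F ∘ D⁻¹`, and `F` commutes with `H`. Writing `y = D z` turns
the region into `x < z < H x`, with the same `F` acting on both factors: what remains is a statement
about homeomorphisms of the line, recorded in `PreservesArea`.

Given a sequence, a subsequence of the lifts converges on the rationals to a nondecreasing `l`. If
`l` has no jump, the subsequence is equicontinuous (`eventually_small`). If `l` jumps at `a`,
consider thin rectangles `[a - ε, a + ε] × [c, d]` with `a < c < d < H a`. Their areas tend to `0`;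
but if `l c < l d`, suitable images of them contain one fixed rectangle of positive area. So `l` is
constant on `(a, H a)`, and symmetrically on `(H⁻¹ a, a)` (`eq_right`, `eq_left`). Commutation with
`H` spreads this along the orbit of `a`, and compatibility with `x ↦ x + 1` forces the jump at `a +
1` to lie on that orbit: `H^[j] a = a + 1` (`exists_step`). Then `H` has translation number `1 / j`,
so `j = k`, and the step function is exactly the `(h, k)`-convergence property. -/

theorem differential_eq_fderiv {u : M → ℝ} {m : M} (hu : MDifferentiableAt (𝓡 2) 𝓘(ℝ, ℝ) u m)
    (a : Plane) :
    differential u m a = fderiv ℝ (u ∘ (extChartAt (𝓡 2) m).symm) (extChartAt (𝓡 2) m m) a := by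
  refine (congrArg (fun L : Plane →L[ℝ] ℝ => L a) hu.mfderiv).trans ?_
  simp only [ModelWithCorners.range_eq_univ, fderivWithin_univ]
  rfl

/-- The inverse function theorem in a chart: independence of the two differentials makes the
derivative injective, hence invertible by equality of dimensions. -/
theorem exists_local_inverse {u v : M → ℝ} {m : M}
    (hu : ContMDiffAt (𝓡 2) 𝓘(ℝ, ℝ) 1 u m) (hv : ContMDiffAt (𝓡 2) 𝓘(ℝ, ℝ) 1 v m)
    (hinj : ∀ a : TangentSpace (𝓡 2) m, differential u m a = 0 → differential v m a = 0 → a = 0) :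
    ∃ s : ℝ × ℝ → M, ContMDiffAt 𝓘(ℝ, ℝ × ℝ) (𝓡 2) 1 s (u m, v m) ∧ s (u m, v m) = m ∧
      (∀ᶠ q in 𝓝 (u m, v m), u (s q) = q.1 ∧ v (s q) = q.2) ∧
      ∀ᶠ m' in 𝓝 m, s (u m', v m') = m' := by
  set φ := extChartAt (𝓡 2) m with hφ
  have hφs : φ.symm (φ m) = m := extChartAt_to_inv m
  have hmi : ContMDiffAt 𝓘(ℝ, Plane) (𝓡 2) 1 φ.symm (φ m) :=
    (contMDiffOn_extChartAt_symm (n := 1) m).contMDiffAt (extChartAt_target_mem_nhds m)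
  have hm' : m = φ.symm (φ m) := hφs.symm
  have hu1 : ContMDiffAt 𝓘(ℝ, Plane) 𝓘(ℝ, ℝ) 1 (u ∘ φ.symm) (φ m) :=
    ContMDiffAt.comp_of_eq hu hmi hφs
  have hv1 : ContMDiffAt 𝓘(ℝ, Plane) 𝓘(ℝ, ℝ) 1 (v ∘ φ.symm) (φ m) :=
    ContMDiffAt.comp_of_eq hv hmi hφs
  have hu2 := hu1.contDiffAt
  have hv2 := hv1.contDiffAt
  have hdu : ∀ a : Plane, fderiv ℝ (u ∘ φ.symm) (φ m) a = differential u m a :=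
    fun a => (differential_eq_fderiv (hu.mdifferentiableAt one_ne_zero) a).symm
  have hdv : ∀ a : Plane, fderiv ℝ (v ∘ φ.symm) (φ m) a = differential v m a :=
    fun a => (differential_eq_fderiv (hv.mdifferentiableAt one_ne_zero) a).symm
  set Φ : Plane → ℝ × ℝ := fun x => (u (φ.symm x), v (φ.symm x)) with hΦ
  have hΦ2 : ContDiffAt ℝ 1 Φ (φ m) := hu2.prodMk hv2
  set L : Plane →L[ℝ] ℝ × ℝ :=
    (fderiv ℝ (u ∘ φ.symm) (φ m)).prod (fderiv ℝ (v ∘ φ.symm) (φ m)) with hL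
  have hLi : Function.Injective L := by
    rw [injective_iff_map_eq_zero]
    intro a ha
    have h1 : fderiv ℝ (u ∘ φ.symm) (φ m) a = 0 := congrArg Prod.fst ha
    have h2 : fderiv ℝ (v ∘ φ.symm) (φ m) a = 0 := congrArg Prod.snd ha
    rw [hdu] at h1
    rw [hdv] at h2
    exact hinj a h1 h2
  let L' : Plane ≃L[ℝ] ℝ × ℝ :=
    (LinearEquiv.ofInjectiveOfFinrankEq (L : Plane →ₗ[ℝ] ℝ × ℝ) hLi (by simp)).toContinuousLinearEquiv
  have hD : HasFDerivAt Φ (L' : Plane →L[ℝ] ℝ × ℝ) (φ m) := by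
    have h : HasFDerivAt Φ L (φ m) :=
      (hu2.differentiableAt one_ne_zero).hasFDerivAt.prodMk
        (hv2.differentiableAt one_ne_zero).hasFDerivAt
    convert h using 1
    ext x <;> rfl
  have hΦm : Φ (φ m) = (u m, v m) := by simp [hΦ, hφs]
  set h := hΦ2.toOpenPartialHomeomorph Φ hD one_ne_zero with hh
  have hcoe : (h : Plane → ℝ × ℝ) = Φ := rfl
  have hsrc : φ m ∈ h.source := hΦ2.mem_toOpenPartialHomeomorph_source hD one_ne_zero
  have hinv : ContDiffAt ℝ 1 (hΦ2.localInverse hD one_ne_zero) (Φ (φ m)) :=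
    hΦ2.to_localInverse hD one_ne_zero
  have hinv' : ContDiffAt ℝ 1 h.symm (u m, v m) := by rw [← hΦm]; exact hinv
  have htgt : (u m, v m) ∈ h.target := by rw [← hΦm]; exact h.map_source hsrc
  have hsym : h.symm (u m, v m) = φ m := by rw [← hΦm]; exact h.left_inv hsrc
  refine ⟨φ.symm ∘ h.symm, ?_, ?_, ?_, ?_⟩
  · exact ContMDiffAt.comp_of_eq hmi hinv'.contMDiffAt hsym
  · simp [hsym, hφs]
  · filter_upwards [h.open_target.mem_nhds htgt] with q hq
    have := h.right_inv hq
    rw [hcoe] at this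
    exact ⟨congrArg Prod.fst this, congrArg Prod.snd this⟩
  · filter_upwards [(continuousAt_extChartAt (I := 𝓡 2) m).preimage_mem_nhds (h.open_source.mem_nhds hsrc),
      extChartAt_source_mem_nhds (I := 𝓡 2) m] with m' h1 h2
    have h3 : φ.symm (φ m') = m' := φ.left_inv h2
    have h4 := h.left_inv h1
    rw [hcoe] at h4
    have h5 : Φ (extChartAt (𝓡 2) m m') = (u m', v m') := by
      change (u (φ.symm (φ m')), v (φ.symm (φ m'))) = _
      rw [h3]
    rw [h5] at h4
    simp only [Function.comp_apply]
    rw [h4, ← hφ, h3]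

/-- A continuous section of a bundle of bilinear forms, evaluated on continuous vector fields
along a map, is a continuous function. -/
theorem continuousOn_bilin_apply
    {B : ∀ m : M, TangentSpace (𝓡 2) m →L[ℝ] TangentSpace (𝓡 2) m →L[ℝ] ℝ}
    (hB : ContMDiff (𝓡 2) ((𝓡 2).prod 𝓘(ℝ, Plane →L[ℝ] Plane →L[ℝ] ℝ)) 0
      (fun m => Bundle.TotalSpace.mk' (Plane →L[ℝ] Plane →L[ℝ] ℝ)
        (E := fun m : M => TangentSpace (𝓡 2) m →L[ℝ] TangentSpace (𝓡 2) m →L[ℝ] ℝ) m (B m)))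
    {s : ℝ × ℝ → M} {V : Set (ℝ × ℝ)} (hs : ContinuousOn s V)
    {v w : ∀ y : ℝ × ℝ, TangentSpace (𝓡 2) (s y)}
    (hv : ContinuousOn (fun y => (⟨s y, v y⟩ : TangentBundle (𝓡 2) M)) V)
    (hw : ContinuousOn (fun y => (⟨s y, w y⟩ : TangentBundle (𝓡 2) M)) V) :
    ContinuousOn (fun y => B (s y) (v y) (w y)) V := by
  have h0 : ContMDiffOn 𝓘(ℝ, ℝ × ℝ) (𝓡 2) 0 s V := contMDiffOn_zero_iff.2 hs
  have h1 : ContMDiffOn 𝓘(ℝ, ℝ × ℝ) ((𝓡 2).prod 𝓘(ℝ, Plane →L[ℝ] Plane →L[ℝ] ℝ)) 0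
      (fun y => Bundle.TotalSpace.mk' (Plane →L[ℝ] Plane →L[ℝ] ℝ)
        (E := fun m : M => TangentSpace (𝓡 2) m →L[ℝ] TangentSpace (𝓡 2) m →L[ℝ] ℝ)
        (s y) (B (s y))) V := hB.comp_contMDiffOn h0
  have h2 := ContMDiffOn.clm_bundle_apply₂ (F₁ := Plane) (F₂ := Plane) (F₃ := ℝ)
    (E₁ := fun m : M => TangentSpace (𝓡 2) m) (E₂ := fun m : M => TangentSpace (𝓡 2) m)
    (E₃ := Bundle.Trivial M ℝ) h1 (v := v) (w := w)
    (contMDiffOn_zero_iff.2 hv) (contMDiffOn_zero_iff.2 hw)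
  intro y hy
  exact ((FiberBundle.continuousWithinAt_totalSpace _ _ |>.1 (h2.continuousOn y hy)).2)

theorem continuousOn_mfderiv_apply {s : ℝ × ℝ → M} {V : Set (ℝ × ℝ)} (hV : IsOpen V)
    (hs : ContMDiffOn 𝓘(ℝ, ℝ × ℝ) (𝓡 2) 1 s V) (e : ℝ × ℝ) :
    ContinuousOn (fun q => (⟨s q, mfderiv 𝓘(ℝ, ℝ × ℝ) (𝓡 2) s q e⟩ : TangentBundle (𝓡 2) M)) V := by
  have h1 := hs.continuousOn_tangentMapWithin le_rfl hV.uniqueMDiffOn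
  have h2 : Continuous (fun q : ℝ × ℝ => (⟨q, e⟩ : TangentBundle 𝓘(ℝ, ℝ × ℝ) (ℝ × ℝ))) := by
    have h3 : Continuous (fun q : ℝ × ℝ =>
      (tangentBundleModelSpaceHomeomorph 𝓘(ℝ, ℝ × ℝ)).symm (q, e)) := by fun_prop
    exact h3
  refine (h1.comp h2.continuousOn (fun q hq => hq)).congr (fun q hq => ?_)
  simp only [Function.comp_apply, tangentMapWithin]
  rw [mfderivWithin_of_isOpen hV hq]

end

/-! ### Circle valued functions, their real lifts and their differentials. -/

section

theorem coe_eq_coe_iff {x y : ℝ} : ((x : S1) = (y : S1)) ↔ ∃ n : ℤ, x = y + n := by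
  rw [← sub_eq_zero, ← AddCircle.coe_sub, AddCircle.coe_eq_zero_iff]
  constructor
  · rintro ⟨n, hn⟩
    exact ⟨n, by simp only [zsmul_eq_mul, mul_one] at hn; linarith⟩
  · rintro ⟨n, hn⟩
    exact ⟨n, by simp only [zsmul_eq_mul, mul_one]; linarith⟩

/-- Two continuous lifts of the same circle valued map differ locally by an integer. -/
theorem eventually_eq_add_int {X : Type*} [TopologicalSpace X] {u v : X → ℝ} {x : X}
    (hu : ContinuousAt u x) (hv : ContinuousAt v x)
    (h : ∀ᶠ y in 𝓝 x, ((u y : ℝ) : S1) = (v y : ℝ)) :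
    ∃ n : ℤ, ∀ᶠ y in 𝓝 x, u y = v y + n := by
  obtain ⟨n, hn⟩ := coe_eq_coe_iff.1 h.self_of_nhds
  refine ⟨n, ?_⟩
  have h1 : ∀ᶠ y in 𝓝 x, |u y - v y - n| < 1 := by
    have h2 : ContinuousAt (fun y => |u y - v y - n|) x := ((hu.sub hv).sub_const _).abs
    refine h2.eventually_lt continuousAt_const ?_
    rw [hn]; simp
  filter_upwards [h, h1] with y hy hy'
  obtain ⟨k, hk⟩ := coe_eq_coe_iff.1 hy
  have h3 : |((k - n : ℤ) : ℝ)| < 1 := by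
    rw [hk] at hy'; push_cast; convert hy' using 2; ring
  have h4 : k - n = 0 := by
    rw [← Int.abs_lt_one_iff]; exact_mod_cast h3
  rw [hk, sub_eq_zero.1 h4]

/-- On a preconnected space two continuous lifts of the same circle valued map differ by an
integer. -/
theorem exists_eq_add_int {X : Type*} [TopologicalSpace X] [PreconnectedSpace X] [Nonempty X]
    {u v : X → ℝ} (hu : Continuous u) (hv : Continuous v)
    (h : ∀ y, ((u y : ℝ) : S1) = (v y : ℝ)) : ∃ n : ℤ, ∀ y, u y = v y + n := by
  have hl : IsLocallyConstant (fun y => u y - v y) := by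
    rw [IsLocallyConstant.iff_eventually_eq]
    intro x
    obtain ⟨n, hn⟩ := eventually_eq_add_int hu.continuousAt hv.continuousAt (Filter.Eventually.of_forall h) (x := x)
    filter_upwards [hn] with y hy
    rw [hy, hn.self_of_nhds]; ring
  obtain ⟨x⟩ := ‹Nonempty X›
  obtain ⟨n, hn⟩ := coe_eq_coe_iff.1 (h x)
  refine ⟨n, fun y => ?_⟩
  have := hl.apply_eq_of_preconnectedSpace x y
  linarith

theorem exists_real_lift {θ : ℝ → S1} (hθ : Continuous θ) :
    ∃ r : ℝ → ℝ, Continuous r ∧ ∀ t, ((r t : ℝ) : S1) = θ t := by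
  obtain ⟨r0, hr0⟩ := QuotientAddGroup.mk_surjective (θ 0)
  obtain ⟨F, ⟨-, hF⟩, -⟩ := (AddCircle.isCoveringMap_coe (1 : ℝ)).existsUnique_continuousMap_lifts
    (⟨θ, hθ⟩ : C(ℝ, S1)) 0 r0 hr0
  exact ⟨F, F.continuous, fun t => congrFun hF t⟩

/-- `u` is a `C¹` lift of the circle valued function `θ` near `m`. -/
def HasLiftAt (θ : M → S1) (u : M → ℝ) (m : M) : Prop :=
  ContMDiffAt (𝓡 2) 𝓘(ℝ, ℝ) 1 u m ∧ ∀ᶠ m' in 𝓝 m, θ m' = ((u m' : ℝ) : S1)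

/-- `θ` is a `C¹` circle valued function. -/
def IsAngle (θ : M → S1) : Prop := ∀ m, ∃ u : M → ℝ, HasLiftAt θ u m

open Classical in
/-- The differential of a circle valued function. -/
def angular (θ : M → S1) (m : M) : Plane →L[ℝ] ℝ :=
  if h : ∃ u : M → ℝ, HasLiftAt θ u m then mfderiv (𝓡 2) 𝓘(ℝ, ℝ) h.choose m else 0

theorem mfderiv_congr_add_const {u v : M → ℝ} {m : M} (c : ℝ) (hv : MDifferentiableAt (𝓡 2) 𝓘(ℝ, ℝ) v m)
    (h : ∀ᶠ m' in 𝓝 m, u m' = v m' + c) (a : Plane) :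
    differential u m a = differential v m a := by
  let L : Plane →L[ℝ] ℝ := mfderiv (𝓡 2) 𝓘(ℝ, ℝ) v m
  have h0 : HasMFDerivAt (𝓡 2) 𝓘(ℝ, ℝ) v m L := hv.hasMFDerivAt
  have h1 : HasMFDerivAt (𝓡 2) 𝓘(ℝ, ℝ) (fun m' => v m' + c) m (L + (0 : Plane →L[ℝ] ℝ)) :=
    h0.add (hasMFDerivAt_const c m)
  have h2 := (h1.congr_of_eventuallyEq (f₁ := u) h).mfderiv
  rw [add_zero] at h2
  exact congrArg (fun L : Plane →L[ℝ] ℝ => L a) h2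

/-- Two lifts differ locally by an integer, which the differential does not see; the choice made in
`angular` is therefore harmless. -/
theorem HasLiftAt.angular_eq {θ : M → S1} {u : M → ℝ} {m : M} (h : HasLiftAt θ u m) (a : Plane) :
    angular θ m a = differential u m a := by
  have hex : ∃ u : M → ℝ, HasLiftAt θ u m := ⟨u, h⟩
  have h1 := hex.choose_spec
  have h2 : ∀ᶠ m' in 𝓝 m, ((hex.choose m' : ℝ) : S1) = (u m' : ℝ) := by
    filter_upwards [h1.2, h.2] with m' ha hb
    rw [← ha, hb]
  obtain ⟨n, hn⟩ := eventually_eq_add_int h1.1.continuousAt h.1.continuousAt h2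
  have h3 : angular θ m a = differential hex.choose m a := by
    exact congrArg (fun L : Plane →L[ℝ] ℝ => L a) (dif_pos hex)
  rw [h3]
  exact mfderiv_congr_add_const n (h.1.mdifferentiableAt one_ne_zero) hn a

theorem HasLiftAt.neg {θ : M → S1} {u : M → ℝ} {m : M} (h : HasLiftAt θ u m) :
    HasLiftAt (fun m => -θ m) (fun m => -u m) m := by
  refine ⟨?_, ?_⟩
  · exact ContMDiffAt.comp (g := fun x : ℝ => -x) m (contDiff_neg.contMDiff.contMDiffAt) h.1
  · filter_upwards [h.2] with m' hm
    rw [hm]; simp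

theorem HasLiftAt.add_int {θ : M → S1} {u : M → ℝ} {m : M} (h : HasLiftAt θ u m) (n : ℤ) :
    HasLiftAt θ (fun m => u m + n) m := by
  refine ⟨?_, ?_⟩
  · exact ContMDiffAt.comp (g := fun x : ℝ => x + n) m
      ((contDiff_id.add contDiff_const).contMDiff.contMDiffAt) h.1
  · filter_upwards [h.2] with m' hm
    rw [hm, coe_eq_coe_iff]
    exact ⟨-n, by push_cast; ring⟩

theorem IsAngle.neg {θ : M → S1} (h : IsAngle θ) : IsAngle (fun m => -θ m) :=
  fun m => let ⟨_, hu⟩ := h m; ⟨_, hu.neg⟩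

theorem IsAngle.angular_neg {θ : M → S1} (h : IsAngle θ) (m : M) (a : Plane) :
    angular (fun m => -θ m) m a = - angular θ m a := by
  obtain ⟨u, hu⟩ := h m
  rw [hu.neg.angular_eq, hu.angular_eq]
  unfold differential
  have h1 := (hu.1.mdifferentiableAt one_ne_zero).hasMFDerivAt.neg.mfderiv
  exact congrArg (fun L : Plane →L[ℝ] ℝ => L a) h1

theorem IsAngle.exists_lift {θ : M → S1} (h : IsAngle θ) {m : M} {x : ℝ} (hx : θ m = (x : S1)) :
    ∃ u, HasLiftAt θ u m ∧ u m = x := by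
  obtain ⟨u, hu⟩ := h m
  have h1 := hu.2.self_of_nhds
  rw [hx] at h1
  obtain ⟨n, hn⟩ := coe_eq_coe_iff.1 h1
  exact ⟨_, hu.add_int n, hn.symm⟩

theorem IsAngle.continuous {θ : M → S1} (h : IsAngle θ) : Continuous θ := by
  rw [continuous_iff_continuousAt]
  intro m
  obtain ⟨u, hu⟩ := h m
  have h1 : ContinuousAt (fun m => ((u m : ℝ) : S1)) m :=
    (AddCircle.continuous_mk' (1 : ℝ)).continuousAt.comp hu.1.continuousAt
  exact h1.congr (hu.2.mono fun _ h => h.symm)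

/-- The differential of a map defined on a normed space, as a linear map into the model plane. -/
def push {X : Type*} [NormedAddCommGroup X] [NormedSpace ℝ X] (c : X → M) (x : X) :
    X →L[ℝ] Plane := mfderiv 𝓘(ℝ, X) (𝓡 2) c x

/-- The chain rule for circle valued functions. -/
theorem IsAngle.hasFDerivAt_iff {X : Type*} [NormedAddCommGroup X] [NormedSpace ℝ X]
    {θ : M → S1} (h : IsAngle θ) {c : X → M} {x : X}
    (hc : MDifferentiableAt 𝓘(ℝ, X) (𝓡 2) c x) {r : X → ℝ} {r' : X →L[ℝ] ℝ}
    (hr : ContinuousAt r x) (hrc : ∀ᶠ y in 𝓝 x, θ (c y) = ((r y : ℝ) : S1)) :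
    HasFDerivAt r r' x ↔
      ∀ a : X, angular θ (c x) (push c x a) = r' a := by
  obtain ⟨u, hu⟩ := h (c x)
  have h1 : ∀ᶠ y in 𝓝 x, ((r y : ℝ) : S1) = ((u (c y) : ℝ) : S1) := by
    filter_upwards [hrc, hc.continuousAt.eventually hu.2] with y h1 h2
    rw [← h1, h2]
  obtain ⟨n, hn⟩ := eventually_eq_add_int hr (hu.1.continuousAt.comp hc.continuousAt) h1
  have h2 := (hu.1.mdifferentiableAt one_ne_zero).hasMFDerivAt.comp x hc.hasMFDerivAt
  have h3 : HasFDerivAt (u ∘ c) ((mfderiv (𝓡 2) 𝓘(ℝ, ℝ) u (c x) : Plane →L[ℝ] ℝ).comp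
      (mfderiv 𝓘(ℝ, X) (𝓡 2) c x : X →L[ℝ] Plane)) x := h2.hasFDerivAt
  have h4 : HasFDerivAt r ((mfderiv (𝓡 2) 𝓘(ℝ, ℝ) u (c x) : Plane →L[ℝ] ℝ).comp
      (mfderiv 𝓘(ℝ, X) (𝓡 2) c x : X →L[ℝ] Plane)) x :=
    (h3.add_const (n : ℝ)).congr_of_eventuallyEq hn
  have key : ∀ a : X, angular θ (c x) (push c x a) =
    ((mfderiv (𝓡 2) 𝓘(ℝ, ℝ) u (c x) : Plane →L[ℝ] ℝ).comp
      (mfderiv 𝓘(ℝ, X) (𝓡 2) c x : X →L[ℝ] Plane)) a := fun a => hu.angular_eq _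
  constructor
  · intro h5 a
    rw [h5.unique h4]
    exact key a
  · intro h5
    rwa [ContinuousLinearMap.ext fun a => (h5 a).symm.trans (key a)]

end

/-! ### Null pairs: the metric as a multiple of a product of two differentials. -/

section

namespace LorentzSurface

variable (g : LorentzSurface M)

/-- The metric, on the model plane. -/
def met (m : M) : Plane →L[ℝ] Plane →L[ℝ] ℝ := g.metric m

/-- The area form, on the model plane. -/
def ar (m : M) : Plane →L[ℝ] Plane →L[ℝ] ℝ := g.area m

/-- The time orientation, in the model plane. -/
def tau (m : M) : Plane := g.time m

/-- Two circle valued functions such that `g` is a positive multiple of `dθ dϑ`. -/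
structure NullPair (θ ϑ : M → S1) : Prop where
  left : IsAngle θ
  right : IsAngle ϑ
  conformal (m : M) : ∃ c : ℝ, 0 < c ∧ ∀ a : Plane,
    g.met m a a = c * (angular θ m a * angular ϑ m a)

/-- The pair `(θ, ϑ)` is compatible with the orientation and the time orientation at `m`. -/
def Oriented (θ ϑ : M → S1) (m : M) : Prop :=
  angular θ m (g.tau m) < 0 ∧ 0 < angular ϑ m (g.tau m) ∧
    ∃ κ : ℝ, 0 < κ ∧ ∀ a b : Plane,
      g.ar m a b = κ * (angular θ m a * angular ϑ m b - angular ϑ m a * angular θ m b)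

variable {g}
variable {θ ϑ : M → S1}

namespace NullPair

theorem swap (h : g.NullPair θ ϑ) : g.NullPair ϑ θ := by
  refine ⟨h.right, h.left, fun m => ?_⟩
  obtain ⟨c, hc, hg⟩ := h.conformal m
  exact ⟨c, hc, fun a => by rw [hg a, mul_comm (angular θ m a)]⟩

theorem neg (h : g.NullPair θ ϑ) : g.NullPair (fun m => -θ m) (fun m => -ϑ m) := by
  refine ⟨h.left.neg, h.right.neg, fun m => ?_⟩
  obtain ⟨c, hc, hg⟩ := h.conformal m
  exact ⟨c, hc, fun a => by rw [hg a, h.left.angular_neg, h.right.angular_neg, neg_mul_neg]⟩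

theorem metric_eq (h : g.NullPair θ ϑ) (m : M) : ∃ c : ℝ, 0 < c ∧ ∀ a b : Plane,
    g.met m a b =
      c / 2 * (angular θ m a * angular ϑ m b + angular ϑ m a * angular θ m b) := by
  obtain ⟨c, hc, hg⟩ := h.conformal m
  refine ⟨c, hc, fun a b => ?_⟩
  have h1 := hg (a + b)
  have h2 := hg a
  have h3 := hg b
  have h4 : g.met m (a + b) (a + b) = g.met m a a + g.met m a b + (g.met m b a + g.met m b b) := by
    simp only [map_add, add_apply]; ring
  have h5 : g.met m b a = g.met m a b := g.symm m b a
  rw [h4, h5, map_add, map_add] at h1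
  linarith

/-- A product of two proportional linear forms cannot take both signs, whereas the signature
supplies a vector of each sign. The two differentials are thus independent, and the witness comes
from Cramer's rule. -/
theorem exists_vector (h : g.NullPair θ ϑ) (m : M) (x y : ℝ) :
    ∃ a : Plane, angular θ m a = x ∧ angular ϑ m a = y := by
  obtain ⟨c, hc, hg⟩ := h.conformal m
  obtain ⟨u, v, hu, hv⟩ : ∃ u v : Plane, g.met m u u < 0 ∧ 0 < g.met m v v := g.signature m
  have hu' := (hg u).symm.trans_lt hu
  have hv' := hv.trans_eq (hg v)
  set p := angular θ m u
  set q := angular ϑ m u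
  set r := angular θ m v
  set s := angular ϑ m v
  have h1 : p * q < 0 := by by_contra! h; nlinarith [mul_nonneg hc.le h]
  have h2 : 0 < r * s := by by_contra! h; nlinarith [mul_nonneg hc.le (neg_nonneg.2 h)]
  -- If `p * s = q * r`, then `(p * s) * (q * r) = (p * q) * (r * s) < 0` would be a square.
  have hd : p * s - q * r ≠ 0 := by
    intro h0
    have h3 : (p * s) * (q * r) < 0 := by nlinarith [mul_pos (neg_pos.2 h1) h2]
    rw [sub_eq_zero.1 h0] at h3
    exact absurd h3 (not_lt.2 (mul_self_nonneg _))
  refine ⟨((x * s - y * r) / (p * s - q * r)) • u +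
    ((p * y - q * x) / (p * s - q * r)) • v, ?_, ?_⟩
  · rw [map_add, map_smul, map_smul]
    change _ * p + _ * r = x
    rw [div_mul_eq_mul_div, div_mul_eq_mul_div, ← add_div, div_eq_iff hd]
    ring
  · rw [map_add, map_smul, map_smul]
    change _ * q + _ * s = y
    rw [div_mul_eq_mul_div, div_mul_eq_mul_div, ← add_div, div_eq_iff hd]
    ring

theorem eq_zero (h : g.NullPair θ ϑ) {m : M} {a : Plane} (h1 : angular θ m a = 0)
    (h2 : angular ϑ m a = 0) : a = 0 := by
  let L : Plane →ₗ[ℝ] ℝ × ℝ := ((angular θ m : Plane →L[ℝ] ℝ) : Plane →ₗ[ℝ] ℝ).prod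
    ((angular ϑ m : Plane →L[ℝ] ℝ) : Plane →ₗ[ℝ] ℝ)
  have hs : Function.Surjective L := by
    rintro ⟨x, y⟩
    obtain ⟨a, ha, hb⟩ := h.exists_vector m x y
    exact ⟨a, Prod.ext ha hb⟩
  have hi : Function.Injective L :=
    (LinearMap.injective_iff_surjective_of_finrank_eq_finrank (by simp)).2 hs
  exact hi ((Prod.ext h1 h2 : L a = (0, 0)).trans (map_zero L).symm)

theorem ext (h : g.NullPair θ ϑ) {m : M} {a b : Plane} (h1 : angular θ m a = angular θ m b)
    (h2 : angular ϑ m a = angular ϑ m b) : a = b :=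
  sub_eq_zero.1 (h.eq_zero (m := m) (by rw [map_sub, h1, sub_self]) (by rw [map_sub, h2, sub_self]))

/-- Alternating bilinear forms on a plane form a line; the coefficient is the value on the basis
dual to the two differentials. -/
theorem area_eq (h : g.NullPair θ ϑ) (m : M) : ∃ κ : ℝ, κ ≠ 0 ∧ ∀ a b : Plane,
    g.ar m a b = κ * (angular θ m a * angular ϑ m b - angular ϑ m a * angular θ m b) := by
  obtain ⟨e, he1, he2⟩ := h.exists_vector m 1 0
  obtain ⟨f, hf1, hf2⟩ := h.exists_vector m 0 1
  set A := g.ar m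
  have hA : ∀ a, A a a = 0 := g.area_self m
  have hfe : A f e = - A e f := by
    have h1 := hA (e + f)
    simp only [map_add, add_apply] at h1
    rw [hA, hA] at h1
    linarith
  have key : ∀ a b : Plane,
      A a b = A e f * (angular θ m a * angular ϑ m b - angular ϑ m a * angular θ m b) := by
    intro a b
    have hx : ∀ a : Plane, a = angular θ m a • e + angular ϑ m a • f := fun a =>
      h.ext (m := m) (by simp [he1, hf1]) (by simp [he2, hf2])
    conv_lhs => rw [hx a, hx b]
    simp only [map_add, map_smul, add_apply, smul_apply,
      smul_eq_mul, hA, hfe]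
    ring
  refine ⟨A e f, fun h0 => g.area_ne_zero m ?_, key⟩
  have : A = 0 := by
    ext a b
    rw [key, h0]; simp
  exact this

theorem time_mul_neg (h : g.NullPair θ ϑ) (m : M) :
    angular θ m (g.tau m) * angular ϑ m (g.tau m) < 0 := by
  obtain ⟨c, hc, hg⟩ := h.conformal m
  have h1 := (hg (g.tau m)).symm.trans_lt (g.timelike_time m)
  by_contra! h2
  nlinarith [mul_nonneg hc.le h2]

/-- Local sections of `(θ, ϑ)`. -/
theorem exists_section (h : g.NullPair θ ϑ) {m : M} {x y : ℝ} (hx : θ m = (x : S1))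
    (hy : ϑ m = (y : S1)) :
    ∃ (V : Set (ℝ × ℝ)) (s : ℝ × ℝ → M), IsOpen V ∧ (x, y) ∈ V ∧ s (x, y) = m ∧
      ContMDiffOn 𝓘(ℝ, ℝ × ℝ) (𝓡 2) 1 s V ∧
      (∀ q ∈ V, θ (s q) = ((q.1 : ℝ) : S1) ∧ ϑ (s q) = ((q.2 : ℝ) : S1)) ∧
      ∀ W ∈ 𝓝 (x, y), s '' W ∈ 𝓝 m := by
  obtain ⟨u, hu, hux⟩ := h.left.exists_lift hx
  obtain ⟨v, hv, hvy⟩ := h.right.exists_lift hy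
  obtain ⟨s, hs, hsm, hs1, hs2⟩ := exists_local_inverse hu.1 hv.1 (fun a h1 h2 =>
    h.eq_zero ((hu.angular_eq a).trans h1) ((hv.angular_eq a).trans h2))
  rw [hux, hvy] at hs hsm hs1
  have e1 : ∀ᶠ q in 𝓝 (x, y), ContMDiffAt 𝓘(ℝ, ℝ × ℝ) (𝓡 2) 1 s q :=
    (contMDiffAt_iff_contMDiffAt_nhds (by simp)).1 hs
  have hsc : Filter.Tendsto s (𝓝 (x, y)) (𝓝 m) := by
    have := hs.continuousAt
    rwa [ContinuousAt, hsm] at this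
  have e2 := hsc.eventually hu.2
  have e3 := hsc.eventually hv.2
  obtain ⟨V, hV, hVo, hVm⟩ := eventually_nhds_iff.1 (e1.and (hs1.and (e2.and e3)))
  refine ⟨V, s, hVo, hVm, hsm, fun q hq => (hV q hq).1.contMDiffWithinAt, fun q hq => ?_, ?_⟩
  · obtain ⟨-, h1, h2, h3⟩ := hV q hq
    rw [h2, h3, h1.1, h1.2]
    exact ⟨rfl, rfl⟩
  · intro W hW
    have huv : Filter.Tendsto (fun m' => (u m', v m')) (𝓝 m) (𝓝 (x, y)) := by
      have := hu.1.continuousAt.prodMk hv.1.continuousAt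
      rwa [ContinuousAt, hux, hvy] at this
    filter_upwards [hs2, huv.eventually hW] with m' h1 h2
    exact ⟨_, h2, h1⟩

theorem angular_section (h : g.NullPair θ ϑ) {V : Set (ℝ × ℝ)} {s : ℝ × ℝ → M} (hV : IsOpen V)
    (hs : ContMDiffOn 𝓘(ℝ, ℝ × ℝ) (𝓡 2) 1 s V)
    (hsV : ∀ q ∈ V, θ (s q) = ((q.1 : ℝ) : S1) ∧ ϑ (s q) = ((q.2 : ℝ) : S1)) {q : ℝ × ℝ}
    (hq : q ∈ V) (a : ℝ × ℝ) :
    angular θ (s q) (push s q a) = a.1 ∧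
      angular ϑ (s q) (push s q a) = a.2 := by
  have hd : MDifferentiableAt 𝓘(ℝ, ℝ × ℝ) (𝓡 2) s q :=
    (hs.contMDiffAt (hV.mem_nhds hq)).mdifferentiableAt one_ne_zero
  constructor
  · exact (h.left.hasFDerivAt_iff hd continuous_fst.continuousAt
      (Filter.mem_of_superset (hV.mem_nhds hq) fun y hy => (hsV y hy).1)).1 hasFDerivAt_fst a
  · exact (h.right.hasFDerivAt_iff hd continuous_snd.continuousAt
      (Filter.mem_of_superset (hV.mem_nhds hq) fun y hy => (hsV y hy).2)).1 hasFDerivAt_snd a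

/-- The differentials are defined pointwise by choice, so their signs are read off continuous
quantities instead: the metric and the area form evaluated on the coordinate fields of a local
section and on the time orientation. -/
theorem isOpen_oriented (h : g.NullPair θ ϑ) : IsOpen {m | g.Oriented θ ϑ m} := by
  rw [isOpen_iff_mem_nhds]
  intro m hm
  obtain ⟨x, hx⟩ := QuotientAddGroup.mk_surjective (θ m)
  obtain ⟨y, hy⟩ := QuotientAddGroup.mk_surjective (ϑ m)
  obtain ⟨V, s, hV, hmV, hsm, hs, hsV, hm'⟩ := h.exists_section hx.symm hy.symm
  have hds := fun q hq a => h.angular_section hV hs hsV (q := q) hq a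
  have htime : ContinuousOn (fun q => (⟨s q, g.time (s q)⟩ : TangentBundle (𝓡 2) M)) V :=
    g.continuous_time.comp_continuousOn hs.continuousOn
  have hg0 := g.contMDiff_metric.of_le (show (0 : WithTop ℕ∞) ≤ 2 by norm_num)
  have c1 : ContinuousOn (fun q => g.met (s q) (push s q (1, 0)) (g.tau (s q))) V := continuousOn_bilin_apply hg0 hs.continuousOn
    (continuousOn_mfderiv_apply hV hs (1, 0)) htime
  have c2 : ContinuousOn (fun q => g.met (s q) (push s q (0, 1)) (g.tau (s q))) V := continuousOn_bilin_apply hg0 hs.continuousOn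
    (continuousOn_mfderiv_apply hV hs (0, 1)) htime
  have c3 : ContinuousOn (fun q => g.ar (s q) (push s q (1, 0)) (push s q (0, 1))) V := continuousOn_bilin_apply g.contMDiff_area hs.continuousOn
    (continuousOn_mfderiv_apply hV hs (1, 0)) (continuousOn_mfderiv_apply hV hs (0, 1))
  have d1 : ∀ q ∈ V, 0 < g.met (s q) (push s q (1, 0)) (g.tau (s q)) ↔
      0 < angular ϑ (s q) (g.tau (s q)) := by
    intro q hq
    obtain ⟨c, hc, hg⟩ := h.metric_eq (s q)
    rw [hg, (hds q hq _).1, (hds q hq _).2]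
    simp [hc]
  have d2 : ∀ q ∈ V, g.met (s q) (push s q (0, 1)) (g.tau (s q)) < 0 ↔
      angular θ (s q) (g.tau (s q)) < 0 := by
    intro q hq
    obtain ⟨c, hc, hg⟩ := h.metric_eq (s q)
    rw [hg, (hds q hq _).1, (hds q hq _).2]
    simp only [zero_mul, one_mul, zero_add, mul_neg_iff]
    constructor
    · rintro (h1 | h1)
      · exact h1.2
      · linarith [h1.1]
    · exact fun h1 => Or.inl ⟨by linarith, h1⟩
  have d3 : ∀ q ∈ V, 0 < g.ar (s q) (push s q (1, 0))
      (push s q (0, 1)) ↔ ∃ κ : ℝ, 0 < κ ∧ ∀ a b : Plane,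
      g.ar (s q) a b = κ * (angular θ (s q) a * angular ϑ (s q) b -
        angular ϑ (s q) a * angular θ (s q) b) := by
    intro q hq
    obtain ⟨κ, -, hκ⟩ := h.area_eq (s q)
    constructor
    · intro h1
      refine ⟨κ, ?_, hκ⟩
      rw [hκ, (hds q hq _).1, (hds q hq _).2, (hds q hq _).1, (hds q hq _).2] at h1
      simpa using h1
    · rintro ⟨κ, hκ0, hκ⟩
      rw [hκ, (hds q hq _).1, (hds q hq _).2, (hds q hq _).1, (hds q hq _).2]
      simpa using hκ0
  have hor : ∀ q ∈ V, g.Oriented θ ϑ (s q) ↔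
      (0 < g.met (s q) (push s q (1, 0)) (g.tau (s q)) ∧
      g.met (s q) (push s q (0, 1)) (g.tau (s q)) < 0 ∧
      0 < g.ar (s q) (push s q (1, 0))
        (push s q (0, 1))) := by
    intro q hq
    rw [d1 q hq, d2 q hq, d3 q hq, Oriented]
    tauto
  obtain ⟨p1, p2, p3⟩ := (hor _ hmV).1 (by rw [hsm]; exact hm)
  have e1 := (c1.continuousAt (hV.mem_nhds hmV)).eventually (lt_mem_nhds p1)
  have e2 := (c2.continuousAt (hV.mem_nhds hmV)).eventually (gt_mem_nhds p2)
  have e3 := (c3.continuousAt (hV.mem_nhds hmV)).eventually (lt_mem_nhds p3)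
  refine Filter.mem_of_superset (hm' _ (Filter.inter_mem (hV.mem_nhds hmV) (e1.and (e2.and e3)))) ?_
  rintro _ ⟨q, ⟨hqV, hq⟩, rfl⟩
  exact (hor q hqV).2 hq

end NullPair

end LorentzSurface

end

/-! ### Orientation of null pairs and the lightlike foliations. -/

section

namespace LorentzSurface

variable {g : LorentzSurface M} {θ ϑ : M → S1}

namespace NullPair

theorem future_iff (h : g.NullPair θ ϑ) {m : M} (ho : g.Oriented θ ϑ m) (u : Plane) :
    g.FutureDirected (m := m) u ↔
      angular θ m u ≤ 0 ∧ 0 ≤ angular ϑ m u ∧ (angular θ m u ≠ 0 ∨ angular ϑ m u ≠ 0) := by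
  obtain ⟨c, hc, hg⟩ := h.metric_eq m
  obtain ⟨h1, h2, -⟩ := ho
  change g.met m u u ≤ 0 ∧ g.met m u (g.tau m) < 0 ↔ _
  rw [hg, hg]
  set p := angular θ m u
  set q := angular ϑ m u
  set t := angular θ m (g.tau m)
  set r := angular ϑ m (g.tau m)
  have hc2 : 0 < c / 2 := by linarith
  have e1 : c / 2 * (p * q + q * p) ≤ 0 ↔ p * q ≤ 0 := by
    rw [mul_nonpos_iff_pos_imp_nonpos]
    constructor
    · intro h; linarith [h.1 hc2]
    · intro h; exact ⟨fun _ => by linarith, fun _ => hc2.le⟩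
  have e2 : c / 2 * (p * r + q * t) < 0 ↔ p * r + q * t < 0 := by
    rw [mul_neg_iff]
    constructor
    · rintro (h | h) <;> linarith
    · exact fun h => Or.inl ⟨hc2, h⟩
  rw [e1, e2]
  constructor
  · rintro ⟨h3, h4⟩
    have hp : p ≤ 0 := by
      by_contra! hp
      have : q ≤ 0 := by by_contra! hq; nlinarith
      nlinarith [mul_nonneg_of_nonpos_of_nonpos this h1.le, mul_pos hp h2]
    have hq : 0 ≤ q := by
      by_contra! hq
      have : p = 0 := by
        by_contra! hp'
        nlinarith [mul_pos_of_neg_of_neg (lt_of_le_of_ne hp hp') hq]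
      rw [this] at h4
      nlinarith [mul_pos_of_neg_of_neg hq h1]
    refine ⟨hp, hq, ?_⟩
    by_contra! h0
    rw [h0.1, h0.2] at h4
    simp at h4
  · rintro ⟨hp, hq, h0⟩
    refine ⟨mul_nonpos_of_nonpos_of_nonneg hp hq, ?_⟩
    rcases h0 with h0 | h0
    · have := mul_neg_of_neg_of_pos (lt_of_le_of_ne hp h0) h2
      nlinarith [mul_nonpos_of_nonneg_of_nonpos hq h1.le]
    · have := mul_neg_of_pos_of_neg (lt_of_le_of_ne hq (Ne.symm h0)) h1
      nlinarith [mul_nonpos_of_nonpos_of_nonneg hp h2.le]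

theorem timelike_future_iff (h : g.NullPair θ ϑ) {m : M} (ho : g.Oriented θ ϑ m) (u : Plane) :
    (g.met m u u < 0 ∧ g.FutureDirected (m := m) u) ↔ angular θ m u < 0 ∧ 0 < angular ϑ m u := by
  obtain ⟨c, hc, hg⟩ := h.conformal m
  rw [h.future_iff ho, hg]
  constructor
  · rintro ⟨h1, h2, h3, -⟩
    refine ⟨lt_of_le_of_ne h2 fun h0 => ?_, lt_of_le_of_ne h3 fun h0 => ?_⟩
    · simp [h0] at h1
    · simp [← h0] at h1
  · rintro ⟨h1, h2⟩
    exact ⟨mul_neg_of_pos_of_neg hc (mul_neg_of_neg_of_pos h1 h2), h1.le, h2.le, Or.inl h1.ne⟩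

theorem lightlike_zero_iff (h : g.NullPair θ ϑ) {m : M} (ho : g.Oriented θ ϑ m) (u : Plane) :
    g.Lightlike 0 (m := m) u ↔ angular θ m u = 0 ∧ 0 < angular ϑ m u := by
  obtain ⟨c, hc, hg⟩ := h.conformal m
  have ho' := ho
  obtain ⟨h1, h2, κ, hκ, ha⟩ := ho'
  have key : g.Lightlike 0 (m := m) u ↔ g.met m u u = 0 ∧ g.FutureDirected (m := m) u ∧
      ∀ w : Plane, g.met m w w < 0 → g.FutureDirected (m := m) w → 0 < g.ar m u w := by
    unfold Lightlike
    simp only [if_true]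
    rfl
  rw [key, h.future_iff ho, hg]
  constructor
  · rintro ⟨h3, ⟨h4, h5, h6⟩, h7⟩
    have h8 := (h.timelike_future_iff ho (g.tau m)).2 ⟨h1, h2⟩
    have h9 := h7 _ h8.1 h8.2
    rw [ha] at h9
    rcases mul_eq_zero.1 ((mul_eq_zero.1 h3).resolve_left hc.ne') with h0 | h0
    · exact ⟨h0, lt_of_le_of_ne h5 (Ne.symm (h6.resolve_left (not_not.2 h0)))⟩
    · rw [h0, zero_mul, sub_zero] at h9
      nlinarith [mul_nonneg hκ.le (mul_nonneg (neg_nonneg.2 h4) h2.le)]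
  · rintro ⟨h3, h4⟩
    refine ⟨by rw [h3]; ring, ⟨h3.le, h4.le, Or.inr h4.ne'⟩, fun w hw hw' => ?_⟩
    have h5 := (h.timelike_future_iff ho w).1 ⟨hw, hw'⟩
    rw [ha, h3]
    nlinarith [mul_pos hκ (mul_pos h4 (neg_pos.2 h5.1))]

theorem lightlike_one_iff (h : g.NullPair θ ϑ) {m : M} (ho : g.Oriented θ ϑ m) (u : Plane) :
    g.Lightlike 1 (m := m) u ↔ angular θ m u < 0 ∧ angular ϑ m u = 0 := by
  obtain ⟨c, hc, hg⟩ := h.conformal m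
  have ho' := ho
  obtain ⟨h1, h2, κ, hκ, ha⟩ := ho'
  have key : g.Lightlike 1 (m := m) u ↔ g.met m u u = 0 ∧ g.FutureDirected (m := m) u ∧
      ∀ w : Plane, g.met m w w < 0 → g.FutureDirected (m := m) w → 0 < g.ar m w u := by
    unfold Lightlike
    simp only [one_ne_zero, if_false]
    rfl
  rw [key, h.future_iff ho, hg]
  constructor
  · rintro ⟨h3, ⟨h4, h5, h6⟩, h7⟩
    have h8 := (h.timelike_future_iff ho (g.tau m)).2 ⟨h1, h2⟩
    have h9 := h7 _ h8.1 h8.2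
    rw [ha] at h9
    rcases mul_eq_zero.1 ((mul_eq_zero.1 h3).resolve_left hc.ne') with h0 | h0
    · rw [h0, mul_zero, sub_zero] at h9
      nlinarith [mul_nonneg hκ.le (mul_nonneg (neg_nonneg.2 h1.le) h5)]
    · exact ⟨lt_of_le_of_ne h4 (h6.resolve_right (not_not.2 h0)), h0⟩
  · rintro ⟨h3, h4⟩
    refine ⟨by rw [h4]; ring, ⟨h3.le, h4.ge, Or.inl h3.ne⟩, fun w hw hw' => ?_⟩
    have h5 := (h.timelike_future_iff ho w).1 ⟨hw, hw'⟩
    rw [ha, h4]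
    nlinarith [mul_pos hκ (mul_pos h5.2 (neg_pos.2 h3))]

/-- The four alternatives correspond to the sign of the area coefficient and the sign of the first
differential on the time orientation. -/
theorem oriented_or (h : g.NullPair θ ϑ) (m : M) :
    g.Oriented θ ϑ m ∨ g.Oriented ϑ θ m ∨ g.Oriented (fun m => -θ m) (fun m => -ϑ m) m ∨
      g.Oriented (fun m => -ϑ m) (fun m => -θ m) m := by
  obtain ⟨κ, hκ, ha⟩ := h.area_eq m
  have ht := h.time_mul_neg m
  simp only [Oriented, h.left.angular_neg, h.right.angular_neg]
  rcases mul_neg_iff.1 ht with ⟨h1, h2⟩ | ⟨h1, h2⟩ <;> rcases lt_or_gt_of_ne hκ with h3 | h3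
  · exact Or.inr (Or.inl ⟨h2, h1, -κ, by linarith, fun a b => by rw [ha]; ring⟩)
  · exact Or.inr (Or.inr (Or.inl ⟨by linarith, by linarith, κ, h3, fun a b => by rw [ha]; ring⟩))
  · exact Or.inr (Or.inr (Or.inr ⟨by linarith, by linarith, -κ, by linarith,
      fun a b => by rw [ha]; ring⟩))
  · exact Or.inl ⟨h1, h2, κ, h3, ha⟩

theorem oriented_unique (h : g.NullPair θ ϑ) {m : M} (h1 : g.Oriented θ ϑ m) :
    ¬ (g.Oriented ϑ θ m ∨ g.Oriented (fun m => -θ m) (fun m => -ϑ m) m ∨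
      g.Oriented (fun m => -ϑ m) (fun m => -θ m) m) := by
  simp only [Oriented, h.left.angular_neg, h.right.angular_neg]
  obtain ⟨h2, h3, κ, hκ, ha⟩ := h1
  rintro (⟨h4, -⟩ | ⟨h4, -⟩ | ⟨-, -, κ', hκ', ha'⟩)
  · linarith
  · linarith
  · obtain ⟨e, he1, he2⟩ := h.exists_vector m 1 0
    obtain ⟨f, hf1, hf2⟩ := h.exists_vector m 0 1
    have h5 := (ha e f).symm.trans (ha' e f)
    rw [he1, he2, hf1, hf2] at h5
    linarith

/-- The four orientation types are open, exhaustive, and the first excludes the others; so the first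
is clopen. -/
theorem oriented_of_oriented [ConnectedSpace M] (h : g.NullPair θ ϑ) {m : M}
    (h1 : g.Oriented θ ϑ m) (n : M) : g.Oriented θ ϑ n := by
  have hc : IsClopen {m | g.Oriented θ ϑ m} := by
    refine ⟨⟨?_⟩, h.isOpen_oriented⟩
    have : {m | g.Oriented θ ϑ m}ᶜ = {m | g.Oriented ϑ θ m} ∪
        ({m | g.Oriented (fun m => -θ m) (fun m => -ϑ m) m} ∪
        {m | g.Oriented (fun m => -ϑ m) (fun m => -θ m) m}) := by
      ext m
      exact ⟨fun h2 => (h.oriented_or m).resolve_left h2,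
        fun h2 h3 => h.oriented_unique h3 h2⟩
    rw [this]
    exact h.swap.isOpen_oriented.union (h.neg.isOpen_oriented.union h.swap.neg.isOpen_oriented)
  have h2 := (isClopen_iff.1 hc).resolve_left (Set.nonempty_iff_ne_empty.1 ⟨m, h1⟩)
  exact Set.eq_univ_iff_forall.1 h2 n

/-- On a connected surface a null pair can be oriented by signs and a permutation. -/
theorem exists_oriented [ConnectedSpace M] (h : g.NullPair θ ϑ) :
    ∃ θ' ϑ' : M → S1, g.NullPair θ' ϑ' ∧ (∀ m, g.Oriented θ' ϑ' m) ∧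
      ∀ m n, θ' m = θ' n → ϑ' m = ϑ' n → θ m = θ n ∧ ϑ m = ϑ n := by
  obtain ⟨m⟩ : Nonempty M := inferInstance
  rcases h.oriented_or m with h1 | h1 | h1 | h1
  · exact ⟨_, _, h, h.oriented_of_oriented h1, fun _ _ a b => ⟨a, b⟩⟩
  · exact ⟨_, _, h.swap, h.swap.oriented_of_oriented h1, fun _ _ a b => ⟨b, a⟩⟩
  · exact ⟨_, _, h.neg, h.neg.oriented_of_oriented h1,
      fun _ _ a b => ⟨neg_injective a, neg_injective b⟩⟩
  · exact ⟨_, _, h.swap.neg, h.swap.neg.oriented_of_oriented h1,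
      fun _ _ a b => ⟨neg_injective b, neg_injective a⟩⟩

theorem push_comp {X Y : Type*} [NormedAddCommGroup X] [NormedSpace ℝ X] [NormedAddCommGroup Y]
    [NormedSpace ℝ Y] {s : Y → M} {c : X → Y} {x : X} {c' : X →L[ℝ] Y}
    (hs : MDifferentiableAt 𝓘(ℝ, Y) (𝓡 2) s (c x)) (hc : HasFDerivAt c c' x) (a : X) :
    push (s ∘ c) x a = push s (c x) (c' a) := by
  have h1 := (hs.hasMFDerivAt.comp x hc.hasMFDerivAt).mfderiv
  exact congrArg (fun L : X →L[ℝ] Plane => L a) h1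

/-- Curves with prescribed direction in a null pair. -/
theorem exists_curve (h : g.NullPair θ ϑ) (m : M) (v : ℝ × ℝ) :
    ∃ γ : ℝ → M, ContMDiff 𝓘(ℝ, ℝ) (𝓡 2) 1 γ ∧ γ 0 = m ∧ ∀ t, ∃ ρ : ℝ, 0 < ρ ∧
      angular θ (γ t) (push γ t 1) = ρ * v.1 ∧ angular ϑ (γ t) (push γ t 1) = ρ * v.2 := by
  obtain ⟨x, hx⟩ := QuotientAddGroup.mk_surjective (θ m)
  obtain ⟨y, hy⟩ := QuotientAddGroup.mk_surjective (ϑ m)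
  obtain ⟨V, s, hV, hmV, hsm, hs, hsV, -⟩ := h.exists_section hx.symm hy.symm
  have hlin : Filter.Tendsto (fun r : ℝ => (x, y) + r • v) (𝓝 0) (𝓝 (x, y)) := by
    have : Continuous (fun r : ℝ => (x, y) + r • v) := by fun_prop
    simpa using this.tendsto 0
  obtain ⟨δ, hδ, hball⟩ := Metric.eventually_nhds_iff.1 (hlin.eventually (hV.mem_nhds hmV))
  set ε := δ / 2 with hε
  have hε0 : 0 < ε := by positivity
  -- The arctangent squeezes the whole line into a short segment of direction `v` without ever
  -- stopping; since `π < 4`, the parameter stays below `ε` in absolute value.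
  set c : ℝ → ℝ × ℝ := fun t => (x, y) + (ε * (Real.arctan t / 2)) • v with hc
  have hcV : ∀ t, c t ∈ V := by
    intro t
    refine hball (y := ε * (Real.arctan t / 2)) ?_
    rw [dist_zero_right, Real.norm_eq_abs, abs_lt]
    have h1 := Real.neg_pi_div_two_lt_arctan t
    have h2 := Real.arctan_lt_pi_div_two t
    have h3 := Real.pi_lt_four
    constructor <;> nlinarith
  have hc1 : ContDiff ℝ 1 c := by
    have := Real.contDiff_arctan (n := 1)
    fun_prop
  have hc' : ∀ t, HasFDerivAt c ((ContinuousLinearMap.toSpanSingleton ℝ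
      ((ε * ((1 / (1 + t ^ 2)) / 2)) • v) : ℝ →L[ℝ] ℝ × ℝ)) t := by
    intro t
    have h1 : HasDerivAt (fun t => ε * (Real.arctan t / 2)) (ε * ((1 / (1 + t ^ 2)) / 2)) t :=
      ((Real.hasDerivAt_arctan t).div_const 2).const_mul ε
    exact ((h1.smul_const v).const_add (x, y)).hasFDerivAt
  have hsm' : ∀ t, ContMDiffAt 𝓘(ℝ, ℝ × ℝ) (𝓡 2) 1 s (c t) := fun t =>
    hs.contMDiffAt (hV.mem_nhds (hcV t))
  refine ⟨s ∘ c, fun t => (hsm' t).comp t hc1.contMDiff.contMDiffAt, ?_, fun t => ?_⟩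
  · simp [hc, hsm]
  · refine ⟨ε * ((1 / (1 + t ^ 2)) / 2), by positivity, ?_⟩
    rw [push_comp ((hsm' t).mdifferentiableAt one_ne_zero) (hc' t)]
    have := h.angular_section hV hs hsV (hcV t)
      ((ContinuousLinearMap.toSpanSingleton ℝ ((ε * ((1 / (1 + t ^ 2)) / 2)) • v)) 1)
    simpa using this

/-- `LeafStep` imposes the parameters `0` and `1`; an affine change of parameter with positive slope
keeps the velocity lightlike and future directed. -/
theorem leafStep_of_lightlike (h : g.NullPair θ ϑ) (ho : ∀ m, g.Oriented θ ϑ m) (i : Fin 2)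
    {γ : ℝ → M} (hγ : ContMDiff 𝓘(ℝ, ℝ) (𝓡 2) 1 γ)
    (hl : ∀ t, g.Lightlike i (velocity γ t)) {a b : ℝ} (hab : a < b) :
    g.LeafStep i (γ a) (γ b) := by
  have hc : ∀ t, HasFDerivAt (fun t : ℝ => a + t * (b - a))
      (ContinuousLinearMap.toSpanSingleton ℝ (b - a)) t := by
    intro t
    have : HasDerivAt (fun t : ℝ => a + t * (b - a)) (b - a) t := by
      simpa using ((hasDerivAt_id t).mul_const (b - a)).const_add a
    exact this.hasFDerivAt
  refine ⟨γ ∘ fun t => a + t * (b - a), hγ.comp (ContDiff.contMDiff (by fun_prop)), fun t => ?_,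
    by simp, by simp⟩
  have h1 : push (γ ∘ fun t => a + t * (b - a)) t 1 =
      (b - a) • push γ (a + t * (b - a)) 1 := by
    rw [push_comp (hγ.mdifferentiable one_ne_zero _) (hc t), ← map_smul]
    simp
  have h2 : g.Lightlike i (m := γ (a + t * (b - a))) (push γ (a + t * (b - a)) 1) := hl _
  change g.Lightlike i (m := γ (a + t * (b - a))) (push (γ ∘ fun t => a + t * (b - a)) t 1)
  rw [h1]
  have h3 : 0 < b - a := sub_pos.2 hab
  fin_cases i
  · rw [Fin.zero_eta, h.lightlike_zero_iff (ho _)] at h2 ⊢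
    rw [map_smul, map_smul, h2.1]
    exact ⟨by simp, mul_pos h3 h2.2⟩
  · rw [Fin.mk_one, h.lightlike_one_iff (ho _)] at h2 ⊢
    rw [map_smul, map_smul, h2.2]
    exact ⟨mul_neg_of_pos_of_neg h3 h2.1, by simp⟩

end NullPair

theorem _root_.LorentzConvergence.IsAngle.eq_of_angular_eq_zero {θ : M → S1} (hθ : IsAngle θ)
    {γ : ℝ → M} (hγ : ContMDiff 𝓘(ℝ, ℝ) (𝓡 2) 1 γ) (h0 : ∀ t, angular θ (γ t) (push γ t 1) = 0)
    (a b : ℝ) : θ (γ a) = θ (γ b) := by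
  obtain ⟨r, hr, hrθ⟩ := exists_real_lift (hθ.continuous.comp hγ.continuous)
  have h1 : ∀ t, HasFDerivAt r (0 : ℝ →L[ℝ] ℝ) t := by
    intro t
    refine (hθ.hasFDerivAt_iff (hγ.mdifferentiable one_ne_zero t) hr.continuousAt
      (Filter.Eventually.of_forall fun y => (hrθ y).symm)).2 fun a => ?_
    have : a = a • (1 : ℝ) := by simp
    rw [this, map_smul, map_smul, h0]
    simp
  have h2 := is_const_of_fderiv_eq_zero (𝕜 := ℝ) (fun t => (h1 t).differentiableAt)
    (fun t => (h1 t).fderiv) a b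
  exact (hrθ a).symm.trans ((congrArg _ h2).trans (hrθ b))

theorem _root_.LorentzConvergence.IsAngle.angular_eq_zero {θ : M → S1} (hθ : IsAngle θ)
    {γ : ℝ → M} (hγ : ContMDiff 𝓘(ℝ, ℝ) (𝓡 2) 1 γ) (h0 : ∀ t, θ (γ t) = θ (γ 0)) :
    angular θ (γ 0) (push γ 0 1) = 0 := by
  obtain ⟨x, hx⟩ := QuotientAddGroup.mk_surjective (θ (γ 0))
  have := (hθ.hasFDerivAt_iff (hγ.mdifferentiable one_ne_zero 0) (r := fun _ => x) (r' := 0)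
    continuousAt_const (Filter.Eventually.of_forall fun y => (h0 y).trans hx.symm)).1
    (hasFDerivAt_const x 0) 1
  simpa using this

theorem IsCoordinate.isAngle {i : Fin 2} {α : g.LeafSpace i ≃ₜ S1} (h : g.IsCoordinate i α) :
    IsAngle (fun m => α (g.leaf i m)) := by
  intro m
  obtain ⟨u, hu, hu', -⟩ := h m
  exact ⟨u, hu, hu'.mono fun _ h => h.symm⟩

theorem IsCoordinate.time_sign {i : Fin 2} {α : g.LeafSpace i ≃ₜ S1} (h : g.IsCoordinate i α)
    (m : M) : if i = 0 then angular (fun m => α (g.leaf i m)) m (g.tau m) < 0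
      else 0 < angular (fun m => α (g.leaf i m)) m (g.tau m) := by
  obtain ⟨u, hu, hu', hs⟩ := h m
  have h1 : HasLiftAt (fun m => α (g.leaf i m)) u m := ⟨hu, hu'.mono fun _ h => h.symm⟩
  rw [h1.angular_eq]
  exact hs

variable (g) in
/-- The projections on the spaces of leaves form an oriented null pair and are jointly
injective. -/
theorem nullPair_toTorus [ConnectedSpace M] (hembeds : g.EmbedsInTorus)
    {α : g.LeafSpace 0 ≃ₜ S1} (hα : g.IsCoordinate 0 α)
    {β : g.LeafSpace 1 ≃ₜ S1} (hβ : g.IsCoordinate 1 β) :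
    g.NullPair (fun m => α (g.leaf 0 m)) (fun m => β (g.leaf 1 m)) ∧
      (∀ m, g.Oriented (fun m => α (g.leaf 0 m)) (fun m => β (g.leaf 1 m)) m) ∧
      Function.Injective (g.toTorus α β) := by
  obtain ⟨f, hf, hloc⟩ := hembeds
  have hN : g.NullPair (fun m => (f m).1) (fun m => (f m).2) := by
    have h1 : ∀ m, ∃ u v : M → ℝ, HasLiftAt (fun m => (f m).1) u m ∧
        HasLiftAt (fun m => (f m).2) v m ∧ ∃ c : ℝ, 0 < c ∧ ∀ a : TangentSpace (𝓡 2) m,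
        g.metric m a a = c * (differential u m a * differential v m a) := by
      intro m
      obtain ⟨u, v, hu, hv, he, hc⟩ := hloc m
      exact ⟨u, v, ⟨hu, he.mono fun _ h => congrArg Prod.fst h⟩,
        ⟨hv, he.mono fun _ h => congrArg Prod.snd h⟩, hc⟩
    refine ⟨fun m => ?_, fun m => ?_, fun m => ?_⟩
    · obtain ⟨u, v, hu, hv, -⟩ := h1 m
      exact ⟨u, hu⟩
    · obtain ⟨u, v, hu, hv, -⟩ := h1 m
      exact ⟨v, hv⟩
    · obtain ⟨u, v, hu, hv, c, hc, hg⟩ := h1 m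
      exact ⟨c, hc, fun a => by rw [hu.angular_eq, hv.angular_eq]; exact hg a⟩
  -- After swapping and changing signs, each component is constant along the leaves of the foliation
  -- with the matching index.
  obtain ⟨θ, ϑ, h, ho, hinj⟩ := hN.exists_oriented
  have hθ : ∀ a b, g.leaf 0 a = g.leaf 0 b → θ a = θ b := by
    intro a b hab
    refine congrArg (Quot.lift θ ?_) hab
    rintro a b ⟨γ, hγ, hl, rfl, rfl⟩
    exact h.left.eq_of_angular_eq_zero hγ
      (fun t => ((h.lightlike_zero_iff (ho _) _).1 (hl t)).1) 0 1
  have hϑ : ∀ a b, g.leaf 1 a = g.leaf 1 b → ϑ a = ϑ b := by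
    intro a b hab
    refine congrArg (Quot.lift ϑ ?_) hab
    rintro a b ⟨γ, hγ, hl, rfl, rfl⟩
    exact h.right.eq_of_angular_eq_zero hγ
      (fun t => ((h.lightlike_one_iff (ho _) _).1 (hl t)).2) 0 1
  set A : M → S1 := fun m => α (g.leaf 0 m) with hA
  set B : M → S1 := fun m => β (g.leaf 1 m) with hB
  have hleaf : ∀ (i : Fin 2) (γ : ℝ → M), ContMDiff 𝓘(ℝ, ℝ) (𝓡 2) 1 γ →
      (∀ t, g.Lightlike i (velocity γ t)) → ∀ t, g.leaf i (γ t) = g.leaf i (γ 0) := by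
    intro i γ hγ hl t
    rcases lt_trichotomy t 0 with h1 | h1 | h1
    · exact Quot.sound (h.leafStep_of_lightlike ho i hγ hl h1)
    · rw [h1]
    · exact (Quot.sound (h.leafStep_of_lightlike ho i hγ hl h1)).symm
  -- `A` is constant along the leaves of foliation `0`, so its differential vanishes on the kernel
  -- of that of `θ` and is a multiple of it. The time orientation fixes the sign of the multiple.
  have dA : ∀ m, ∃ r : ℝ, 0 < r ∧ ∀ a, angular A m a = r * angular θ m a := by
    intro m
    obtain ⟨γ, hγ, rfl, hd⟩ := h.exists_curve m (0, 1)
    have h1 : angular A (γ 0) (push γ 0 1) = 0 := by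
      refine hα.isAngle.angular_eq_zero hγ fun t => congrArg α (hleaf 0 γ hγ (fun t => ?_) t)
      obtain ⟨ρ, hρ, hd1, hd2⟩ := hd t
      exact (h.lightlike_zero_iff (ho _) _).2 ⟨hd1.trans (by simp), hd2.symm ▸ by simpa using hρ⟩
    obtain ⟨ρ, hρ, hd1, hd2⟩ := hd 0
    obtain ⟨e, he1, he2⟩ := h.exists_vector (γ 0) 1 0
    have h2 : ∀ a, angular A (γ 0) a = angular A (γ 0) e * angular θ (γ 0) a := by
      intro a
      have : a = angular θ (γ 0) a • e + (angular ϑ (γ 0) a / ρ) • push γ 0 1 := by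
        refine h.ext (m := γ 0) ?_ ?_
        · simp [he1, hd1]
        · simp [he2, hd2, hρ.ne']
      conv_lhs => rw [this]
      simp [h1, mul_comm]
    refine ⟨_, ?_, h2⟩
    have h3 : angular A (γ 0) (g.tau (γ 0)) < 0 := by simpa using hα.time_sign (γ 0)
    have h4 := (ho (γ 0)).1
    rw [h2] at h3
    by_contra! h5
    nlinarith [mul_nonneg_of_nonpos_of_nonpos h5 h4.le]
  have dB : ∀ m, ∃ r : ℝ, 0 < r ∧ ∀ a, angular B m a = r * angular ϑ m a := by
    intro m
    obtain ⟨γ, hγ, rfl, hd⟩ := h.exists_curve m (-1, 0)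
    have h1 : angular B (γ 0) (push γ 0 1) = 0 := by
      refine hβ.isAngle.angular_eq_zero hγ fun t => congrArg β (hleaf 1 γ hγ (fun t => ?_) t)
      obtain ⟨ρ, hρ, hd1, hd2⟩ := hd t
      exact (h.lightlike_one_iff (ho _) _).2 ⟨hd1.symm ▸ by simpa using hρ, hd2.trans (by simp)⟩
    obtain ⟨ρ, hρ, hd1, hd2⟩ := hd 0
    obtain ⟨e, he1, he2⟩ := h.exists_vector (γ 0) 0 1
    have h2 : ∀ a, angular B (γ 0) a = angular B (γ 0) e * angular ϑ (γ 0) a := by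
      intro a
      have : a = angular ϑ (γ 0) a • e + (-(angular θ (γ 0) a / ρ)) • push γ 0 1 := by
        refine h.ext (m := γ 0) ?_ ?_
        · simp [he1, hd1, hρ.ne']
        · simp [he2, hd2]
      conv_lhs => rw [this]
      simp [h1, mul_comm]
    refine ⟨_, ?_, h2⟩
    have h3 : 0 < angular B (γ 0) (g.tau (γ 0)) := by simpa using hβ.time_sign (γ 0)
    have h4 := (ho (γ 0)).2.1
    rw [h2] at h3
    by_contra! h5
    nlinarith [mul_nonneg (neg_nonneg.2 h5) h4.le]
  refine ⟨⟨hα.isAngle, hβ.isAngle, fun m => ?_⟩, fun m => ?_, fun a b hab => ?_⟩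
  · obtain ⟨c, hc, hg⟩ := h.conformal m
    obtain ⟨r, hr, hA'⟩ := dA m
    obtain ⟨r', hr', hB'⟩ := dB m
    refine ⟨c / (r * r'), by positivity, fun a => ?_⟩
    rw [hg, hA', hB']
    field_simp
  · obtain ⟨r, hr, hA'⟩ := dA m
    obtain ⟨r', hr', hB'⟩ := dB m
    obtain ⟨h1, h2, κ, hκ, ha⟩ := ho m
    refine ⟨?_, ?_, κ / (r * r'), by positivity, fun a b => ?_⟩
    · rw [hA']; exact mul_neg_of_pos_of_neg hr h1
    · rw [hB']; exact mul_pos hr' h2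
    · rw [ha, hA', hB', hA', hB']
      field_simp
  -- `θ` and `ϑ` factor through the leaf projections, and together they determine the embedding; its
  -- injectivity thus passes to the pair of projections.
  · have h1 : α (g.leaf 0 a) = α (g.leaf 0 b) := congrArg Prod.fst hab
    have h2 : β (g.leaf 1 a) = β (g.leaf 1 b) := congrArg Prod.snd hab
    obtain ⟨h3, h4⟩ := hinj a b (hθ _ _ (α.injective h1)) (hϑ _ _ (β.injective h2))
    exact hf.injective (Prod.ext h3 h4)

end LorentzSurface

end

/-! ### The plane region over the image, and the conformal factor on it. -/

section

namespace LorentzSurface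

variable {g : LorentzSurface M} {A B : M → S1}

/-- The subset of the plane lying over the image of `(A, B)`. -/
def planeDomain (A B : M → S1) : Set (ℝ × ℝ) :=
  {q | ∃ m, A m = ((q.1 : ℝ) : S1) ∧ B m = ((q.2 : ℝ) : S1)}

/-- The inverse of the pair `(A, B)`, as a map defined on the plane. -/
def planeInv [Nonempty M] (A B : M → S1) (q : ℝ × ℝ) : M :=
  Classical.epsilon fun m => A m = ((q.1 : ℝ) : S1) ∧ B m = ((q.2 : ℝ) : S1)

/-- The conformal factor of `g` in the coordinates `(A, B)`. -/
def planeFactor [Nonempty M] (g : LorentzSurface M) (A B : M → S1) (q : ℝ × ℝ) : ℝ :=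
  -- The factor two undoes polarisation: the metric becomes exactly this function times `dx dy`.
  2 * g.met (planeInv A B q) (push (planeInv A B) q (1, 0)) (push (planeInv A B) q (0, 1))

variable (g) in
/-- A conformal embedding in the torus, compatible with the orientations. -/
structure TorusChart (A B : M → S1) : Prop extends g.NullPair A B where
  oriented (m : M) : g.Oriented A B m
  injective (m n : M) : A m = A n → B m = B n → m = n

namespace TorusChart

variable [Nonempty M] (h : g.TorusChart A B)

theorem planeInv_spec {q : ℝ × ℝ} (hq : q ∈ planeDomain A B) :
    A (planeInv A B q) = ((q.1 : ℝ) : S1) ∧ B (planeInv A B q) = ((q.2 : ℝ) : S1) :=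
  Classical.epsilon_spec hq

include h

theorem planeInv_eq {q : ℝ × ℝ} {m : M} (h1 : A m = ((q.1 : ℝ) : S1))
    (h2 : B m = ((q.2 : ℝ) : S1)) : planeInv A B q = m := by
  obtain ⟨h3, h4⟩ := planeInv_spec (A := A) (B := B) ⟨m, h1, h2⟩
  exact h.injective _ _ (h3.trans h1.symm) (h4.trans h2.symm)

theorem exists_nhds {q : ℝ × ℝ} (hq : q ∈ planeDomain A B) : ∃ V : Set (ℝ × ℝ), IsOpen V ∧ q ∈ V ∧
    V ⊆ planeDomain A B ∧ ContMDiffOn 𝓘(ℝ, ℝ × ℝ) (𝓡 2) 1 (planeInv A B) V := by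
  obtain ⟨m, h1, h2⟩ := hq
  obtain ⟨V, s, hV, hmV, hsm, hs, hsV, -⟩ := h.exists_section h1 h2
  exact ⟨V, hV, hmV, fun q hq => ⟨s q, hsV q hq⟩,
    hs.congr fun q hq => h.planeInv_eq (hsV q hq).1 (hsV q hq).2⟩

theorem isOpen_planeDomain : IsOpen (planeDomain A B) := by
  rw [isOpen_iff_forall_mem_open]
  intro q hq
  obtain ⟨V, hV, hqV, hVW, -⟩ := h.exists_nhds hq
  exact ⟨V, hVW, hV, hqV⟩

theorem contMDiffOn_planeInv :
    ContMDiffOn 𝓘(ℝ, ℝ × ℝ) (𝓡 2) 1 (planeInv A B) (planeDomain A B) := by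
  intro q hq
  obtain ⟨V, hV, hqV, -, hs⟩ := h.exists_nhds hq
  exact (hs.contMDiffAt (hV.mem_nhds hqV)).contMDiffWithinAt

theorem contMDiffAt_planeInv {q : ℝ × ℝ} (hq : q ∈ planeDomain A B) :
    ContMDiffAt 𝓘(ℝ, ℝ × ℝ) (𝓡 2) 1 (planeInv A B) q :=
  h.contMDiffOn_planeInv.contMDiffAt (h.isOpen_planeDomain.mem_nhds hq)

theorem mdifferentiableAt_planeInv {q : ℝ × ℝ} (hq : q ∈ planeDomain A B) :
    MDifferentiableAt 𝓘(ℝ, ℝ × ℝ) (𝓡 2) (planeInv A B) q :=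
  (h.contMDiffAt_planeInv hq).mdifferentiableAt one_ne_zero

theorem angular_planeInv {q : ℝ × ℝ} (hq : q ∈ planeDomain A B) (a : ℝ × ℝ) :
    angular A (planeInv A B q) (push (planeInv A B) q a) = a.1 ∧
      angular B (planeInv A B q) (push (planeInv A B) q a) = a.2 :=
  h.angular_section h.isOpen_planeDomain h.contMDiffOn_planeInv (fun _ hq => planeInv_spec hq) hq a

theorem met_eq {q : ℝ × ℝ} (hq : q ∈ planeDomain A B) (a : Plane) :
    g.met (planeInv A B q) a a = planeFactor g A B q *
      (angular A (planeInv A B q) a * angular B (planeInv A B q) a) := by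
  obtain ⟨c, hc, hg⟩ := h.metric_eq (planeInv A B q)
  rw [planeFactor, hg, hg, (h.angular_planeInv hq _).1, (h.angular_planeInv hq _).2,
    (h.angular_planeInv hq _).1, (h.angular_planeInv hq _).2]
  ring

theorem planeFactor_pos {q : ℝ × ℝ} (hq : q ∈ planeDomain A B) : 0 < planeFactor g A B q := by
  obtain ⟨c, hc, hg⟩ := h.metric_eq (planeInv A B q)
  rw [planeFactor, hg, (h.angular_planeInv hq _).1, (h.angular_planeInv hq _).2,
    (h.angular_planeInv hq _).1, (h.angular_planeInv hq _).2]
  simpa using hc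

theorem continuousOn_planeFactor : ContinuousOn (planeFactor g A B) (planeDomain A B) := by
  have hg0 := g.contMDiff_metric.of_le (show (0 : WithTop ℕ∞) ≤ 2 by norm_num)
  have h1 : ContinuousOn (fun q => g.met (planeInv A B q) (push (planeInv A B) q (1, 0))
      (push (planeInv A B) q (0, 1))) (planeDomain A B) :=
    continuousOn_bilin_apply hg0 h.contMDiffOn_planeInv.continuousOn
      (continuousOn_mfderiv_apply h.isOpen_planeDomain h.contMDiffOn_planeInv (1, 0))
      (continuousOn_mfderiv_apply h.isOpen_planeDomain h.contMDiffOn_planeInv (0, 1))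
  exact continuousOn_const.mul h1

omit h [Nonempty M] in
theorem add_int_mem {q : ℝ × ℝ} (hq : q ∈ planeDomain A B) (i j : ℤ) :
    q + ((i : ℝ), (j : ℝ)) ∈ planeDomain A B := by
  obtain ⟨m, h1, h2⟩ := hq
  refine ⟨m, h1.trans ?_, h2.trans ?_⟩
  · exact coe_eq_coe_iff.2 ⟨-i, by simp⟩
  · exact coe_eq_coe_iff.2 ⟨-j, by simp⟩

theorem planeInv_add_int {q : ℝ × ℝ} (hq : q ∈ planeDomain A B) (i j : ℤ) :
    planeInv A B (q + ((i : ℝ), (j : ℝ))) = planeInv A B q := by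
  obtain ⟨h1, h2⟩ := planeInv_spec hq
  refine h.planeInv_eq (h1.trans ?_) (h2.trans ?_)
  · exact coe_eq_coe_iff.2 ⟨-i, by simp⟩
  · exact coe_eq_coe_iff.2 ⟨-j, by simp⟩

/-- There are no closed causal curves. -/
theorem not_closed_causal [T2Space M] (hsc : g.SpatiallyCompact) {c c' : ℝ → ℝ × ℝ}
    (hc : ContDiff ℝ 1 c) (hcW : ∀ t, c t ∈ planeDomain A B) (hc' : ∀ t, HasDerivAt c (c' t) t)
    (hcausal : ∀ t, (c' t).1 * (c' t).2 ≤ 0 ∧ c' t ≠ 0) {i j : ℤ}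
    (hper : ∀ t, c (t + 1) = c t + ((i : ℝ), (j : ℝ))) : False := by
  obtain ⟨S, ⟨-, hS⟩, -⟩ := hsc
  set γ : ℝ → M := planeInv A B ∘ c with hγ
  have hγp : ∀ t, γ (t + 1) = γ t := by
    intro t
    simp only [hγ, Function.comp_apply, hper]
    exact h.planeInv_add_int (hcW t) i j
  have hpush : ∀ t, push γ t 1 = push (planeInv A B) (c t) (c' t) := by
    intro t
    rw [hγ, NullPair.push_comp (h.mdifferentiableAt_planeInv (hcW t)) (hc' t).hasFDerivAt]
    simp
  have hne : ∀ t, push γ t 1 ≠ 0 := by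
    intro t h0
    rw [hpush] at h0
    obtain ⟨h1, h2⟩ := h.angular_planeInv (hcW t) (c' t)
    rw [h0, map_zero] at h1 h2
    exact (hcausal t).2 (Prod.ext h1.symm h2.symm)
  have hC : ContMDiff 𝓘(ℝ, ℝ) (𝓡 2) 1 γ := fun t =>
    (h.contMDiffAt_planeInv (hcW t)).comp t hc.contMDiff.contMDiffAt
  have hcc : g.IsCausalCurve γ := by
    refine ⟨hC, fun t => ⟨hne t, ?_⟩⟩
    change g.met (γ t) (push γ t 1) (push γ t 1) ≤ 0
    rw [hpush, hγ, Function.comp_apply, h.met_eq (hcW t), (h.angular_planeInv (hcW t) _).1,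
      (h.angular_planeInv (hcW t) _).2]
    exact mul_nonpos_of_nonneg_of_nonpos (h.planeFactor_pos (hcW t)).le (hcausal t).1
  have hper' : ∀ (n : ℕ) t, γ (t + n) = γ t := by
    intro n t
    induction n with
    | zero => simp
    | succ n ih => rw [Nat.cast_succ, ← add_assoc, hγp, ih]
  have hper'' : ∀ (n : ℕ) t, γ (t - n) = γ t := by
    intro n t
    rw [← hper' n (t - n)]; simp
  -- A periodic curve with a limit at either end is constant, which the non-zero velocity excludes;
  -- this yields inextensibility.
  have hconst : ∀ x, (∀ t, γ t = x) → False := by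
    intro x hx
    have h1 : γ = fun _ => x := funext hx
    refine hne 0 ?_
    have h2 : push (fun _ : ℝ => x) (0 : ℝ) (1 : ℝ) = 0 :=
      congrArg (fun L : ℝ →L[ℝ] Plane => L 1) (mfderiv_const (I := 𝓘(ℝ, ℝ)) (I' := 𝓡 2) (c := x))
    rw [h1]
    exact h2
  have hine : Inextensible γ := by
    refine ⟨?_, ?_⟩
    · rintro ⟨x, hx⟩
      refine hconst x fun t => ?_
      have h1 : Filter.Tendsto (fun n : ℕ => γ (t + n)) Filter.atTop (𝓝 x) :=
        hx.comp (Filter.tendsto_atTop_add_const_left _ t tendsto_natCast_atTop_atTop)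
      simp only [hper'] at h1
      exact tendsto_nhds_unique tendsto_const_nhds h1
    · rintro ⟨x, hx⟩
      refine hconst x fun t => ?_
      have h1 : Filter.Tendsto (fun n : ℕ => γ (t - n)) Filter.atTop (𝓝 x) :=
        hx.comp (Filter.tendsto_atBot_add_const_left _ t
          (Filter.tendsto_neg_atTop_atBot.comp tendsto_natCast_atTop_atTop))
      simp only [hper''] at h1
      exact tendsto_nhds_unique tendsto_const_nhds h1
  -- By periodicity the curve meets the Cauchy hypersurface at `t + 1` as well as at `t`.
  obtain ⟨t, ht, hu⟩ := hS γ hcc hine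
  have h1 := hu (t + 1) (by simp only [hγp]; exact ht)
  linarith

/-! ### Isometries in null coordinates. -/

section Isometry

variable {φ : M ≃ₜ M} (hφ : g.IsIsometry φ) {F F' : ℝ → ℝ} (hF : Continuous F)
  (hF' : Continuous F') (hFA : ∀ m (x : ℝ), A m = (x : S1) → A (φ m) = ((F x : ℝ) : S1))
  (hFB : ∀ m (x : ℝ), B m = (x : S1) → B (φ m) = ((F' x : ℝ) : S1))

include hFA hFB

theorem planeInv_map {q : ℝ × ℝ} (hq : q ∈ planeDomain A B) :
    (F q.1, F' q.2) ∈ planeDomain A B ∧ planeInv A B (F q.1, F' q.2) = φ (planeInv A B q) := by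
  obtain ⟨h1, h2⟩ := planeInv_spec hq
  have h3 := hFA _ _ h1
  have h4 := hFB _ _ h2
  exact ⟨⟨_, h3, h4⟩, h.planeInv_eq h3 h4⟩

include hφ hF hF'

/-- A local lift of `A ∘ φ`, restricted to the horizontal line through `q`, is `C¹` and differs from
`F` by an integer; vertical lines play the same role for `F'`. -/
theorem contDiffAt_map {q : ℝ × ℝ} (hq : q ∈ planeDomain A B) :
    ContDiffAt ℝ 1 F q.1 ∧ ContDiffAt ℝ 1 F' q.2 := by
  have hs := h.contMDiffAt_planeInv hq
  have hφs : ContMDiffAt 𝓘(ℝ, ℝ × ℝ) (𝓡 2) 1 (φ ∘ planeInv A B) q :=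
    hφ.contMDiff.contMDiffAt.comp q hs
  have hW : ∀ᶠ p in 𝓝 q, p ∈ planeDomain A B := h.isOpen_planeDomain.mem_nhds hq
  constructor
  · obtain ⟨u, hu, hu'⟩ := h.left (φ (planeInv A B q))
    have h1 : ContMDiffAt 𝓘(ℝ, ℝ × ℝ) 𝓘(ℝ, ℝ) 1 (u ∘ (φ ∘ planeInv A B)) q := hu.comp q hφs
    have h2 : ContDiffAt ℝ 1 (fun x : ℝ => (u ∘ (φ ∘ planeInv A B)) (x, q.2)) q.1 :=
      ContDiffAt.comp (g := u ∘ (φ ∘ planeInv A B)) q.1 h1.contDiffAt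
        (contDiffAt_id.prodMk contDiffAt_const)
    have hl : Filter.Tendsto (fun x : ℝ => (x, q.2)) (𝓝 q.1) (𝓝 q) :=
      (Continuous.prodMk_left q.2).tendsto' _ _ rfl
    have h3 : ∀ᶠ x in 𝓝 q.1, ((F x : ℝ) : S1) =
        (((u ∘ (φ ∘ planeInv A B)) (x, q.2) : ℝ) : S1) := by
      filter_upwards [hl.eventually hW, hl.eventually (hφs.continuousAt.eventually hu')] with x a b
      exact (hFA _ _ (planeInv_spec a).1).symm.trans b
    obtain ⟨n, hn⟩ := eventually_eq_add_int hF.continuousAt h2.continuousAt h3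
    exact (h2.add contDiffAt_const).congr_of_eventuallyEq hn
  · obtain ⟨u, hu, hu'⟩ := h.right (φ (planeInv A B q))
    have h1 : ContMDiffAt 𝓘(ℝ, ℝ × ℝ) 𝓘(ℝ, ℝ) 1 (u ∘ (φ ∘ planeInv A B)) q := hu.comp q hφs
    have h2 : ContDiffAt ℝ 1 (fun x : ℝ => (u ∘ (φ ∘ planeInv A B)) (q.1, x)) q.2 :=
      ContDiffAt.comp (g := u ∘ (φ ∘ planeInv A B)) q.2 h1.contDiffAt
        (contDiffAt_const.prodMk contDiffAt_id)
    have hl : Filter.Tendsto (fun x : ℝ => (q.1, x)) (𝓝 q.2) (𝓝 q) :=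
      (Continuous.prodMk_right q.1).tendsto' _ _ rfl
    have h3 : ∀ᶠ x in 𝓝 q.2, ((F' x : ℝ) : S1) =
        (((u ∘ (φ ∘ planeInv A B)) (q.1, x) : ℝ) : S1) := by
      filter_upwards [hl.eventually hW, hl.eventually (hφs.continuousAt.eventually hu')] with x a b
      exact (hFB _ _ (planeInv_spec a).2).symm.trans b
    obtain ⟨n, hn⟩ := eventually_eq_add_int hF'.continuousAt h2.continuousAt h3
    exact (h2.add contDiffAt_const).congr_of_eventuallyEq hn

/-- Positivity comes from the future timelike vector `(-1, 1)`, whose image is again future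
timelike. The density identity compares the metric on `(1, 1)` with the metric on its image. -/
theorem deriv_map {q : ℝ × ℝ} (hq : q ∈ planeDomain A B) :
    0 < deriv F q.1 ∧ 0 < deriv F' q.2 ∧
      planeFactor g A B (F q.1, F' q.2) * (deriv F q.1 * deriv F' q.2) = planeFactor g A B q := by
  obtain ⟨hd, hd'⟩ := h.contDiffAt_map hφ hF hF' hFA hFB hq
  obtain ⟨hqW, hqe⟩ := h.planeInv_map hFA hFB hq
  have hs := h.mdifferentiableAt_planeInv hq
  have hφd : MDifferentiableAt (𝓡 2) (𝓡 2) φ (planeInv A B q) :=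
    hφ.contMDiff.mdifferentiable one_ne_zero _
  have hW : ∀ᶠ p in 𝓝 q, p ∈ planeDomain A B := h.isOpen_planeDomain.mem_nhds hq
  have hpush : ∀ a : ℝ × ℝ, push (φ ∘ planeInv A B) q a =
      (mfderiv (𝓡 2) (𝓡 2) φ (planeInv A B q) : Plane →L[ℝ] Plane) (push (planeInv A B) q a) :=
    fun a => congrArg (fun L : ℝ × ℝ →L[ℝ] Plane => L a)
      (hφd.hasMFDerivAt.comp q hs.hasMFDerivAt).mfderiv
  have hA : ∀ a : ℝ × ℝ, angular A (φ (planeInv A B q)) (push (φ ∘ planeInv A B) q a) =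
      deriv F q.1 * a.1 := by
    intro a
    have h1 := (h.left.hasFDerivAt_iff (hφd.comp q hs) (r := fun p => F p.1)
      (hF.comp continuous_fst).continuousAt (hW.mono fun p hp => hFA _ _ (planeInv_spec hp).1)).1
      ((hd.differentiableAt one_ne_zero).hasDerivAt.hasFDerivAt.comp q hasFDerivAt_fst) a
    rw [mul_comm]
    simpa using h1
  have hB : ∀ a : ℝ × ℝ, angular B (φ (planeInv A B q)) (push (φ ∘ planeInv A B) q a) =
      deriv F' q.2 * a.2 := by
    intro a
    have h1 := (h.right.hasFDerivAt_iff (hφd.comp q hs) (r := fun p => F' p.2)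
      (hF'.comp continuous_snd).continuousAt (hW.mono fun p hp => hFB _ _ (planeInv_spec hp).2)).1
      ((hd'.differentiableAt one_ne_zero).hasDerivAt.hasFDerivAt.comp q hasFDerivAt_snd) a
    rw [mul_comm]
    simpa using h1
  have hmet : ∀ a : ℝ × ℝ, g.met (φ (planeInv A B q)) (push (φ ∘ planeInv A B) q a)
      (push (φ ∘ planeInv A B) q a) = planeFactor g A B q * (a.1 * a.2) := by
    intro a
    rw [hpush]
    refine (hφ.metric_eq (planeInv A B q) (push (planeInv A B) q a)
      (push (planeInv A B) q a)).trans ?_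
    refine (h.met_eq hq _).trans ?_
    rw [(h.angular_planeInv hq a).1, (h.angular_planeInv hq a).2]
  have hmet' : ∀ a : ℝ × ℝ, g.met (φ (planeInv A B q)) (push (φ ∘ planeInv A B) q a)
      (push (φ ∘ planeInv A B) q a) =
      planeFactor g A B (F q.1, F' q.2) * ((deriv F q.1 * a.1) * (deriv F' q.2 * a.2)) := by
    intro a
    rw [← hA, ← hB, ← hqe]
    exact h.met_eq hqW _
  have hfut := (h.timelike_future_iff (h.oriented (planeInv A B q))
    (push (planeInv A B) q (-1, 1))).2 (by
      rw [(h.angular_planeInv hq _).1, (h.angular_planeInv hq _).2]; norm_num)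
  have hfut' := (h.timelike_future_iff (h.oriented (φ (planeInv A B q)))
    (push (φ ∘ planeInv A B) q (-1, 1))).1 (by
      rw [hpush]
      exact ⟨(hφ.metric_eq (planeInv A B q) _ _).trans_lt hfut.1,
        (hφ.future (planeInv A B q) _).2 hfut.2⟩)
  rw [hA, hB] at hfut'
  refine ⟨by linarith [hfut'.1], by linarith [hfut'.2], ?_⟩
  have h1 := (hmet' (1, 1)).symm.trans (hmet (1, 1))
  simpa using h1

end Isometry

end TorusChart

end LorentzSurface

end

/-! ### The lift to the cover and path lifting. -/

section

namespace LorentzSurface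

variable {g : LorentzSurface M} {A B : M → S1}

variable (A B) in
/-- `P` is a lift to the plane of the map `(A, B)` along the covering map `π`. -/
structure PlaneLift {E : Type*} [TopologicalSpace E] (π : E → M) (P : E → ℝ × ℝ) : Prop where
  covering : IsCoveringMap π
  surjective : Function.Surjective π
  continuous : Continuous P
  fst (e : E) : (((P e).1 : ℝ) : S1) = A (π e)
  snd (e : E) : (((P e).2 : ℝ) : S1) = B (π e)

namespace PlaneLift

open unitInterval

variable {E : Type*} [TopologicalSpace E] {π : E → M} {P : E → ℝ × ℝ} (hP : PlaneLift A B π P)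

include hP

theorem range_subset : Set.range P ⊆ planeDomain A B := by
  rintro _ ⟨e, rfl⟩
  exact ⟨π e, (hP.fst e).symm, (hP.snd e).symm⟩

/-- Lifting of paths. -/
theorem exists_lift_path {γ : I → M} (hγ : Continuous γ) {c : I → ℝ × ℝ} (hc : Continuous c)
    (hA : ∀ t, (((c t).1 : ℝ) : S1) = A (γ t)) (hB : ∀ t, (((c t).2 : ℝ) : S1) = B (γ t))
    {e : E} (he : π e = γ 0) (hce : c 0 = P e) : ∃ e', π e' = γ 1 ∧ P e' = c 1 := by
  obtain ⟨Γ, hΓ, hΓ0⟩ := hP.covering.exists_path_lifts ⟨γ, hγ⟩ e he.symm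
  have hΓ' : ∀ t, π (Γ t) = γ t := fun t => congrFun hΓ t
  have hPΓ : Continuous fun t => P (Γ t) := hP.continuous.comp Γ.continuous
  obtain ⟨n, hn⟩ := exists_eq_add_int (u := fun t => (P (Γ t)).1) (v := fun t => (c t).1)
    hPΓ.fst hc.fst (fun t => by rw [hP.fst, hΓ', hA])
  obtain ⟨k, hk⟩ := exists_eq_add_int (u := fun t => (P (Γ t)).2) (v := fun t => (c t).2)
    hPΓ.snd hc.snd (fun t => by rw [hP.snd, hΓ', hB])
  have h1 := hn 0
  have h2 := hk 0
  simp only [hΓ0, hce, left_eq_add] at h1 h2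
  exact ⟨Γ 1, hΓ' 1, Prod.ext (by rw [hn, h1, add_zero]) (by rw [hk, h2, add_zero])⟩

/-- The inverse chart turns a plane path into a path of `M`, which is then lifted to the cover. For
a path connected cover, the range of `P` is thus a path component of `planeDomain`. -/
theorem mem_range_of_path [Nonempty M] (h : g.TorusChart A B) {c : I → ℝ × ℝ} (hc : Continuous c)
    (hcW : ∀ t, c t ∈ planeDomain A B) (h0 : c 0 ∈ Set.range P) : c 1 ∈ Set.range P := by
  obtain ⟨e, he⟩ := h0
  have hs : ∀ t, A (planeInv A B (c t)) = _ ∧ B (planeInv A B (c t)) = _ := fun t =>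
    TorusChart.planeInv_spec (hcW t)
  obtain ⟨e', -, he'⟩ := hP.exists_lift_path
    (h.contMDiffOn_planeInv.continuousOn.comp_continuous hc hcW) hc (fun t => (hs t).1.symm)
    (fun t => (hs t).2.symm) (e := e) (by
      symm
      refine h.planeInv_eq ?_ ?_
      · rw [← he, hP.fst]
      · rw [← he, hP.snd]) he.symm
  exact ⟨e', he'⟩

/-- A substitute for deck transformations: a path of the cover is projected and lifted again from
another point of the fibre, which shifts its image in the plane by a constant vector. -/
theorem add_mem_range [PathConnectedSpace E] {e₀ e₁ : E} (h : π e₀ = π e₁) {q : ℝ × ℝ}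
    (hq : q ∈ Set.range P) : q + (P e₁ - P e₀) ∈ Set.range P := by
  obtain ⟨e, rfl⟩ := hq
  let p := PathConnectedSpace.somePath e₀ e
  have h1 : (((P e₁).1 - (P e₀).1 : ℝ) : S1) = 0 := by
    rw [AddCircle.coe_sub, hP.fst, hP.fst, h, sub_self]
  have h2 : (((P e₁).2 - (P e₀).2 : ℝ) : S1) = 0 := by
    rw [AddCircle.coe_sub, hP.snd, hP.snd, h, sub_self]
  obtain ⟨e', -, he'⟩ := hP.exists_lift_path (γ := fun t => π (p t))
    (c := fun t => P (p t) + (P e₁ - P e₀)) (hP.covering.continuous.comp p.continuous)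
    ((hP.continuous.comp p.continuous).add continuous_const)
    (fun t => by rw [Prod.fst_add, Prod.fst_sub, AddCircle.coe_add, h1, add_zero, hP.fst])
    (fun t => by rw [Prod.snd_add, Prod.snd_sub, AddCircle.coe_add, h2, add_zero, hP.snd])
    (e := e₁) (by simp [h]) (by simp)
  exact ⟨e', he'.trans (by simp)⟩

/-- When `A` is constant along the path, the first coordinate of its lift can vary only by integers,
hence not at all. -/
theorem exists_fst_eq {a b : M} {γ : I → M} (hγ : Continuous γ) (h0 : γ 0 = a) (h1 : γ 1 = b)
    (hA : ∀ t, A (γ t) = A a) {e : E} (he : π e = a) : ∃ e', π e' = b ∧ (P e').1 = (P e).1 := by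
  obtain ⟨Γ, hΓ, hΓ0⟩ := hP.covering.exists_path_lifts ⟨γ, hγ⟩ e (he.trans h0.symm).symm
  have hΓ' : ∀ t, π (Γ t) = γ t := fun t => congrFun hΓ t
  have hPΓ : Continuous fun t => P (Γ t) := hP.continuous.comp Γ.continuous
  obtain ⟨n, hn⟩ := exists_eq_add_int (u := fun t => (P (Γ t)).1) (v := fun _ => (P e).1)
    hPΓ.fst continuous_const (fun t => by rw [hP.fst, hP.fst, hΓ', hA, he])
  refine ⟨Γ 1, (hΓ' 1).trans h1, ?_⟩
  rw [hn 1, ← hn 0, hΓ0]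

theorem exists_snd_eq {a b : M} {γ : I → M} (hγ : Continuous γ) (h0 : γ 0 = a) (h1 : γ 1 = b)
    (hB : ∀ t, B (γ t) = B a) {e : E} (he : π e = a) : ∃ e', π e' = b ∧ (P e').2 = (P e).2 := by
  obtain ⟨Γ, hΓ, hΓ0⟩ := hP.covering.exists_path_lifts ⟨γ, hγ⟩ e (he.trans h0.symm).symm
  have hΓ' : ∀ t, π (Γ t) = γ t := fun t => congrFun hΓ t
  have hPΓ : Continuous fun t => P (Γ t) := hP.continuous.comp Γ.continuous
  obtain ⟨n, hn⟩ := exists_eq_add_int (u := fun t => (P (Γ t)).2) (v := fun _ => (P e).2)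
    hPΓ.snd continuous_const (fun t => by rw [hP.snd, hP.snd, hΓ', hB, he])
  refine ⟨Γ 1, (hΓ' 1).trans h1, ?_⟩
  rw [hn 1, ← hn 0, hΓ0]

end PlaneLift

/-! ### Leaves and integer periods of the region. -/

section Leaves

open unitInterval

/-- Leaf steps are future directed and so not symmetric, while equality of leaves is the equivalence
relation they generate; this is why `R` is required in both directions along each step. -/
theorem exists_path_of_eqvGen (i : Fin 2) {R : M → M → Prop}
    (hstep : ∀ γ : ℝ → M, ContMDiff 𝓘(ℝ, ℝ) (𝓡 2) 1 γ → (∀ t, g.Lightlike i (velocity γ t)) →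
      R (γ 0) (γ 1) ∧ R (γ 1) (γ 0)) (hrefl : ∀ a, R a a)
    (htrans : ∀ a b c, R a b → R b c → R a c) {a b : M} (h : g.leaf i a = g.leaf i b) :
    R a b := by
  have h1 : ∀ a b, Relation.EqvGen (g.LeafStep i) a b → R a b ∧ R b a := by
    intro a b hab
    induction hab with
    | rel a b hab =>
      obtain ⟨γ, hγ, hl, rfl, rfl⟩ := hab
      exact hstep γ hγ hl
    | refl a => exact ⟨hrefl a, hrefl a⟩
    | symm a b _ ih => exact ih.symm
    | trans a b c _ _ ih1 ih2 => exact ⟨htrans _ _ _ ih1.1 ih2.1, htrans _ _ _ ih2.2 ih1.2⟩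
  exact (h1 a b (Quot.eqvGen_exact h)).1

variable {α : g.LeafSpace 0 ≃ₜ S1} {β : g.LeafSpace 1 ≃ₜ S1}
  (h : g.TorusChart (fun m => α (g.leaf 0 m)) (fun m => β (g.leaf 1 m)))
  {E : Type*} [TopologicalSpace E] {π : E → M} {P : E → ℝ × ℝ}
  (hP : PlaneLift (fun m => α (g.leaf 0 m)) (fun m => β (g.leaf 1 m)) π P)

include h hP

theorem PlaneLift.exists_same_fst {a b : M} (hab : g.leaf 0 a = g.leaf 0 b) {e : E}
    (he : π e = a) : ∃ e', π e' = b ∧ (P e').1 = (P e).1 := by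
  refine exists_path_of_eqvGen (g := g) 0
    (R := fun a b => ∀ e, π e = a → ∃ e', π e' = b ∧ (P e').1 = (P e).1)
    (fun γ hγ hl => ?_) (fun a e he => ⟨e, he, rfl⟩) (fun a b c hab hbc e he => ?_) hab e he
  · have hA := h.left.eq_of_angular_eq_zero hγ
      (fun t => ((h.lightlike_zero_iff (h.oriented _) _).1 (hl t)).1)
    refine ⟨fun e he => ?_, fun e he => ?_⟩
    · exact hP.exists_fst_eq (γ := fun t : I => γ t) (hγ.continuous.comp continuous_subtype_val)
        (by simp) (by simp) (fun t => hA _ _) he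
    · exact hP.exists_fst_eq (γ := fun t : I => γ (1 - t))
        (hγ.continuous.comp (continuous_const.sub continuous_subtype_val))
        (by simp) (by simp) (fun t => hA _ _) he
  · obtain ⟨e1, he1, h1⟩ := hab e he
    obtain ⟨e2, he2, h2⟩ := hbc e1 he1
    exact ⟨e2, he2, h2.trans h1⟩

theorem PlaneLift.exists_same_snd {a b : M} (hab : g.leaf 1 a = g.leaf 1 b) {e : E}
    (he : π e = a) : ∃ e', π e' = b ∧ (P e').2 = (P e).2 := by
  refine exists_path_of_eqvGen (g := g) 1
    (R := fun a b => ∀ e, π e = a → ∃ e', π e' = b ∧ (P e').2 = (P e).2)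
    (fun γ hγ hl => ?_) (fun a e he => ⟨e, he, rfl⟩) (fun a b c hab hbc e he => ?_) hab e he
  · have hB := h.right.eq_of_angular_eq_zero hγ
      (fun t => ((h.lightlike_one_iff (h.oriented _) _).1 (hl t)).2)
    refine ⟨fun e he => ?_, fun e he => ?_⟩
    · exact hP.exists_snd_eq (γ := fun t : I => γ t) (hγ.continuous.comp continuous_subtype_val)
        (by simp) (by simp) (fun t => hB _ _) he
    · exact hP.exists_snd_eq (γ := fun t : I => γ (1 - t))
        (hγ.continuous.comp (continuous_const.sub continuous_subtype_val))
        (by simp) (by simp) (fun t => hB _ _) he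
  · obtain ⟨e1, he1, h1⟩ := hab e he
    obtain ⟨e2, he2, h2⟩ := hbc e1 he1
    exact ⟨e2, he2, h2.trans h1⟩

/-- Points over `x` and `x + 1` project to one leaf. Following that leaf in the cover from the first
point reaches the fibre of the second with first coordinate still `x`; the difference of the two
points of this fibre is a period. -/
theorem PlaneLift.exists_translation_fst [PathConnectedSpace E] {x y y' : ℝ}
    (h0 : (x, y) ∈ Set.range P) (h1 : (x + 1, y') ∈ Set.range P) :
    ∃ j : ℤ, ∀ q, q ∈ Set.range P ↔ q + (1, (j : ℝ)) ∈ Set.range P := by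
  obtain ⟨e, he⟩ := h0
  obtain ⟨e', he'⟩ := h1
  have hleaf : g.leaf 0 (π e) = g.leaf 0 (π e') := by
    apply α.injective
    have h2 := hP.fst e
    have h3 := hP.fst e'
    simp only [he, he'] at h2 h3
    rw [← h2, ← h3, coe_eq_coe_iff]
    exact ⟨-1, by simp⟩
  obtain ⟨e'', hπ, hfst⟩ := PlaneLift.exists_same_fst h hP hleaf rfl
  have h2 : (((P e').2 : ℝ) : S1) = ((P e'').2 : ℝ) := by rw [hP.snd, hP.snd, hπ]
  obtain ⟨j, hj⟩ := coe_eq_coe_iff.1 h2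
  have hd : P e' - P e'' = (1, (j : ℝ)) := by
    refine Prod.ext ?_ ?_
    · rw [Prod.fst_sub, hfst, he, he']; simp
    · rw [Prod.snd_sub, hj]; simp
  refine ⟨j, fun q => ⟨fun hq => ?_, fun hq => ?_⟩⟩
  · rw [← hd]; exact hP.add_mem_range hπ hq
  · have := hP.add_mem_range hπ.symm hq
    rwa [← neg_sub, hd, add_neg_cancel_right] at this

theorem PlaneLift.exists_translation_snd [PathConnectedSpace E] {x x' y : ℝ}
    (h0 : (x, y) ∈ Set.range P) (h1 : (x', y + 1) ∈ Set.range P) :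
    ∃ j : ℤ, ∀ q, q ∈ Set.range P ↔ q + ((j : ℝ), 1) ∈ Set.range P := by
  obtain ⟨e, he⟩ := h0
  obtain ⟨e', he'⟩ := h1
  have hleaf : g.leaf 1 (π e) = g.leaf 1 (π e') := by
    apply β.injective
    have h2 := hP.snd e
    have h3 := hP.snd e'
    simp only [he, he'] at h2 h3
    rw [← h2, ← h3, coe_eq_coe_iff]
    exact ⟨-1, by simp⟩
  obtain ⟨e'', hπ, hsnd⟩ := PlaneLift.exists_same_snd h hP hleaf rfl
  have h2 : (((P e').1 : ℝ) : S1) = ((P e'').1 : ℝ) := by rw [hP.fst, hP.fst, hπ]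
  obtain ⟨j, hj⟩ := coe_eq_coe_iff.1 h2
  have hd : P e' - P e'' = ((j : ℝ), 1) := by
    refine Prod.ext ?_ ?_
    · rw [Prod.fst_sub, hj]; simp
    · rw [Prod.snd_sub, hsnd, he, he']; simp
  refine ⟨j, fun q => ⟨fun hq => ?_, fun hq => ?_⟩⟩
  · rw [← hd]; exact hP.add_mem_range hπ hq
  · have := hP.add_mem_range hπ.symm hq
    rwa [← neg_sub, hd, add_neg_cancel_right] at this

end Leaves

end LorentzSurface

end

/-! ### The region lies between lifts of circle homeomorphisms. -/

section

/-- A non empty open interval of `ℝ` determines its extended end points. -/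
theorem ereal_bounds_eq {lo hi : EReal} {a b : ℝ} (hab : a < b)
    (h : ∀ x : ℝ, (lo < x ∧ (x : EReal) < hi) ↔ (a < x ∧ x < b)) : hi = b := by
  have hm := (h ((a + b) / 2)).2 ⟨by linarith, by linarith⟩
  refine le_antisymm ?_ ?_
  · by_contra! hlt
    obtain ⟨r, hr1, hr2⟩ := EReal.lt_iff_exists_real_btwn.1 hlt
    have hr1' : b < r := EReal.coe_lt_coe_iff.1 hr1
    have h1 : lo < (r : EReal) := hm.1.trans (EReal.coe_lt_coe_iff.2 (by linarith))
    linarith [((h r).1 ⟨h1, hr2⟩).2]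
  · by_contra! hlt
    obtain ⟨r, hr1, hr2⟩ := EReal.lt_iff_exists_real_btwn.1 hlt
    have hr2' : r < b := EReal.coe_lt_coe_iff.1 hr2
    have h1 : (a + b) / 2 < r := EReal.coe_lt_coe_iff.1 (hm.2.trans hr1)
    exact absurd ((h r).2 ⟨by linarith, hr2'⟩).2 (not_lt.2 hr1.le)

theorem Ioo_inj {a b c d : ℝ} (hab : a < b) (h : ∀ x, (a < x ∧ x < b) ↔ (c < x ∧ x < d)) :
    a = c ∧ b = d := by
  have h1 := (h ((a + b) / 2)).1 ⟨by linarith, by linarith⟩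
  have h2 : Set.Ioo a b = Set.Ioo c d := Set.ext h
  have hcd : c < d := h1.1.trans h1.2
  have h3 := congrArg closure h2
  rw [closure_Ioo hab.ne, closure_Ioo hcd.ne] at h3
  exact (Set.Icc_eq_Icc_iff hab.le).1 h3

/-- Between two continuous functions on `ℝ`, with a translation property, there is a `C¹`
nondecreasing function with the same translation property. -/
theorem exists_contDiff_between {D U : ℝ → ℝ} (hD : Continuous D) (hU : Continuous U)
    (hDm : Monotone D) (hUm : Monotone U) (hD1 : ∀ x, D (x + 1) = D x + 1)
    (hU1 : ∀ x, U (x + 1) = U x + 1) (hDU : ∀ x, D x < U x) :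
    ∃ c c' : ℝ → ℝ, ContDiff ℝ 1 c ∧ (∀ t, HasDerivAt c (c' t) t) ∧ (∀ t, 0 ≤ c' t) ∧
      (∀ t, D t < c t ∧ c t < U t) ∧ ∀ t, c (t + 1) = c t + 1 := by
  set m : ℝ → ℝ := fun t => (D t + U t) / 2 with hm
  have hmc : Continuous m := by fun_prop
  have hmm : Monotone m := fun a b hab => by
    have := hDm hab
    have := hUm hab
    simp only [hm]; linarith
  have hm1 : ∀ t, m (t + 1) = m t + 1 := fun t => by simp only [hm, hD1, hU1]; ring
  have hDm' : ∀ t, D t < m t := fun t => by have := hDU t; simp only [hm]; linarith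
  have hmU : ∀ t, m t < U t := fun t => by have := hDU t; simp only [hm]; linarith
  -- A uniform window width, from compactness of `[0, 1]` and the common translation property.
  obtain ⟨ε, hε, hεU⟩ : ∃ ε > 0, ∀ t, m (t + ε) < U t := by
    have h1 : ∀ᶠ ε in 𝓝 (0 : ℝ), ∀ t ∈ Set.Icc (0 : ℝ) 1, m (t + ε) < U t := by
      refine isCompact_Icc.eventually_forall_of_forall_eventually fun t _ => ?_
      have h2 : Continuous fun z : ℝ × ℝ => U z.2 - m (z.2 + z.1) := by fun_prop
      have h3 := h2.continuousAt (x := ((0 : ℝ), t)).eventually (lt_mem_nhds (a := 0) (by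
        have := hmU t; simp; linarith))
      exact h3.mono fun z hz => by linarith
    obtain ⟨δ, hδ, hδ'⟩ := Metric.eventually_nhds_iff.1 h1
    refine ⟨δ / 2, by positivity, fun t => ?_⟩
    have h4 := hδ' (y := δ / 2) (by rw [dist_zero_right, Real.norm_eq_abs, abs_of_pos] <;> linarith)
      (Int.fract t) ⟨Int.fract_nonneg t, (Int.fract_lt_one t).le⟩
    have hint : ∀ (f : ℝ → ℝ), (∀ x, f (x + 1) = f x + 1) → ∀ (n : ℤ) x, f (x + n) = f x + n := by
      intro f hf n x
      have h5 : Function.Periodic (fun x => f x - x) 1 := fun x => by simp only [hf]; ring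
      have h6 := h5.int_mul n x
      simp only [mul_one] at h6
      linarith
    have h5 := hint m hm1 ⌊t⌋ (Int.fract t + δ / 2)
    have h6 := hint U hU1 ⌊t⌋ (Int.fract t)
    rw [Int.fract_add_floor] at h6
    rw [show Int.fract t + δ / 2 + (⌊t⌋ : ℝ) = t + δ / 2 by
      linarith [Int.fract_add_floor t]] at h5
    linarith
  have hi : ∀ a b, IntervalIntegrable m MeasureTheory.volume a b := fun a b =>
    hmc.intervalIntegrable a b
  -- The required function is the average of `m` over `[t, t + ε]`: it is `C¹`, nondecreasing, and
  -- lies between `m t` and `m (t + ε)`.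
  have hder : ∀ t, HasDerivAt (fun t => ε⁻¹ * ∫ s in t..(t + ε), m s)
      (ε⁻¹ * (m (t + ε) - m t)) t := by
    intro t
    have h1 : (fun t => ε⁻¹ * ∫ s in t..(t + ε), m s) =
        fun t => ε⁻¹ * ((∫ s in (0 : ℝ)..(t + ε), m s) - ∫ s in (0 : ℝ)..t, m s) := by
      ext t
      rw [intervalIntegral.integral_interval_sub_left (hi _ _) (hi _ _)]
    rw [h1]
    have h2 : HasDerivAt (fun t => ∫ s in (0 : ℝ)..t, m s) (m (t + ε)) (t + ε) :=
      hmc.integral_hasStrictDerivAt 0 (t + ε) |>.hasDerivAt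
    have h3 : HasDerivAt (fun t => ∫ s in (0 : ℝ)..t, m s) (m t) t :=
      hmc.integral_hasStrictDerivAt 0 t |>.hasDerivAt
    exact ((h2.comp_add_const t ε).sub h3).const_mul ε⁻¹
  refine ⟨_, _, ?_, hder, fun t => ?_, fun t => ?_, fun t => ?_⟩
  · rw [contDiff_one_iff_deriv]
    refine ⟨fun t => (hder t).differentiableAt, ?_⟩
    rw [funext fun t => (hder t).deriv]
    fun_prop
  · have := hmm (show t ≤ t + ε by linarith)
    exact mul_nonneg (by positivity) (by linarith)
  · have h1 : ε * m t ≤ ∫ s in t..(t + ε), m s := by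
      have := intervalIntegral.integral_mono_on (a := t) (b := t + ε) (by linarith)
        (intervalIntegrable_const (c := m t)) (hi _ _) fun s hs => hmm hs.1
      simpa using this
    have h2 : (∫ s in t..(t + ε), m s) ≤ ε * m (t + ε) := by
      have := intervalIntegral.integral_mono_on (a := t) (b := t + ε) (by linarith) (hi _ _)
        (intervalIntegrable_const (c := m (t + ε))) fun s hs => hmm hs.2
      simpa using this
    constructor
    · refine (hDm' t).trans_le ?_
      rw [inv_mul_eq_div, le_div_iff₀ hε]; linarith
    · refine lt_of_le_of_lt ?_ (hεU t)
      rw [inv_mul_eq_div, div_le_iff₀ hε]; linarith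
  · have h1 : (∫ s in (t + 1)..(t + 1 + ε), m s) = (∫ s in t..(t + ε), m s) + ε := by
      have h2 := intervalIntegral.integral_comp_add_right (a := t) (b := t + ε) m 1
      rw [show t + ε + 1 = t + 1 + ε by ring] at h2
      rw [← h2]
      simp only [hm1]
      rw [intervalIntegral.integral_add (hi _ _) intervalIntegrable_const]
      simp
    simp only [h1]
    field_simp

namespace LorentzSurface

variable {g : LorentzSurface M}

/-- Such a vertical line would project to a closed lightlike curve. -/
theorem TorusChart.not_vertical {A B : M → S1} [T2Space M] [Nonempty M] (h : g.TorusChart A B)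
    (hsc : g.SpatiallyCompact)
    {x : ℝ} (hx : ∀ t : ℝ, ∃ n : ℤ, (x, t + n) ∈ planeDomain A B) : False := by
  refine h.not_closed_causal hsc (c := fun t => (x, t)) (c' := fun _ => (0, 1)) (i := 0) (j := 1)
    (by fun_prop) (fun t => ?_) (fun t => (hasDerivAt_const t x).prodMk (hasDerivAt_id t))
    (fun t => by simp) (fun t => by simp)
  obtain ⟨n, hn⟩ := hx t
  have := add_int_mem hn 0 (-n)
  simpa using this

/-- The planar domain covered by the universal cover lies between the graphs of two lifts of
circle homeomorphisms. -/
structure BoundedBy (U : Set (ℝ × ℝ)) (D T : ℝ ≃ₜ ℝ) : Prop where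
  mem_iff (x y : ℝ) : (x, y) ∈ U ↔ D x < y ∧ y < T x
  strictMono_lower : StrictMono D
  strictMono_upper : StrictMono T
  lower_add_one (x : ℝ) : D (x + 1) = D x + 1
  upper_add_one (x : ℝ) : T (x + 1) = T x + 1
  lower_lt_upper (x : ℝ) : D x < T x
  upper_le (x : ℝ) : T x ≤ D x + 1

/-- Monotonicity makes `j` and `k` positive integers; since `1 ≤ k`, the increase `j` over one unit
is at most the increase `1` over `k` units. -/
theorem translation_eq_one {D : ℝ ≃ₜ ℝ} (hD : StrictMono D) {j k : ℤ}
    (hj : ∀ x, D (x + 1) = D x + j) (hk : ∀ x, D (x + k) = D x + 1) : j = 1 := by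
  have h1 : (0 : ℝ) < j := by have := hD (show (0 : ℝ) < 0 + 1 by norm_num); rw [hj] at this; linarith
  have h2 : (0 : ℝ) < k := by
    have := hk 0
    exact (lt_add_iff_pos_right (0 : ℝ)).1 (hD.lt_iff_lt.1 (by rw [this]; linarith))
  have h1' : 0 < j := by exact_mod_cast h1
  have h2' : 0 < k := by exact_mod_cast h2
  have h3 : (1 : ℝ) ≤ k := by exact_mod_cast h2'
  have h4 := hD.monotone (show (0 : ℝ) + 1 ≤ 0 + k by linarith)
  rw [hj, hk] at h4
  have h5 : j ≤ 1 := by exact_mod_cast (show (j : ℝ) ≤ 1 by linarith)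
  omega

theorem translation_eq_neg_one {D : ℝ ≃ₜ ℝ} (hD : StrictAnti D) {j k : ℤ}
    (hj : ∀ x, D (x + 1) = D x + j) (hk : ∀ x, D (x + k) = D x + 1) : j = -1 := by
  have h1 : (j : ℝ) < 0 := by have := hD (show (0 : ℝ) < 0 + 1 by norm_num); rw [hj] at this; linarith
  have h2 : (k : ℝ) < 0 := by
    have := hk 0
    have := hD.lt_iff_gt.1 (show D 0 < D (0 + k) by rw [this]; linarith)
    linarith
  have h1' : j < 0 := by exact_mod_cast h1
  have h2' : k < 0 := by exact_mod_cast h2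
  have h3 : (k : ℝ) ≤ -1 := by exact_mod_cast (show k ≤ -1 by omega)
  have h4 := hD.antitone (show (0 : ℝ) + k ≤ -1 by linarith)
  have h5 := hj (-1)
  rw [hk] at h4
  rw [show (-1 : ℝ) + 1 = 0 by ring] at h5
  have h6 : -1 ≤ j := by exact_mod_cast (show (-1 : ℝ) ≤ j by linarith)
  omega

theorem strictMono_or_strictAnti (D : ℝ ≃ₜ ℝ) : StrictMono D ∨ StrictAnti D :=
  D.continuous.strictMono_of_inj D.injective

/-- Identifying both leaf spaces with the circle gives periods `(1, j)` and `(k, 1)` of the region.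
Monotonicity of the boundary functions leaves only `j = 1` or `j = -1`, and causality rules out the
latter. -/
theorem exists_boundedBy [T2Space M] [Nonempty M] (hsc : g.SpatiallyCompact)
    {α : g.LeafSpace 0 ≃ₜ S1} {β : g.LeafSpace 1 ≃ₜ S1}
    (h : g.TorusChart (fun m => α (g.leaf 0 m)) (fun m => β (g.leaf 1 m)))
    {E : Type*} [TopologicalSpace E] [PathConnectedSpace E] {π : E → M} {P : E → ℝ × ℝ}
    (hP : PlaneLift (fun m => α (g.leaf 0 m)) (fun m => β (g.leaf 1 m)) π P)
    {hDown hUp hLeft hRight : ℝ → EReal}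
    (hvert : SliceBounds (Set.range P) hDown hUp)
    (hhor : SliceBounds (Prod.swap ⁻¹' Set.range P) hLeft hRight)
    (hacausal : HomeoOrInfinite hDown ∧ HomeoOrInfinite hUp) :
    ∃ D T : ℝ ≃ₜ ℝ, BoundedBy (Set.range P) D T ∧ (∀ x, hUp x = (T x : EReal)) ∧
      ∀ y, hRight y = (D.symm y : EReal) := by
  have hne : ∀ x, ∃ y, (x, y) ∈ Set.range P := by
    intro x
    obtain ⟨h1, h2⟩ := hvert x
    obtain ⟨y, hy⟩ := EReal.lt_iff_exists_real_btwn.1 h1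
    exact ⟨y, (h2 y).2 hy⟩
  have hne' : ∀ y, ∃ x, (x, y) ∈ Set.range P := by
    intro y
    obtain ⟨h1, h2⟩ := hhor y
    obtain ⟨x, hx⟩ := EReal.lt_iff_exists_real_btwn.1 h1
    exact ⟨x, (h2 x).2 hx⟩
  -- If the upper boundary were infinite, the vertical line over `0` would lie in the region up to
  -- integer shifts.
  have hup : ∃ T : ℝ ≃ₜ ℝ, ∀ x, hUp x = (T x : EReal) := by
    rcases hacausal.2 with h1 | h1 | h1
    · exact h1
    · exact absurd (hvert 0).1 (by rw [h1]; exact not_lt_bot)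
    · exfalso
      obtain ⟨y, hy⟩ := hne 0
      refine h.not_vertical hsc (x := 0) fun t => ?_
      refine ⟨⌈y - t⌉, hP.range_subset (((hvert 0).2 _).2 ⟨?_, ?_⟩)⟩
      · refine (((hvert 0).2 y).1 hy).1.trans_le (EReal.coe_le_coe_iff.2 ?_)
        linarith [Int.le_ceil (y - t)]
      · rw [h1]; exact EReal.coe_lt_top _
  have hdown : ∃ D : ℝ ≃ₜ ℝ, ∀ x, hDown x = (D x : EReal) := by
    rcases hacausal.1 with h1 | h1 | h1
    · exact h1
    · exfalso
      obtain ⟨y, hy⟩ := hne 0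
      refine h.not_vertical hsc (x := 0) fun t => ?_
      refine ⟨⌊y - t⌋, hP.range_subset (((hvert 0).2 _).2 ⟨?_, ?_⟩)⟩
      · rw [h1]; exact EReal.bot_lt_coe _
      · refine lt_of_le_of_lt (EReal.coe_le_coe_iff.2 ?_) (((hvert 0).2 y).1 hy).2
        linarith [Int.floor_le (y - t)]
    · exact absurd (hvert 0).1 (by rw [h1]; exact not_top_lt)
  obtain ⟨T, hT⟩ := hup
  obtain ⟨D, hD⟩ := hdown
  have hmem : ∀ x y, (x, y) ∈ Set.range P ↔ D x < y ∧ y < T x := by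
    intro x y
    rw [(hvert x).2 y, hT, hD, EReal.coe_lt_coe_iff, EReal.coe_lt_coe_iff]
  have hlt : ∀ x, D x < T x := fun x => by
    have := (hvert x).1
    rwa [hT, hD, EReal.coe_lt_coe_iff] at this
  obtain ⟨j, hj⟩ : ∃ j : ℤ, ∀ q, q ∈ Set.range P ↔ q + (1, (j : ℝ)) ∈ Set.range P := by
    obtain ⟨y, hy⟩ := hne 0
    obtain ⟨y', hy'⟩ := hne (0 + 1)
    exact PlaneLift.exists_translation_fst h hP hy hy'
  obtain ⟨k, hk⟩ : ∃ k : ℤ, ∀ q, q ∈ Set.range P ↔ q + ((k : ℝ), 1) ∈ Set.range P := by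
    obtain ⟨x, hx⟩ := hne' 0
    obtain ⟨x', hx'⟩ := hne' (0 + 1)
    exact PlaneLift.exists_translation_snd h hP hx hx'
  have hDT : ∀ (a b : ℝ), (∀ q, q ∈ Set.range P ↔ q + (a, b) ∈ Set.range P) → ∀ x,
      D (x + a) = D x + b ∧ T (x + a) = T x + b := by
    intro a b hab x
    have h1 := Ioo_inj (a := D x + b) (b := T x + b) (c := D (x + a)) (d := T (x + a))
      (by linarith [hlt x]) fun y => by
        have := hab (x, y - b)
        rw [hmem, Prod.mk_add_mk, hmem, sub_add_cancel] at this
        rw [← this]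
        constructor <;> rintro ⟨h1, h2⟩ <;> constructor <;> linarith
    exact ⟨h1.1.symm, h1.2.symm⟩
  have hDj := fun x => (hDT _ _ hj x).1
  have hTj := fun x => (hDT _ _ hj x).2
  have hDk := fun x => (hDT _ _ hk x).1
  have hTk := fun x => (hDT _ _ hk x).2
  have hj1 : j ≠ -1 := by
    rintro rfl
    have hDa : StrictAnti D := (strictMono_or_strictAnti D).resolve_left fun h =>
      absurd (translation_eq_one h hDj hDk) (by norm_num)
    have hTa : StrictAnti T := (strictMono_or_strictAnti T).resolve_left fun h =>
      absurd (translation_eq_one h hTj hTk) (by norm_num)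
    have hneg : ∀ (S : ℝ ≃ₜ ℝ), (∀ x, S (x + 1) = S x + ((-1 : ℤ) : ℝ)) →
        ∀ x, S (-(x + 1)) = S (-x) + 1 := by
      intro S hS x
      have := hS (-(x + 1))
      rw [show -(x + 1) + 1 = -x by ring] at this
      push_cast at this
      linarith
    -- Between decreasing boundaries one can move with `x` decreasing and `y` nondecreasing, which
    -- is causal, and close up modulo `(-1, 1)`. The reflection `x ↦ -x` reduces this to the
    -- increasing case.
    obtain ⟨c, c', hc, hc', hc0, hcb, hc1⟩ := exists_contDiff_between (D := fun x => D (-x))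
      (U := fun x => T (-x)) (by fun_prop) (by fun_prop)
      (fun a b hab => hDa.antitone (neg_le_neg hab)) (fun a b hab => hTa.antitone (neg_le_neg hab))
      (hneg D hDj) (hneg T hTj) (fun x => hlt _)
    refine h.not_closed_causal hsc (c := fun t => (-t, c t)) (c' := fun t => (-1, c' t))
      (i := -1) (j := 1) (contDiff_neg.prodMk hc) (fun t => hP.range_subset ((hmem _ _).2 (hcb t)))
      (fun t => (hasDerivAt_neg t).prodMk (hc' t)) (fun t => ⟨by simpa using hc0 t, by simp⟩)
      (fun t => by simp [hc1]; ring)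
  have hDm : StrictMono D := (strictMono_or_strictAnti D).resolve_right fun h =>
    hj1 (translation_eq_neg_one h hDj hDk)
  have hTm : StrictMono T := (strictMono_or_strictAnti T).resolve_right fun h =>
    hj1 (translation_eq_neg_one h hTj hTk)
  obtain rfl := translation_eq_one hDm hDj hDk
  push_cast at hDj hTj
  -- A slice longer than `1` contains two points with the same image in the torus, hence in `M`.
  -- Then `(0, 1)` is a period, which contradicts finiteness of `T x`.
  have hle : ∀ x, T x ≤ D x + 1 := by
    intro x
    by_contra! hx
    obtain ⟨y, hy1, hy2⟩ := exists_between hx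
    obtain ⟨e, he⟩ := (hmem x (y - 1)).2 ⟨by linarith, by linarith⟩
    obtain ⟨e', he'⟩ := (hmem x y).2 ⟨by linarith, hy2⟩
    have hπ : π e = π e' := by
      refine h.injective _ _ ?_ ?_
      · have h1 := hP.fst e
        have h2 := hP.fst e'
        rw [← h1, ← h2, he, he']
      · have h1 := hP.snd e
        have h2 := hP.snd e'
        rw [← h1, ← h2, he, he', coe_eq_coe_iff]
        exact ⟨-1, by push_cast; ring⟩
    have htr : ∀ q ∈ Set.range P, q + (0, 1) ∈ Set.range P := by
      intro q hq
      have := hP.add_mem_range hπ hq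
      rw [he, he'] at this
      simpa using this
    have hall : ∀ n : ℕ, (x, y + n) ∈ Set.range P := by
      intro n
      induction n with
      | zero => simpa using ⟨e', he'⟩
      | succ n ih => simpa [add_assoc] using htr _ ih
    obtain ⟨n, hn⟩ := exists_nat_gt (T x - y)
    have := ((hmem _ _).1 (hall n)).2
    linarith
  refine ⟨D, T, ⟨hmem, hDm, hTm, hDj, hTj, hlt, hle⟩, hT, fun y => ?_⟩
  have hsm : ∀ a, D a < y ↔ a < D.symm y := fun a => by
    conv_lhs => rw [← D.apply_symm_apply y, hDm.lt_iff_lt]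
  have hsm' : ∀ a, y < T a ↔ T.symm y < a := fun a => by
    conv_lhs => rw [← T.apply_symm_apply y, hTm.lt_iff_lt]
  refine ereal_bounds_eq (a := T.symm y) (lo := hLeft y) ?_ fun x => ?_
  · rw [← hsm]
    have := hlt (T.symm y)
    rwa [T.apply_symm_apply] at this
  · rw [← (hhor y).2 x, Set.mem_preimage, Prod.swap_prod_mk, hmem, hsm, hsm']
    exact and_comm

end LorentzSurface

end

/-! ### Lifting isometries to area preserving product maps. -/

section

theorem exists_homeomorph_lift (f : S1 ≃ₜ S1) : ∃ F : ℝ ≃ₜ ℝ, ∀ x : ℝ, ((F x : ℝ) : S1) = f x := by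
  obtain ⟨F, hF, hFf⟩ := exists_real_lift (θ := fun x : ℝ => f (x : S1))
    (f.continuous.comp (AddCircle.continuous_mk' 1))
  obtain ⟨G, hG, hGf⟩ := exists_real_lift (θ := fun x : ℝ => f.symm (x : S1))
    (f.symm.continuous.comp (AddCircle.continuous_mk' 1))
  obtain ⟨n, hn⟩ := exists_eq_add_int (u := fun x => G (F x)) (v := id) (hG.comp hF) continuous_id
    (fun x => by rw [hGf, hFf, f.symm_apply_apply, id])
  obtain ⟨k, hk⟩ := exists_eq_add_int (u := fun x => F (G x - n)) (v := id)
    (hF.comp (hG.sub continuous_const)) continuous_id (fun x => by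
      rw [hFf, show ((G x - n : ℝ) : S1) = ((G x : ℝ) : S1) from
        coe_eq_coe_iff.2 ⟨-n, by push_cast; ring⟩, hGf, f.apply_symm_apply, id])
  simp only [id] at hn hk
  have hk0 : (k : ℝ) = 0 := by
    have h1 := hk (F 0)
    rw [hn] at h1
    simpa using h1
  refine ⟨⟨⟨F, fun x => G x - n, fun x => ?_, fun x => ?_⟩, hF, hG.sub continuous_const⟩, hFf⟩
  · change G (F x) - n = x
    rw [hn]; ring
  · change F (G x - n) = x
    rw [hk, hk0, add_zero]

/-- The preimage of `F x + 1` differs from `x` by a positive integer, by injectivity on the circle;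
so it is at least `x + 1`, and the increase of `F` over a unit cannot exceed `1`. -/
theorem homeomorph_lift_add_one {f : S1 ≃ₜ S1} {F : ℝ ≃ₜ ℝ} (hF : ∀ x : ℝ, ((F x : ℝ) : S1) = f x)
    (hm : StrictMono F) (x : ℝ) : F (x + 1) = F x + 1 := by
  have h1 : ((F (x + 1) : ℝ) : S1) = ((F x : ℝ) : S1) := by
    rw [hF, hF]
    exact congrArg f (coe_eq_coe_iff.2 ⟨1, by simp⟩)
  obtain ⟨k, hk⟩ := coe_eq_coe_iff.1 h1
  have hk0 : 0 < k := by
    have := hm (lt_add_one x)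
    rw [hk] at this
    exact_mod_cast (show (0 : ℝ) < k by linarith)
  obtain ⟨y, hy⟩ := F.surjective (F x + 1)
  have h2 : f (y : S1) = f (x : S1) := by
    rw [← hF, ← hF, hy]
    exact coe_eq_coe_iff.2 ⟨1, by simp⟩
  obtain ⟨n, hn⟩ := coe_eq_coe_iff.1 (f.injective h2)
  have hn0 : 0 < n := by
    have : x < y := hm.lt_iff_lt.1 (by rw [hy]; linarith)
    exact_mod_cast (show (0 : ℝ) < n by linarith)
  have hn1 : (1 : ℝ) ≤ n := by exact_mod_cast hn0
  have h3 := hm.monotone (show x + 1 ≤ y by linarith)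
  rw [hk, hy] at h3
  have h4 : (1 : ℝ) ≤ k := by exact_mod_cast hk0
  rw [hk]; linarith

/-- Each slice is sent inside the slice over the image point. The opposite inequalities come from
applying this to the inverse map. -/
theorem le_of_mapsTo_of_boundedBy {U : Set (ℝ × ℝ)} {D T : ℝ ≃ₜ ℝ}
    (hU : LorentzSurface.BoundedBy U D T) {F F' : ℝ ≃ₜ ℝ} (hF' : StrictMono F')
    (h : ∀ q ∈ U, (F q.1, F' q.2) ∈ U) (x : ℝ) : D (F x) ≤ F' (D x) ∧ F' (T x) ≤ T (F x) := by
  have hlt := hU.lower_lt_upper x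
  have h1 : ∀ y, D x < y → y < T x → D (F x) < F' y ∧ F' y < T (F x) := fun y h1 h2 =>
    (hU.mem_iff _ _).1 (h (x, y) ((hU.mem_iff _ _).2 ⟨h1, h2⟩))
  constructor
  · by_contra! hc
    obtain ⟨z, hz1, hz2⟩ := exists_between (lt_min hc (hF' hlt))
    obtain ⟨y, rfl⟩ := F'.surjective z
    have := (h1 y (hF'.lt_iff_lt.1 hz1) (hF'.lt_iff_lt.1 (hz2.trans_le (min_le_right _ _)))).1
    exact absurd (hz2.trans_le (min_le_left _ _)) (not_lt.2 this.le)
  · by_contra! hc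
    obtain ⟨z, hz1, hz2⟩ := exists_between (max_lt hc (hF' hlt))
    obtain ⟨y, rfl⟩ := F'.surjective z
    have := (h1 y (hF'.lt_iff_lt.1 ((le_max_right _ _).trans_lt hz1)) (hF'.lt_iff_lt.1 hz2)).2
    exact absurd ((le_max_left _ _).trans_lt hz1) (not_lt.2 this.le)

namespace LorentzSurface

variable {g : LorentzSurface M} {A B : M → S1}

theorem BoundedBy.lower_add_int {U : Set (ℝ × ℝ)} {D T : ℝ ≃ₜ ℝ} (hU : BoundedBy U D T) (x : ℝ)
    (n : ℤ) : D (x + n) = D x + n ∧ T (x + n) = T x + n := by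
  have key : ∀ (f : ℝ → ℝ), (∀ x, f (x + 1) = f x + 1) → f (x + n) = f x + n := by
    intro f hf
    have h5 : Function.Periodic (fun x => f x - x) 1 := fun x => by simp only [hf]; ring
    have h6 := h5.int_mul n x
    simp only [mul_one] at h6
    linarith
  exact ⟨key D hU.lower_add_one, key T hU.upper_add_one⟩

/-- A pair of homeomorphisms of `ℝ` preserving the domain between the graphs of `D` and `T` and
the area form with density `ρ`. -/
structure AreaPreserving (ρ : ℝ × ℝ → ℝ) (D T : ℝ ≃ₜ ℝ) (F F' : ℝ ≃ₜ ℝ) : Prop where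
  strictMono : StrictMono F
  strictMono' : StrictMono F'
  map_lower (x : ℝ) : F' (D x) = D (F x)
  map_upper (x : ℝ) : F' (T x) = T (F x)
  differentiable : Differentiable ℝ F
  differentiable' : Differentiable ℝ F'
  deriv_pos (x : ℝ) : 0 < deriv F x
  deriv_pos' (x : ℝ) : 0 < deriv F' x
  density (x y : ℝ) : D x < y → y < T x → ρ (F x, F' y) * (deriv F x * deriv F' y) = ρ (x, y)

/-- The lifts are chosen so that one point of the region goes to a point of the region. Path
connectedness then carries the whole region into itself, for the pair and for its inverse, so the
boundary graphs are preserved. -/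
theorem exists_areaPreserving [Nonempty M] (h : g.TorusChart A B) {E : Type*} [TopologicalSpace E]
    [PathConnectedSpace E] {π : E → M} {P : E → ℝ × ℝ} (hP : PlaneLift A B π P) {D T : ℝ ≃ₜ ℝ}
    (hU : BoundedBy (Set.range P) D T) {φ : M ≃ₜ M} (hφ : g.IsIsometry φ) {f f' : S1 ≃ₜ S1}
    (hf : ∀ m, A (φ m) = f (A m)) (hf' : ∀ m, B (φ m) = f' (B m)) :
    ∃ F F' : ℝ ≃ₜ ℝ, AreaPreserving (planeFactor g A B) D T F F' ∧
      (∀ x : ℝ, ((F x : ℝ) : S1) = f x) ∧ 0 ≤ F 0 ∧ F 0 < 1 := by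
  obtain ⟨e₀⟩ : Nonempty E := inferInstance
  obtain ⟨F₀, hF₀⟩ := exists_homeomorph_lift f
  obtain ⟨F₀', hF₀'⟩ := exists_homeomorph_lift f'
  obtain ⟨e₁, he₁⟩ := hP.surjective (φ (π e₀))
  obtain ⟨i, hi⟩ : ∃ i : ℤ, (P e₁).1 = F₀ (P e₀).1 + i :=
    coe_eq_coe_iff.1 (by rw [hP.fst, hF₀, hP.fst, he₁, hf])
  obtain ⟨j, hj⟩ : ∃ j : ℤ, (P e₁).2 = F₀' (P e₀).2 + j :=
    coe_eq_coe_iff.1 (by rw [hP.snd, hF₀', hP.snd, he₁, hf'])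
  -- The diagonal shift by `n` brings `F 0` into `[0, 1)`; it preserves the region because `D` and
  -- `T` commute with integer translations.
  set n : ℤ := -⌊F₀ 0 + i⌋ with hn
  set F : ℝ ≃ₜ ℝ := F₀.trans (Homeomorph.addRight ((i + n : ℤ) : ℝ)) with hF
  set F' : ℝ ≃ₜ ℝ := F₀'.trans (Homeomorph.addRight ((j + n : ℤ) : ℝ)) with hF'
  have hFe : ∀ x, F x = F₀ x + (i + n) := fun x => by simp [hF]
  have hFe' : ∀ x, F' x = F₀' x + (j + n) := fun x => by simp [hF']
  have hFf : ∀ x : ℝ, ((F x : ℝ) : S1) = f x := fun x => by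
    rw [← hF₀, coe_eq_coe_iff]; exact ⟨i + n, by rw [hFe]; push_cast; ring⟩
  have hFf' : ∀ x : ℝ, ((F' x : ℝ) : S1) = f' x := fun x => by
    rw [← hF₀', coe_eq_coe_iff]; exact ⟨j + n, by rw [hFe']; push_cast; ring⟩
  have hFA : ∀ m (x : ℝ), A m = (x : S1) → A (φ m) = ((F x : ℝ) : S1) := fun m x hx => by
    rw [hf, hx, hFf]
  have hFB : ∀ m (x : ℝ), B m = (x : S1) → B (φ m) = ((F' x : ℝ) : S1) := fun m x hx => by
    rw [hf', hx, hFf']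
  have hmap : ∀ (K K' : ℝ ≃ₜ ℝ), (∀ q ∈ planeDomain A B, (K q.1, K' q.2) ∈ planeDomain A B) →
      (∃ q ∈ Set.range P, (K q.1, K' q.2) ∈ Set.range P) →
      ∀ q ∈ Set.range P, (K q.1, K' q.2) ∈ Set.range P := by
    rintro K K' hK ⟨_, ⟨e, rfl⟩, he⟩ _ ⟨e', rfl⟩
    let p := PathConnectedSpace.somePath e e'
    have hPp : Continuous fun t => P (p t) := hP.continuous.comp p.continuous
    have := hP.mem_range_of_path h (c := fun t => (K (P (p t)).1, K' (P (p t)).2))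
      ((K.continuous.comp hPp.fst).prodMk (K'.continuous.comp hPp.snd))
      (fun t => hK _ (hP.range_subset ⟨_, rfl⟩)) (by simpa using he)
    simpa using this
  have hq : (F (P e₀).1, F' (P e₀).2) ∈ Set.range P := by
    have h1 : (F (P e₀).1, F' (P e₀).2) = ((P e₁).1 + n, (P e₁).2 + n) := by
      rw [hi, hj, hFe, hFe']
      ext <;> simp <;> ring
    rw [h1, hU.mem_iff, (hU.lower_add_int _ n).1, (hU.lower_add_int _ n).2]
    have := (hU.mem_iff (P e₁).1 (P e₁).2).1 ⟨e₁, rfl⟩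
    constructor <;> linarith
  have hW : ∀ q ∈ planeDomain A B, (F q.1, F' q.2) ∈ planeDomain A B := fun q hq =>
    (h.planeInv_map hFA hFB hq).1
  have hWi : ∀ q ∈ planeDomain A B, (F.symm q.1, F'.symm q.2) ∈ planeDomain A B := by
    rintro q ⟨m, h1, h2⟩
    refine ⟨φ.symm m, f.injective ?_, f'.injective ?_⟩
    · rw [← hf, φ.apply_symm_apply, h1, ← hFf, F.apply_symm_apply]
    · rw [← hf', φ.apply_symm_apply, h2, ← hFf', F'.apply_symm_apply]
  have hm1 := hmap F F' hW ⟨_, ⟨e₀, rfl⟩, hq⟩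
  have hm2 := hmap F.symm F'.symm hWi ⟨_, hq, by simp⟩
  have hne : ∀ x, ∃ y, (x, y) ∈ Set.range P := fun x => by
    obtain ⟨y, hy⟩ := exists_between (hU.lower_lt_upper x)
    exact ⟨y, (hU.mem_iff _ _).2 hy⟩
  have hne' : ∀ y, ∃ x, (x, y) ∈ Set.range P := fun y => by
    obtain ⟨z, hz⟩ := D.surjective y
    obtain ⟨x, hx⟩ := T.surjective y
    have hxz : x < z := by
      rw [← hU.strictMono_lower.lt_iff_lt, hz, ← hx]; exact hU.lower_lt_upper x
    obtain ⟨w, hw1, hw2⟩ := exists_between hxz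
    refine ⟨w, (hU.mem_iff _ _).2 ⟨?_, ?_⟩⟩
    · rw [← hz]; exact hU.strictMono_lower hw2
    · rw [← hx]; exact hU.strictMono_upper hw1
  have hd := fun q (hq : q ∈ Set.range P) =>
    h.deriv_map hφ F.continuous F'.continuous hFA hFB (hP.range_subset hq)
  have hdiff := fun q (hq : q ∈ Set.range P) =>
    h.contDiffAt_map hφ F.continuous F'.continuous hFA hFB (hP.range_subset hq)
  have hp : ∀ x, 0 < deriv F x := fun x => by
    obtain ⟨y, hy⟩ := hne x
    exact (hd _ hy).1
  have hp' : ∀ y, 0 < deriv F' y := fun y => by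
    obtain ⟨x, hx⟩ := hne' y
    exact (hd _ hx).2.1
  have hs : StrictMono F := strictMono_of_deriv_pos hp
  have hs' : StrictMono F' := strictMono_of_deriv_pos hp'
  have hsi' : StrictMono F'.symm := fun a b hab => by
    rw [← hs'.lt_iff_lt, F'.apply_symm_apply, F'.apply_symm_apply]; exact hab
  have hle := le_of_mapsTo_of_boundedBy hU hs' hm1
  have hle' := fun x => le_of_mapsTo_of_boundedBy hU hsi' hm2 (F x)
  refine ⟨F, F', ⟨hs, hs', fun x => le_antisymm ?_ (hle x).1, fun x => le_antisymm (hle x).2 ?_,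
    fun x => ?_, fun y => ?_, hp, hp', fun x y h1 h2 => ?_⟩, hFf, ?_, ?_⟩
  · have := hs'.monotone (hle' x).1
    rwa [F'.apply_symm_apply, F.symm_apply_apply] at this
  · have := hs'.monotone (hle' x).2
    rwa [F'.apply_symm_apply, F.symm_apply_apply] at this
  · obtain ⟨y, hy⟩ := hne x
    exact (hdiff _ hy).1.differentiableAt one_ne_zero
  · obtain ⟨x, hx⟩ := hne' y
    exact (hdiff _ hx).2.differentiableAt one_ne_zero
  · exact (hd (x, y) ((hU.mem_iff _ _).2 ⟨h1, h2⟩)).2.2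
  · rw [hFe, hn]; push_cast; linarith [Int.floor_le (F₀ 0 + i)]
  · rw [hFe, hn]; push_cast; linarith [Int.lt_floor_add_one (F₀ 0 + i)]

/-! ### Areas of rectangles in the region. -/

/-- The area, for the density `ρ`, of the rectangle `[a, b] × [D c, D d]`. -/
def rectArea (ρ : ℝ × ℝ → ℝ) (D : ℝ ≃ₜ ℝ) (a b c d : ℝ) : ENNReal :=
  ∫⁻ x in Set.Icc a b, ∫⁻ y in Set.Icc (D c) (D d), ENNReal.ofReal (ρ (x, y))

section Area

variable {ρ : ℝ × ℝ → ℝ} {U : Set (ℝ × ℝ)} {D T : ℝ ≃ₜ ℝ}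

theorem image_Icc_of_strictMono {F : ℝ ≃ₜ ℝ} (hF : StrictMono F) (a b : ℝ) :
    F '' Set.Icc a b = Set.Icc (F a) (F b) := by
  ext y
  constructor
  · rintro ⟨x, hx, rfl⟩
    exact ⟨hF.monotone hx.1, hF.monotone hx.2⟩
  · rintro ⟨h1, h2⟩
    obtain ⟨x, rfl⟩ := F.surjective y
    exact ⟨x, ⟨hF.le_iff_le.1 h1, hF.le_iff_le.1 h2⟩, rfl⟩

/-- Change of variables by `F` in `x` and by `F'` in `y`. Measuring vertical sides through `D` lets
`F` act on all four parameters, since `F' ∘ D = D ∘ F`. The two inequalities place the rectangle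
inside the region, where the density identity holds. -/
theorem AreaPreserving.rectArea_eq {F F' : ℝ ≃ₜ ℝ} (hU : BoundedBy U D T)
    (hF : AreaPreserving ρ D T F F') {a b c d : ℝ} (hbc : b < c) (hda : D d < T a) :
    rectArea ρ D (F a) (F b) (F c) (F d) = rectArea ρ D a b c d := by
  have h1 : ∀ (G : ℝ ≃ₜ ℝ), StrictMono G → Differentiable ℝ G → (∀ x, 0 < deriv G x) →
      ∀ (a b : ℝ) (u : ℝ → ENNReal), ∫⁻ x in Set.Icc (G a) (G b), u x =
        ∫⁻ x in Set.Icc a b, ENNReal.ofReal (deriv G x) * u (G x) := by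
    intro G hG hd hp a b u
    rw [← image_Icc_of_strictMono hG, MeasureTheory.lintegral_image_eq_lintegral_abs_deriv_mul
      measurableSet_Icc (fun x _ => (hd x).hasDerivAt.hasDerivWithinAt) G.injective.injOn]
    simp only [abs_of_pos (hp _)]
  unfold rectArea
  rw [h1 F hF.strictMono hF.differentiable hF.deriv_pos]
  refine MeasureTheory.setLIntegral_congr_fun measurableSet_Icc fun x hx => ?_
  rw [← hF.map_lower, ← hF.map_lower, h1 F' hF.strictMono' hF.differentiable' hF.deriv_pos',
    ← MeasureTheory.lintegral_const_mul' _ _ ENNReal.ofReal_ne_top]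
  refine MeasureTheory.setLIntegral_congr_fun measurableSet_Icc fun y hy => ?_
  have h2 : D x < y := (hU.strictMono_lower (hx.2.trans_lt hbc)).trans_le hy.1
  have h3 : y < T x := hy.2.trans_lt (hda.trans_le (hU.strictMono_upper.monotone hx.1))
  rw [← hF.density x y h2 h3, ← mul_assoc, ← ENNReal.ofReal_mul (hF.deriv_pos x).le, mul_comm,
    ← ENNReal.ofReal_mul' (mul_pos (hF.deriv_pos x) (hF.deriv_pos' y)).le]

theorem rectArea_mono (hD : StrictMono D) {a b c d a' b' c' d' : ℝ} (ha : a' ≤ a) (hb : b ≤ b')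
    (hc : c' ≤ c) (hd : d ≤ d') : rectArea ρ D a b c d ≤ rectArea ρ D a' b' c' d' := by
  unfold rectArea
  refine (MeasureTheory.lintegral_mono_set (Set.Icc_subset_Icc ha hb)).trans ?_
  exact MeasureTheory.lintegral_mono fun x => MeasureTheory.lintegral_mono_set
    (Set.Icc_subset_Icc (hD.monotone hc) (hD.monotone hd))

theorem rect_subset (hU : BoundedBy U D T) {a b c d : ℝ} (hbc : b < c) (hda : D d < T a) :
    Set.Icc a b ×ˢ Set.Icc (D c) (D d) ⊆ U := by
  rintro ⟨x, y⟩ ⟨hx, hy⟩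
  exact (hU.mem_iff _ _).2 ⟨(hU.strictMono_lower (hx.2.trans_lt hbc)).trans_le hy.1,
    hy.2.trans_lt (hda.trans_le (hU.strictMono_upper.monotone hx.1))⟩

theorem rectArea_pos (hU : BoundedBy U D T) (hρ : ContinuousOn ρ U) (hpos : ∀ q ∈ U, 0 < ρ q)
    {a b c d : ℝ} (hab : a < b) (hbc : b < c) (hcd : c < d) (hda : D d < T a) :
    0 < rectArea ρ D a b c d := by
  have hsub := rect_subset hU hbc hda
  have hcd' := hU.strictMono_lower hcd
  obtain ⟨q, hq, hmin⟩ := (isCompact_Icc.prod isCompact_Icc).exists_isMinOn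
    (⟨(a, D c), ⟨le_rfl, hab.le⟩, ⟨le_rfl, hcd'.le⟩⟩ :
      (Set.Icc a b ×ˢ Set.Icc (D c) (D d)).Nonempty) (hρ.mono hsub)
  have h1 : ENNReal.ofReal (ρ q) * ENNReal.ofReal (D d - D c) * ENNReal.ofReal (b - a) ≤
      rectArea ρ D a b c d := by
    rw [← Real.volume_Icc (a := a), ← MeasureTheory.setLIntegral_const]
    refine MeasureTheory.setLIntegral_mono' measurableSet_Icc fun x hx => ?_
    rw [← Real.volume_Icc, ← MeasureTheory.setLIntegral_const]
    exact MeasureTheory.setLIntegral_mono' measurableSet_Icc fun y hy =>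
      ENNReal.ofReal_le_ofReal (hmin (show (x, y) ∈ _ from ⟨hx, hy⟩))
  refine lt_of_lt_of_le ?_ h1
  have := hpos q (hsub hq)
  refine ENNReal.mul_pos (ENNReal.mul_pos ?_ ?_).ne' ?_ <;>
    simpa using by linarith

/-- One density bound on a compact rectangle serves all its subrectangles, so areas tend to `0` when
either pair of sides shrinks. -/
theorem exists_rectArea_le (hU : BoundedBy U D T) (hρ : ContinuousOn ρ U) {a b c d : ℝ}
    (hbc : b < c) (hda : D d < T a) : ∃ K : NNReal, ∀ a' b' c' d', a ≤ a' → b' ≤ b → c ≤ c' →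
      d' ≤ d → rectArea ρ D a' b' c' d' ≤
        K * ENNReal.ofReal (D d' - D c') * ENNReal.ofReal (b' - a') := by
  have hsub := rect_subset hU hbc hda
  obtain ⟨K, hK⟩ := (isCompact_Icc.prod isCompact_Icc).bddAbove_image (hρ.mono hsub)
  refine ⟨K.toNNReal, fun a' b' c' d' ha hb hc hd => ?_⟩
  unfold rectArea
  rw [← Real.volume_Icc (a := a'), ← MeasureTheory.setLIntegral_const]
  refine MeasureTheory.setLIntegral_mono' measurableSet_Icc fun x hx => ?_
  rw [← Real.volume_Icc, ← MeasureTheory.setLIntegral_const]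
  exact MeasureTheory.setLIntegral_mono' measurableSet_Icc fun y hy =>
    ENNReal.ofReal_le_ofReal (hK ⟨(x, y), ⟨⟨ha.trans hx.1, hx.2.trans hb⟩,
      ⟨(hU.strictMono_lower.monotone hc).trans hy.1, hy.2.trans
        (hU.strictMono_lower.monotone hd)⟩⟩, rfl⟩)

end Area

end LorentzSurface

end

/-! ### Limits of area preserving sequences of lifts. -/

section

/-- A sequence of lifts of circle homeomorphisms commuting with `H` and preserving an area of the
rectangles `[a, b] × [c, d]` lying in `{(x, y) | x < y < H x}`. -/
structure PreservesArea (H : ℝ ≃ₜ ℝ) (R : ℝ → ℝ → ℝ → ℝ → ENNReal) (F : ℕ → ℝ ≃ₜ ℝ) : Prop where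
  strictMono_H : StrictMono H
  lt_H (x : ℝ) : x < H x
  H_add_one (x : ℝ) : H (x + 1) = H x + 1
  strictMono (n : ℕ) : StrictMono (F n)
  add_one (n : ℕ) (x : ℝ) : F n (x + 1) = F n x + 1
  commute (n : ℕ) (x : ℝ) : F n (H x) = H (F n x)
  zero_le (n : ℕ) : 0 ≤ F n 0
  lt_one (n : ℕ) : F n 0 < 1
  area_eq (n : ℕ) {a b c d : ℝ} : b < c → d < H a → R (F n a) (F n b) (F n c) (F n d) = R a b c d
  area_mono {a b c d a' b' c' d' : ℝ} : a' ≤ a → b ≤ b' → c' ≤ c → d ≤ d' →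
    R a b c d ≤ R a' b' c' d'
  area_pos {a b c d : ℝ} : a < b → b < c → c < d → d < H a → 0 < R a b c d
  area_small_left {a c d : ℝ} : a < c → d < H a → ∀ η > 0,
    ∀ᶠ ε in 𝓝[>] (0 : ℝ), R (a - ε) (a + ε) c d < η
  area_small_right {a c d : ℝ} : d < a → a < H c → ∀ η > 0,
    ∀ᶠ ε in 𝓝[>] (0 : ℝ), R c d (a - ε) (a + ε) < η

namespace PreservesArea

open Filter

variable {H : ℝ ≃ₜ ℝ} {R : ℝ → ℝ → ℝ → ℝ → ENNReal} {F : ℕ → ℝ ≃ₜ ℝ} (hF : PreservesArea H R F)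

include hF

theorem comp {s : ℕ → ℕ} : PreservesArea H R (fun n => F (s n)) :=
  ⟨hF.strictMono_H, hF.lt_H, hF.H_add_one, fun _ => hF.strictMono _, fun _ => hF.add_one _,
    fun _ => hF.commute _, fun _ => hF.zero_le _, fun _ => hF.lt_one _, fun _ => hF.area_eq _,
    hF.area_mono, hF.area_pos, hF.area_small_left, hF.area_small_right⟩

theorem map_int (n : ℕ) (k : ℤ) : F n k = F n 0 + k := by
  have h5 : Function.Periodic (fun x => F n x - x) 1 := fun x => by simp only [hF.add_one]; ring
  have h6 := h5.int_mul k 0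
  simp only [mul_one, zero_add] at h6
  linarith

/-- Compactness of a product indexed by the rationals: the normalisation of `F n 0` traps `F n q` in
`[⌊q⌋, ⌊q⌋ + 2]`. -/
theorem exists_subseq : ∃ (s : ℕ → ℕ) (l : ℚ → ℝ), StrictMono s ∧
    ∀ q : ℚ, Tendsto (fun n => F (s n) q) atTop (𝓝 (l q)) := by
  have hK : IsCompact (Set.univ.pi fun q : ℚ => Set.Icc ((⌊(q : ℝ)⌋ : ℤ) : ℝ) ((⌊(q : ℝ)⌋ : ℤ) + 2)) :=
    isCompact_univ_pi fun q => isCompact_Icc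
  obtain ⟨l, -, s, hs, hl⟩ := hK.tendsto_subseq (x := fun n (q : ℚ) => F n q) fun n q _ => by
    have h1 := (hF.strictMono n).monotone (Int.floor_le (q : ℝ))
    have h2 := (hF.strictMono n).monotone (Int.lt_floor_add_one (q : ℝ)).le
    rw [hF.map_int] at h1
    rw [hF.add_one, hF.map_int] at h2
    have := hF.zero_le n
    have := hF.lt_one n
    constructor <;> linarith
  exact ⟨s, l, hs, fun q => tendsto_pi_nhds.1 hl q⟩

variable {l : ℚ → ℝ} (hl : ∀ q : ℚ, Tendsto (fun n => F n q) atTop (𝓝 (l q)))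

include hl

theorem monotone_lim : Monotone l := fun p q hpq =>
  le_of_tendsto_of_tendsto' (hl p) (hl q) fun n =>
    (hF.strictMono n).monotone (by exact_mod_cast hpq)

/-- By monotonicity, the small increment of `l` between two rationals controls all late terms; the
finitely many early ones are controlled by their continuity. -/
theorem eventually_small (h : ∀ x : ℝ, ∀ η > 0, ∃ p r : ℚ, (p : ℝ) < x ∧ x < r ∧ l r - l p < η)
    (x : ℝ) {η : ℝ} (hη : 0 < η) : ∀ᶠ y in 𝓝 x, ∀ n, |F n y - F n x| < η := by
  obtain ⟨p, r, hp, hr, hpr⟩ := h x η hη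
  obtain ⟨N, hN⟩ := eventually_atTop.1 (((hl r).sub (hl p)).eventually (gt_mem_nhds hpr))
  have h1 : ∀ᶠ y in 𝓝 x, ∀ n ∈ Set.Iio N, |F n y - F n x| < η := by
    rw [eventually_all_finite (Set.finite_Iio N)]
    intro n _
    have := (F n).continuous.continuousAt (x := x) |>.eventually (Metric.ball_mem_nhds _ hη)
    exact this.mono fun y hy => by rwa [Real.dist_eq] at hy
  filter_upwards [h1, Ioo_mem_nhds hp hr] with y hy1 hy2 n
  rcases lt_or_ge n N with hn | hn
  · exact hy1 n hn
  · have h2 := hN n hn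
    have m := (hF.strictMono n)
    have e1 := m hy2.1
    have e2 := m hy2.2
    have e3 := m hp
    have e4 := m hr
    rw [abs_lt]
    constructor <;> linarith

/-- Rectangles `[p, r] × [c, d]` with `p < a < r` have arbitrarily small area. The jump stretches
the image of the first side over a fixed `[u, v]`, and `l c < l d` would stretch that of the second
over a fixed `[w, z]`, whose product has positive area. -/
theorem eq_right {a lo hi : ℝ} (hlo : ∀ p : ℚ, (p : ℝ) < a → l p ≤ lo)
    (hhi : ∀ r : ℚ, a < r → hi ≤ l r) (hlt : lo < hi) {c d : ℚ} (hac : a < c) (hcd : c < d)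
    (hd : (d : ℝ) < H a) : l c = l d := by
  by_contra hne
  have hcd' : l c < l d := lt_of_le_of_ne (hF.monotone_lim hl hcd.le) hne
  obtain ⟨u, hu1, hu2⟩ := exists_between hlt
  obtain ⟨v, hv1, hv2⟩ := exists_between hu2
  obtain ⟨w, hw1, hw2⟩ := exists_between hcd'
  obtain ⟨z, hz1, hz2⟩ := exists_between hw2
  have hvw : v < w := (hv2.trans_le (hhi c hac)).trans hw1
  have key : ∀ p r : ℚ, (p : ℝ) < a → a < r → (r : ℝ) < c → (d : ℝ) < H p →
      z < H u ∧ R u v w z ≤ R p r c d := by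
    intro p r hp hr hrc hdp
    have e1 := (hl p).eventually (gt_mem_nhds ((hlo p hp).trans_lt hu1))
    have e2 := (hl r).eventually (lt_mem_nhds (hv2.trans_le (hhi r hr)))
    have e3 := (hl c).eventually (gt_mem_nhds hw1)
    have e4 := (hl d).eventually (lt_mem_nhds hz2)
    obtain ⟨n, h1, h2, h3, h4⟩ := (e1.and (e2.and (e3.and e4))).exists
    refine ⟨?_, ?_⟩
    · have h5 := hF.strictMono n hdp
      rw [hF.commute] at h5
      exact h4.trans (h5.trans (hF.strictMono_H h1))
    · rw [← hF.area_eq n hrc hdp]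
      exact hF.area_mono h1.le h2.le h3.le h4.le
  have hcont : ∀ᶠ ε in 𝓝[>] (0 : ℝ), (d : ℝ) < H (a - ε) := by
    have h1 : Tendsto (fun ε => H (a - ε)) (𝓝 0) (𝓝 (H a)) := by
      have : Continuous fun ε => H (a - ε) := by fun_prop
      simpa using this.tendsto 0
    exact (h1.eventually (lt_mem_nhds hd)).filter_mono nhdsWithin_le_nhds
  have hcont' : ∀ᶠ ε in 𝓝[>] (0 : ℝ), a + ε < c := by
    have h1 : Tendsto (fun ε => a + ε) (𝓝 0) (𝓝 a) := by
      have : Continuous fun ε => a + ε := by fun_prop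
      simpa using this.tendsto 0
    exact (h1.eventually (gt_mem_nhds hac)).filter_mono nhdsWithin_le_nhds
  -- Positive area requires the fixed rectangle to lie below the graph of `H`; this comes from the
  -- commutation of `F n` with `H`.
  have hz : z < H u := by
    obtain ⟨ε, h1, h2, h3⟩ := (hcont.and (hcont'.and self_mem_nhdsWithin)).exists
    have h3 : 0 < ε := h3
    obtain ⟨p, hp1, hp2⟩ := exists_rat_btwn (show a - ε < a by linarith)
    obtain ⟨r, hr1, hr2⟩ := exists_rat_btwn (show a < a + ε by linarith)
    exact (key p r hp2 hr1 (hr2.trans h2) (h1.trans (hF.strictMono_H hp1))).1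
  have hpos := hF.area_pos hv1 hvw hz1 hz
  obtain ⟨ε, h0, h1, h2, h3⟩ := ((hF.area_small_left hac hd _ hpos).and
    (hcont.and (hcont'.and self_mem_nhdsWithin))).exists
  have h3 : 0 < ε := h3
  obtain ⟨p, hp1, hp2⟩ := exists_rat_btwn (show a - ε < a by linarith)
  obtain ⟨r, hr1, hr2⟩ := exists_rat_btwn (show a < a + ε by linarith)
  have h4 := (key p r hp2 hr1 (hr2.trans h2) (h1.trans (hF.strictMono_H hp1))).2
  exact absurd (h4.trans (hF.area_mono hp1.le hr2.le le_rfl le_rfl)) (not_le.2 h0)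

/-- The mirror argument, with the jump in the second factor of the rectangles `[c, d] × [p, r]`. -/
theorem eq_left {a lo hi : ℝ} (hlo : ∀ p : ℚ, (p : ℝ) < a → l p ≤ lo)
    (hhi : ∀ r : ℚ, a < r → hi ≤ l r) (hlt : lo < hi) {c d : ℚ} (hcd : c < d) (hda : (d : ℝ) < a)
    (hac : a < H c) : l c = l d := by
  by_contra hne
  have hcd' : l c < l d := lt_of_le_of_ne (hF.monotone_lim hl hcd.le) hne
  obtain ⟨u, hu1, hu2⟩ := exists_between hlt
  obtain ⟨v, hv1, hv2⟩ := exists_between hu2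
  obtain ⟨w, hw1, hw2⟩ := exists_between hcd'
  obtain ⟨z, hz1, hz2⟩ := exists_between hw2
  have hzu : z < u := (hz2.trans_le (hlo d hda)).trans hu1
  have key : ∀ p r : ℚ, (p : ℝ) < a → a < r → (d : ℝ) < p → (r : ℝ) < H c →
      v < H w ∧ R w z u v ≤ R c d p r := by
    intro p r hp hr hdp hrc
    have e1 := (hl p).eventually (gt_mem_nhds ((hlo p hp).trans_lt hu1))
    have e2 := (hl r).eventually (lt_mem_nhds (hv2.trans_le (hhi r hr)))
    have e3 := (hl c).eventually (gt_mem_nhds hw1)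
    have e4 := (hl d).eventually (lt_mem_nhds hz2)
    obtain ⟨n, h1, h2, h3, h4⟩ := (e1.and (e2.and (e3.and e4))).exists
    refine ⟨?_, ?_⟩
    · have h5 := hF.strictMono n hrc
      rw [hF.commute] at h5
      exact h2.trans (h5.trans (hF.strictMono_H h3))
    · rw [← hF.area_eq n hdp hrc]
      exact hF.area_mono h3.le h4.le h1.le h2.le
  have hcont : ∀ᶠ ε in 𝓝[>] (0 : ℝ), (d : ℝ) < a - ε := by
    have h1 : Tendsto (fun ε => a - ε) (𝓝 0) (𝓝 a) := by
      have : Continuous fun ε => a - ε := by fun_prop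
      simpa using this.tendsto 0
    exact (h1.eventually (lt_mem_nhds hda)).filter_mono nhdsWithin_le_nhds
  have hcont' : ∀ᶠ ε in 𝓝[>] (0 : ℝ), a + ε < H c := by
    have h1 : Tendsto (fun ε => a + ε) (𝓝 0) (𝓝 a) := by
      have : Continuous fun ε => a + ε := by fun_prop
      simpa using this.tendsto 0
    exact (h1.eventually (gt_mem_nhds hac)).filter_mono nhdsWithin_le_nhds
  have hv : v < H w := by
    obtain ⟨ε, h1, h2, h3⟩ := (hcont.and (hcont'.and self_mem_nhdsWithin)).exists
    have h3 : 0 < ε := h3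
    obtain ⟨p, hp1, hp2⟩ := exists_rat_btwn (show a - ε < a by linarith)
    obtain ⟨r, hr1, hr2⟩ := exists_rat_btwn (show a < a + ε by linarith)
    exact (key p r hp2 hr1 (h1.trans hp1) (hr2.trans h2)).1
  have hpos := hF.area_pos hz1 hzu hv1 hv
  obtain ⟨ε, h0, h1, h2, h3⟩ := ((hF.area_small_right hda hac _ hpos).and
    (hcont.and (hcont'.and self_mem_nhdsWithin))).exists
  have h3 : 0 < ε := h3
  obtain ⟨p, hp1, hp2⟩ := exists_rat_btwn (show a - ε < a by linarith)
  obtain ⟨r, hr1, hr2⟩ := exists_rat_btwn (show a < a + ε by linarith)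
  have h4 := (key p r hp2 hr1 (h1.trans hp1) (hr2.trans h2)).2
  exact absurd (h4.trans (hF.area_mono le_rfl le_rfl hp1.le hr2.le)) (not_le.2 h0)

theorem tendsto_of_eq {u v b : ℝ} (h : ∀ c d : ℚ, u < c → c < d → (d : ℝ) < v → l c = l d)
    (hb : ∃ q : ℚ, u < q ∧ (q : ℝ) < v ∧ l q = b) {x : ℝ} (hux : u < x) (hxv : x < v) :
    Tendsto (fun n => F n x) atTop (𝓝 b) := by
  obtain ⟨q, hq1, hq2, hq3⟩ := hb
  have hall : ∀ c : ℚ, u < c → (c : ℝ) < v → l c = b := by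
    intro c hc1 hc2
    rcases lt_trichotomy c q with h1 | h1 | h1
    · rw [h c q hc1 h1 hq2, hq3]
    · rw [h1, hq3]
    · rw [← h q c hq1 h1 hc2, hq3]
  obtain ⟨c, hc1, hc2⟩ := exists_rat_btwn hux
  obtain ⟨d, hd1, hd2⟩ := exists_rat_btwn hxv
  have t1 := hl c
  have t2 := hl d
  rw [hall c hc1 (hc2.trans hxv)] at t1
  rw [hall d (hux.trans hd1) hd2] at t2
  exact tendsto_of_tendsto_of_tendsto_of_le_of_le t1 t2
    (fun n => (hF.strictMono n).monotone hc2.le) (fun n => (hF.strictMono n).monotone hd1.le)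

/-- A jump of the limit forces the limit to be a step function. -/
theorem exists_step {a η : ℝ} (hη : 0 < η)
    (h : ∀ p r : ℚ, (p : ℝ) < a → a < r → η ≤ l r - l p) :
    ∃ (b : ℝ) (j : ℕ), 0 < j ∧ H^[j] a = a + 1 ∧ H^[j] b = b + 1 ∧
      ∀ (i : ℕ) (x : ℝ), H^[i] a < x → x < H^[i + 1] a →
        Tendsto (fun n => F n x) atTop (𝓝 (H^[i] b)) := by
  have hmono := hF.monotone_lim hl
  obtain ⟨p₀, -, hp₀⟩ := exists_rat_btwn (show a - 1 < a by linarith)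
  obtain ⟨r₀, hr₀, -⟩ := exists_rat_btwn (show a < a + 1 by linarith)
  set lo := sSup (l '' {p : ℚ | (p : ℝ) < a}) with hlo_def
  set hi := sInf (l '' {r : ℚ | a < (r : ℝ)}) with hhi_def
  have hlr : ∀ p r : ℚ, (p : ℝ) < a → a < r → l p ≤ l r := fun p r hp hr => by
    linarith [h p r hp hr]
  have hlo : ∀ p : ℚ, (p : ℝ) < a → l p ≤ lo := fun p hp =>
    le_csSup ⟨l r₀, by rintro _ ⟨q, hq, rfl⟩; exact hlr q r₀ hq hr₀⟩ ⟨p, hp, rfl⟩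
  have hhi : ∀ r : ℚ, a < r → hi ≤ l r := fun r hr =>
    csInf_le ⟨l p₀, by rintro _ ⟨q, hq, rfl⟩; exact hlr p₀ q hp₀ hq⟩ ⟨r, hr, rfl⟩
  have hlt : lo < hi := by
    have h1 : ∀ r : ℚ, a < r → lo ≤ l r - η := fun r hr =>
      csSup_le ⟨l p₀, p₀, hp₀, rfl⟩ (by rintro _ ⟨q, hq, rfl⟩; linarith [h q r hq hr])
    have h2 : lo + η ≤ hi :=
      le_csInf ⟨l r₀, r₀, hr₀, rfl⟩ (by rintro _ ⟨q, hq, rfl⟩; linarith [h1 q hq])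
    linarith
  obtain ⟨a', ha'⟩ := H.surjective a
  have ha'a : a' < a := by have := hF.lt_H a'; rwa [ha'] at this
  have hright := fun (c d : ℚ) (h1 : a < c) (h2 : c < d) (h3 : (d : ℝ) < H a) =>
    hF.eq_right hl hlo hhi hlt h1 h2 h3
  have hleft := fun (c d : ℚ) (h1 : a' < c) (h2 : c < d) (h3 : (d : ℝ) < a) =>
    hF.eq_left hl hlo hhi hlt h2 h3 (by rw [← ha']; exact hF.strictMono_H h1)
  obtain ⟨q, hq1, hq2⟩ := exists_rat_btwn (hF.lt_H a)
  obtain ⟨q', hq1', hq2'⟩ := exists_rat_btwn ha'a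
  set b := l q with hb
  have tright : ∀ x, a < x → x < H a → Tendsto (fun n => F n x) atTop (𝓝 b) := fun x h1 h2 =>
    hF.tendsto_of_eq hl hright ⟨q, hq1, hq2, rfl⟩ h1 h2
  have tleft : ∀ x, a' < x → x < a → Tendsto (fun n => F n x) atTop (𝓝 (l q')) := fun x h1 h2 =>
    hF.tendsto_of_eq hl hleft ⟨q', hq1', hq2', rfl⟩ h1 h2
  have hne : l q' < b := (hlo q' hq2').trans_lt (hlt.trans_le (hhi q hq1))
  -- Commutation with `H` carries the limit from each interval of the orbit to the next.
  have tall : ∀ (i : ℕ) (x : ℝ), H^[i] a < x → x < H^[i + 1] a →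
      Tendsto (fun n => F n x) atTop (𝓝 (H^[i] b)) := by
    intro i
    induction i with
    | zero => exact fun x h1 h2 => tright x h1 h2
    | succ i ih =>
      intro x h1 h2
      obtain ⟨y, rfl⟩ := H.surjective x
      rw [Function.iterate_succ_apply'] at h1 h2 ⊢
      have h3 := ih y (hF.strictMono_H.lt_iff_lt.1 h1) (hF.strictMono_H.lt_iff_lt.1 h2)
      have h4 := (H.continuous.tendsto _).comp h3
      exact h4.congr fun n => (hF.commute n y).symm
  -- A bounded orbit would increase to a fixed point, impossible since `x < H x`.
  have hunb : ∃ i : ℕ, a + 1 < H^[i + 1] a := by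
    by_contra! hbd
    have hm : Monotone fun i => H^[i] a := monotone_nat_of_le_succ fun i => by
      rw [Function.iterate_succ_apply']; exact (hF.lt_H _).le
    have hbdd : BddAbove (Set.range fun i => H^[i] a) := ⟨a + 1, by
      rintro _ ⟨i, rfl⟩; exact (hm (Nat.le_succ i)).trans (hbd i)⟩
    have h1 := tendsto_atTop_ciSup hm hbdd
    have h2 := isFixedPt_of_tendsto_iterate h1 H.continuous.continuousAt
    exact absurd h2 (hF.lt_H _).ne'
  classical
  obtain ⟨j, hj1, hj2⟩ : ∃ j : ℕ, H^[j] a ≤ a + 1 ∧ a + 1 < H^[j + 1] a := by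
    refine ⟨Nat.find hunb, ?_, Nat.find_spec hunb⟩
    rcases Nat.eq_zero_or_pos (Nat.find hunb) with h0 | h0
    · rw [h0]; simp
    · have := Nat.find_min hunb (Nat.sub_lt h0 one_pos)
      rw [show Nat.find hunb - 1 + 1 = Nat.find hunb by omega] at this
      exact not_lt.1 this
  -- If the orbit skipped `a + 1`, points on both sides of it would have the common limit `H^[j] b`.
  -- Their translates by `-1` lie on both sides of `a`, where the limits differ because of the jump.
  have hja : H^[j] a = a + 1 := by
    by_contra hja
    have hj1' : H^[j] a < a + 1 := lt_of_le_of_ne hj1 hja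
    obtain ⟨x, hx1, hx2⟩ := exists_between (lt_min (hF.lt_H a)
      (show a < H^[j + 1] a - 1 by linarith))
    obtain ⟨y, hy1, hy2⟩ := exists_between (max_lt ha'a (show H^[j] a - 1 < a by linarith))
    have hx3 := hx2.trans_le (min_le_right _ _)
    have hy3 := (le_max_right _ _).trans_lt hy1
    have t1 := (tright x hx1 (hx2.trans_le (min_le_left _ _))).add_const 1
    have t2 := (tleft y ((le_max_left _ _).trans_lt hy1) hy2).add_const 1
    have t3 := tall j (x + 1) (by linarith) (by linarith)
    have t4 := tall j (y + 1) (by linarith) (by linarith)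
    simp only [hF.add_one] at t3 t4
    have e1 := tendsto_nhds_unique t1 t3
    have e2 := tendsto_nhds_unique t2 t4
    linarith
  refine ⟨b, j, ?_, hja, ?_, tall⟩
  · rcases Nat.eq_zero_or_pos j with h0 | h0
    · rw [h0] at hja; simp at hja
    · exact h0
  · have t1 := (tright q hq1 hq2).add_const 1
    have t3 := tall j (q + 1) (by rw [hja]; linarith) (by
      rw [Function.iterate_succ_apply', hja, hF.H_add_one]; linarith)
    simp only [hF.add_one] at t3
    exact (tendsto_nhds_unique t1 t3).symm

end PreservesArea

end

section

/-! ### Lifts of circle homeomorphisms and rotation numbers -/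

/-- The lift of a circle homeomorphism, as an element of `CircleDeg1Lift`. -/
def toCircleDeg1Lift (H : ℝ ≃ₜ ℝ) (hm : Monotone H) (h1 : ∀ x, H (x + 1) = H x + 1) :
    CircleDeg1Lift :=
  ⟨⟨H, hm⟩, h1⟩

/-- Continuity of `f` is not part of `CircleDeg1Lift`, so monotonicity replaces it: the integer gap
is nondecreasing over distances less than `1` and periodic, hence constant. -/
theorem exists_eq_add_int_of_lifts {H : ℝ ≃ₜ ℝ} (hm : StrictMono H) (h1 : ∀ x, H (x + 1) = H x + 1)
    (f : CircleDeg1Lift) (hf : ∀ x : ℝ, ((f x : ℝ) : S1) = (H x : S1)) :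
    ∃ n : ℤ, ∀ x, f x = H x + n := by
  choose n hn using fun x => coe_eq_coe_iff.1 (hf x)
  have hper : ∀ x, n (x + 1) = n x := fun x => by
    have h2 := hn (x + 1)
    rw [f.map_add_one, hn, h1] at h2
    exact_mod_cast (show (n (x + 1) : ℝ) = n x by linarith)
  have hle : ∀ x y, x ≤ y → y < x + 1 → n x ≤ n y := fun x y hxy hyx => by
    have h2 := f.monotone hxy
    have h3 := hm hyx
    rw [h1] at h3
    rw [hn, hn] at h2
    have h4 : (n x : ℝ) < n y + 1 := by linarith
    exact Int.lt_add_one_iff.1 (by exact_mod_cast h4)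
  have hfract : ∀ x, n x = n (Int.fract x) := fun x => by
    have h5 : Function.Periodic n 1 := hper
    have := h5.int_mul ⌊x⌋ (Int.fract x)
    rwa [mul_one, Int.fract_add_floor] at this
  refine ⟨n 0, fun x => ?_⟩
  rw [hn, hfract]
  have h3 := Int.fract_nonneg x
  have h4 := Int.fract_lt_one x
  have h5 := hle 0 _ h3 (by linarith)
  rcases h3.eq_or_lt with h6 | h6
  · rw [← h6]
  · have h7 := hle (Int.fract x) (0 + 1) (by linarith) (by linarith)
    rw [hper] at h7
    rw [le_antisymm h5 h7]

/-- The orbit relation gives translation number `1 / j`. Both `1 / j` and `1 / k` lie in `(0, 1]`,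
where congruence modulo `1` is equality. -/
theorem period_eq_of_hasRotationNumber {H : ℝ ≃ₜ ℝ} (hm : StrictMono H)
    (h1 : ∀ x, H (x + 1) = H x + 1) {h : S1 ≃ₜ S1}
    (hh : ∀ x : ℝ, ((H x : ℝ) : S1) = h x) {k : ℕ} (hk : 0 < k)
    (hrot : HasRotationNumber h (((1 : ℝ) / (k : ℝ) : ℝ) : S1)) {j : ℕ} (hj : 0 < j) {a : ℝ}
    (ha : H^[j] a = a + 1) : j = k := by
  obtain ⟨f, hf, hτ⟩ := hrot
  obtain ⟨n, hn⟩ := exists_eq_add_int_of_lifts hm h1 f fun x => (hf x).trans (hh x).symm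
  set G := toCircleDeg1Lift H hm.monotone h1 with hG
  have hGe : ∀ x, G x = H x := fun _ => rfl
  have hpow : ∀ (m : ℕ) x, (G ^ m) x = H^[m] x := fun m x => by
    rw [CircleDeg1Lift.coe_pow]; rfl
  have e1 : G.translationNumber = 1 / j := by
    have := G.translationNumber_of_map_pow_eq_add_int (x := a) (n := j) (m := 1)
      (by rw [hpow, ha]; simp) hj
    simpa using this
  have e2 : f = (CircleDeg1Lift.translate (Multiplicative.ofAdd (n : ℝ)) : CircleDeg1Lift) * G := by
    ext x
    rw [CircleDeg1Lift.mul_apply, CircleDeg1Lift.translate_apply, hn, hGe, add_comm]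
  have e3 : f.translationNumber = n + G.translationNumber := by
    rw [e2, CircleDeg1Lift.translationNumber_mul_of_commute, CircleDeg1Lift.translationNumber_translate]
    rw [CircleDeg1Lift.commute_iff_commute]
    intro x
    simp [CircleDeg1Lift.map_int_add]
  rw [e3, e1] at hτ
  obtain ⟨m, hm'⟩ := coe_eq_coe_iff.1 hτ
  have hj1 : (1 : ℝ) ≤ j := by exact_mod_cast hj
  have hk1 : (1 : ℝ) ≤ k := by exact_mod_cast hk
  have i1 : (1 : ℝ) / j ≤ 1 := by rw [div_le_one] <;> linarith
  have i2 : (1 : ℝ) / k ≤ 1 := by rw [div_le_one] <;> linarith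
  have i3 : (0 : ℝ) < 1 / j := by positivity
  have i4 : (0 : ℝ) < 1 / k := by positivity
  have i5 : ((m - n : ℤ) : ℝ) < 1 := by push_cast; linarith
  have i6 : (-1 : ℝ) < ((m - n : ℤ) : ℝ) := by push_cast; linarith
  have i7 : m - n = 0 := by
    have i5' : m - n < 1 := by exact_mod_cast i5
    have i6' : -1 < m - n := by exact_mod_cast i6
    omega
  have i8 : (m : ℝ) = n := by exact_mod_cast (sub_eq_zero.1 i7)
  have i9 : (1 : ℝ) / j = 1 / k := by linarith
  rw [one_div, one_div, inv_inj] at i9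
  exact_mod_cast i9

/-- The case `c = a + 1` is where the convention for `(a, a)` on the circle enters. -/
theorem exists_mem_Ioo_of_mem_circleIoo {a c : ℝ} (hac : a < c) (hca : c ≤ a + 1) {y : S1}
    (hy : y ∈ circleIoo (a : S1) (c : S1)) : ∃ x : ℝ, a < x ∧ x < c ∧ (x : S1) = y := by
  obtain ⟨x, ⟨hx1, hx2⟩, rfl⟩ : y ∈ ((↑) : ℝ → S1) '' Set.Ico a (a + 1) := by
    rw [AddCircle.coe_image_Ico_eq]; trivial
  simp only [circleIoo, Set.mem_ofPred_eq] at hy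
  split_ifs at hy with h
  · obtain ⟨n, hn⟩ := coe_eq_coe_iff.1 h.symm
    have h0 : (0 : ℝ) < n := by linarith
    have h1 : (1 : ℝ) ≤ n := by exact_mod_cast (show 0 < n by exact_mod_cast h0)
    exact ⟨x, lt_of_le_of_ne hx1 (by rintro rfl; exact hy rfl), by linarith, rfl⟩
  · have hca' : c < a + 1 := lt_of_le_of_ne hca (by
      rintro rfl
      exact h (coe_eq_coe_iff.2 ⟨-1, by push_cast; ring⟩))
    rw [sbtw_iff_not_btw, btw_cyclic, QuotientAddGroup.btw_coe_iff,
      (toIcoMod_eq_self _).2 (show c ∈ Set.Ico a (a + 1) from ⟨hac.le, hca'⟩), not_le] at hy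
    rcases hx1.eq_or_lt with rfl | hlt
    · rw [toIocMod_apply_left] at hy
      linarith
    · rw [(toIocMod_eq_self _).2 (show x ∈ Set.Ioc a (a + 1) from ⟨hlt, hx2.le⟩)] at hy
      exact ⟨x, hlt, hy, rfl⟩

/-- The projection to the circle is open and does not increase distances, so the estimate on the
lifts descends. -/
theorem equicontinuous_of_lifts {ψ : ℕ → S1 ≃ₜ S1} {F : ℕ → ℝ ≃ₜ ℝ}
    (hψ : ∀ n (x : ℝ), ((F n x : ℝ) : S1) = ψ n x)
    (h : ∀ (x η : ℝ), 0 < η → ∀ᶠ y in 𝓝 x, ∀ n, |F n y - F n x| < η) :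
    Equicontinuous fun n => (ψ n : S1 → S1) := by
  intro p
  obtain ⟨x, rfl⟩ := QuotientAddGroup.mk_surjective p
  rw [Metric.equicontinuousAt_iff_right]
  intro ε hε
  have h1 := (QuotientAddGroup.isOpenMap_coe (N := AddSubgroup.zmultiples (1 : ℝ))).image_mem_nhds
    (h x ε hε)
  filter_upwards [h1]
  rintro _ ⟨y, hy, rfl⟩ n
  have h2 := hψ n x
  have h3 := hψ n y
  change dist (ψ n (x : S1)) (ψ n (y : S1)) < ε
  rw [← h2, ← h3, dist_comm, dist_eq_norm, ← AddCircle.coe_sub]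
  exact (QuotientAddGroup.norm_mk_le_norm).trans_lt (hy n)

theorem PreservesArea.dichotomy {H : ℝ ≃ₜ ℝ} {R : ℝ → ℝ → ℝ → ℝ → ENNReal} {F : ℕ → ℝ ≃ₜ ℝ}
    (hF : PreservesArea H R F) (hle : ∀ x, H x ≤ x + 1) {h : S1 ≃ₜ S1}
    (hh : ∀ x : ℝ, ((H x : ℝ) : S1) = h x) {k : ℕ} (hk : 0 < k)
    (hrot : HasRotationNumber h (((1 : ℝ) / (k : ℝ) : ℝ) : S1)) {ψ : ℕ → S1 ≃ₜ S1}
    (hψ : ∀ n (x : ℝ), ((F n x : ℝ) : S1) = ψ n x) :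
    HasConvergenceProperty h k ψ ∨
      ∃ s : ℕ → ℕ, StrictMono s ∧ Equicontinuous (fun n => (ψ (s n) : S1 → S1)) := by
  obtain ⟨s, l, hs, hl⟩ := hF.exists_subseq
  have hF' : PreservesArea H R (fun n => F (s n)) := hF.comp
  -- The dichotomy is whether the limit on the rationals has a jump.
  by_cases hjump : ∀ x : ℝ, ∀ η > 0, ∃ p r : ℚ, (p : ℝ) < x ∧ x < r ∧ l r - l p < η
  · refine Or.inr ⟨s, hs, equicontinuous_of_lifts (fun n x => hψ (s n) x) fun x η hη => ?_⟩
    exact hF'.eventually_small hl hjump x hη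
  · push Not at hjump
    obtain ⟨a, η, hη, ha⟩ := hjump
    obtain ⟨b, j, hj, hja, hjb, hlim⟩ := hF'.exists_step hl hη ha
    obtain rfl := period_eq_of_hasRotationNumber hF.strictMono_H hF.H_add_one hh hk
      hrot hj hja
    have hit : ∀ (i : ℕ) (x : ℝ), (h ^ i) (x : S1) = ((H^[i] x : ℝ) : S1) := by
      intro i x
      induction i with
      | zero => simp
      | succ i ih =>
        rw [pow_succ', Homeomorph.mul_apply, ih, Function.iterate_succ_apply', hh]
    have hone : ∀ x : ℝ, (((x + 1 : ℝ)) : S1) = x := fun x =>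
      coe_eq_coe_iff.2 ⟨1, by push_cast; ring⟩
    refine Or.inl ⟨a, b, s, hs, ?_, ?_, fun i _ y hy => ?_⟩
    · rw [hit, hja, hone]
    · rw [hit, hjb, hone]
    · rw [hit, hit] at hy
      have e : H^[i + 1] a = H (H^[i] a) := Function.iterate_succ_apply' _ _ _
      obtain ⟨x, hx1, hx2, rfl⟩ := exists_mem_Ioo_of_mem_circleIoo (by rw [e]; exact hF.lt_H _)
        (by rw [e]; exact hle _) hy
      rw [hit]
      have h1 := hlim i x hx1 hx2
      have h2 := ((AddCircle.continuous_mk' (1 : ℝ)).tendsto (H^[i] b)).comp h1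
      exact h2.congr fun n => hψ (s n) x

namespace LorentzSurface

/-- With `y = D z` the region becomes `x < z < H x`; commutation with `H = D⁻¹ ∘ T` expresses the
preservation of both boundary graphs. -/
theorem AreaPreserving.preservesArea {ρ : ℝ × ℝ → ℝ} {U : Set (ℝ × ℝ)} {D T : ℝ ≃ₜ ℝ}
    (hU : BoundedBy U D T) (hρ : ContinuousOn ρ U) (hpos : ∀ q ∈ U, 0 < ρ q) {F F' : ℕ → ℝ ≃ₜ ℝ}
    (hF : ∀ n, AreaPreserving ρ D T (F n) (F' n)) (h1 : ∀ n x, F n (x + 1) = F n x + 1)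
    (h0 : ∀ n, 0 ≤ F n 0 ∧ F n 0 < 1) :
    PreservesArea (T.trans D.symm) (rectArea ρ D) F := by
  have hDH : ∀ x, D ((T.trans D.symm) x) = T x := fun x => by simp
  have hlt : ∀ {d a : ℝ}, d < (T.trans D.symm) a → D d < T a := fun {d a} h => by
    have := hU.strictMono_lower h
    rwa [hDH] at this
  set H := T.trans D.symm with hH
  have hmono : StrictMono H := fun x y hxy => by
    have := hU.strictMono_upper hxy
    rw [← hDH, ← hDH] at this
    exact hU.strictMono_lower.lt_iff_lt.1 this
  have hev : ∀ {u : ℝ → ℝ} {r : ℝ}, Continuous u → u 0 < r → ∀ᶠ ε in 𝓝[>] (0 : ℝ), u ε < r :=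
    fun {u r} hu h => (hu.tendsto 0).eventually (gt_mem_nhds h) |>.filter_mono nhdsWithin_le_nhds
  refine ⟨hmono, fun x => ?_, fun x => ?_, fun n => (hF n).strictMono, h1, fun n x => ?_,
    fun n => (h0 n).1, fun n => (h0 n).2, fun n _ _ _ _ hbc hda => (hF n).rectArea_eq hU hbc (hlt hda),
    fun ha hb hc hd => rectArea_mono hU.strictMono_lower ha hb hc hd,
    fun hab hbc hcd hda => rectArea_pos hU hρ hpos hab hbc hcd (hlt hda), ?_, ?_⟩
  · have := hU.lower_lt_upper x
    rw [← hDH] at this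
    exact hU.strictMono_lower.lt_iff_lt.1 this
  · refine D.injective ?_
    rw [hDH, hU.upper_add_one, hU.lower_add_one, hDH]
  · refine D.injective ?_
    rw [hDH, ← (hF n).map_lower, hDH, (hF n).map_upper]
  · intro a c d hac hda η hη
    have e1 : ∀ᶠ ε in 𝓝[>] (0 : ℝ), a + ε < c := hev (by fun_prop) (by simpa using hac)
    have e2 : ∀ᶠ ε in 𝓝[>] (0 : ℝ), d - H (a - ε) < 0 := hev (by fun_prop) (by simpa using hda)
    obtain ⟨δ, h2, h3, h4⟩ := (e1.and (e2.and self_mem_nhdsWithin)).exists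
    obtain ⟨K, hK⟩ := exists_rectArea_le hU hρ h2 (hlt (sub_neg.1 h3))
    have h5 : Filter.Tendsto (fun ε : ℝ => (K : ENNReal) * ENNReal.ofReal (D d - D c) *
        ENNReal.ofReal ((a + ε) - (a - ε))) (𝓝[>] 0) (𝓝 0) := by
      have h6 : Filter.Tendsto (fun ε : ℝ => ENNReal.ofReal ((a + ε) - (a - ε))) (𝓝[>] 0) (𝓝 0) := by
        have : Continuous fun ε : ℝ => ENNReal.ofReal ((a + ε) - (a - ε)) :=
          ENNReal.continuous_ofReal.comp (by fun_prop)
        simpa using (this.tendsto 0).mono_left (nhdsWithin_le_nhds (s := Set.Ioi 0))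
      have := ENNReal.Tendsto.const_mul (a := (K : ENNReal) * ENNReal.ofReal (D d - D c)) h6
        (Or.inr (ENNReal.mul_ne_top ENNReal.coe_ne_top ENNReal.ofReal_ne_top))
      simpa using this
    filter_upwards [h5.eventually (gt_mem_nhds hη), Ioo_mem_nhdsGT h4] with ε h7 h8
    exact (hK _ _ _ _ (by linarith [h8.2]) (by linarith [h8.2]) le_rfl le_rfl).trans_lt h7
  · intro a c d hda hac η hη
    have e1 : ∀ᶠ ε in 𝓝[>] (0 : ℝ), d - (a - ε) < 0 := hev (by fun_prop) (by simpa using hda)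
    have e2 : ∀ᶠ ε in 𝓝[>] (0 : ℝ), a + ε < H c := hev (by fun_prop) (by simpa using hac)
    obtain ⟨δ, h2, h3, h4⟩ := (e1.and (e2.and self_mem_nhdsWithin)).exists
    obtain ⟨K, hK⟩ := exists_rectArea_le hU hρ (sub_neg.1 h2) (hlt h3)
    have h5 : Filter.Tendsto (fun ε : ℝ => (K : ENNReal) *
        ENNReal.ofReal (D (a + ε) - D (a - ε)) * ENNReal.ofReal (d - c)) (𝓝[>] 0) (𝓝 0) := by
      have h6 : Filter.Tendsto (fun ε : ℝ => ENNReal.ofReal (D (a + ε) - D (a - ε)))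
          (𝓝[>] 0) (𝓝 0) := by
        have : Continuous fun ε : ℝ => ENNReal.ofReal (D (a + ε) - D (a - ε)) :=
          ENNReal.continuous_ofReal.comp (by fun_prop)
        simpa using (this.tendsto 0).mono_left (nhdsWithin_le_nhds (s := Set.Ioi 0))
      have := ENNReal.Tendsto.mul_const (b := ENNReal.ofReal (d - c))
        (ENNReal.Tendsto.const_mul (a := (K : ENNReal)) h6 (Or.inr ENNReal.coe_ne_top))
        (Or.inr ENNReal.ofReal_ne_top)
      simpa using this
    filter_upwards [h5.eventually (gt_mem_nhds hη), Ioo_mem_nhdsGT h4] with ε h7 h8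
    exact (hK _ _ _ _ le_rfl le_rfl (by linarith [h8.2]) (by linarith [h8.2])).trans_lt h7

end LorentzSurface

end

end LorentzConvergence

end

/-! ### The convergence group property of the isometry group. -/

theorem mainTheorem9
    {M : Type*} [TopologicalSpace M] [T2Space M] [SecondCountableTopology M] [ConnectedSpace M]
    [ChartedSpace Plane M] [IsManifold (𝓡 2) ∞ M]
    -- a spatially compact surface that embeds conformally in the flat torus
    (g : LorentzSurface M) (hcompact : g.SpatiallyCompact) (hembeds : g.EmbedsInTorus)
    -- identifications of the two spaces of lightlike leaves with the circle
    (α : g.LeafSpace 0 ≃ₜ S1) (hα : g.IsCoordinate 0 α)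
    (β : g.LeafSpace 1 ≃ₜ S1) (hβ : g.IsCoordinate 1 β)
    -- the universal cover of `M`, and a lift to `ℝ²` of the conformal immersion in the torus
    {E : Type*} [TopologicalSpace E] [SimplyConnectedSpace E] (π : E → M)
    (hπ : IsCoveringMap π) (hπ_surj : Function.Surjective π)
    (P : E → ℝ × ℝ) (hP : Continuous P)
    (hPπ : ∀ e : E, ((((P e).1 : ℝ) : S1), (((P e).2 : ℝ) : S1)) = g.toTorus α β (π e))
    -- the vertical and horizontal boundary maps of the image of the universal cover
    (hDown hUp hLeft hRight : ℝ → EReal)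
    (hvert : SliceBounds (Set.range P) hDown hUp)
    (hhor : SliceBounds (Prod.swap ⁻¹' Set.range P) hLeft hRight)
    -- the conformal boundary is acausal
    (hacausal : HomeoOrInfinite hDown ∧ HomeoOrInfinite hUp)
    -- the induced circle homeomorphisms
    (cUp cRight : S1 ≃ₜ S1) (hcUp : Induces hUp cUp) (hcRight : Induces hRight cRight)
    (k : ℕ) (hk : 0 < k)
    (hrot : HasRotationNumber (cRight * cUp) (((1 : ℝ) / (k : ℝ) : ℝ) : S1)) :
    IsConvergenceGroup (cRight * cUp) k (g.rho 0 α).range := by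
  have hnull := g.nullPair_toTorus hembeds hα hβ
  have hchart : g.TorusChart (fun m => α (g.leaf 0 m)) (fun m => β (g.leaf 1 m)) :=
    ⟨hnull.1, hnull.2.1, fun m n h1 h2 => hnull.2.2 (Prod.ext h1 h2)⟩
  have hlift : LorentzSurface.PlaneLift (fun m => α (g.leaf 0 m)) (fun m => β (g.leaf 1 m)) π P :=
    ⟨hπ, hπ_surj, hP, fun e => congrArg Prod.fst (hPπ e), fun e => congrArg Prod.snd (hPπ e)⟩
  obtain ⟨D, T, hU, hT, hD⟩ := LorentzSurface.exists_boundedBy hcompact hchart hlift hvert hhor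
    hacausal
  have hh : ∀ x : ℝ, (((T.trans D.symm) x : ℝ) : S1) = (cRight * cUp) x := fun x => by
    rw [Homeomorph.mul_apply, hcUp x _ (hT x), hcRight _ _ (hD (T x))]
    rfl
  have hle : ∀ x : ℝ, (T.trans D.symm) x ≤ x + 1 := fun x => by
    rw [← hU.strictMono_lower.le_iff_le, hU.lower_add_one]
    simpa using hU.upper_le x
  have hlifts : ∀ ψ ∈ (g.rho 0 α).range, ∃ F F' : ℝ ≃ₜ ℝ,
      LorentzSurface.AreaPreserving
        (LorentzSurface.planeFactor g (fun m => α (g.leaf 0 m)) (fun m => β (g.leaf 1 m))) D T F F' ∧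
      (∀ x : ℝ, ((F x : ℝ) : S1) = ψ x) ∧ 0 ≤ F 0 ∧ F 0 < 1 := by
    rintro _ ⟨φ, rfl⟩
    refine LorentzSurface.exists_areaPreserving hchart hlift hU φ.2 (f' := g.rho 1 β φ)
      (fun m => ?_) fun m => ?_
    · exact congrArg (fun z => α (g.leafAction 0 φ z)) (α.symm_apply_apply (g.leaf 0 m)).symm
    · exact congrArg (fun z => β (g.leafAction 1 φ z)) (β.symm_apply_apply (g.leaf 1 m)).symm
  constructor
  · intro ψ hψ
    obtain ⟨F, F', hF, hFψ, -⟩ := hlifts ψ hψ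
    ext p
    obtain ⟨x, rfl⟩ := QuotientAddGroup.mk_surjective p
    change ψ ((cRight * cUp) (x : S1)) = (cRight * cUp) (ψ (x : S1))
    rw [← hh, ← hFψ, ← hFψ, ← hh]
    congr 1
    -- After applying `D`, the commutation follows from the invariance of the lower and upper
    -- graphs.
    refine D.injective ?_
    rw [← hF.map_lower]
    simp [hF.map_upper]
  · intro ψ hψ
    choose F F' hF hFψ hF0 using fun n => hlifts (ψ n) (hψ n)
    refine (LorentzSurface.AreaPreserving.preservesArea hU
      (hchart.continuousOn_planeFactor.mono hlift.range_subset)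
      (fun q hq => hchart.planeFactor_pos (hlift.range_subset hq)) hF
      (fun n => homeomorph_lift_add_one (hFψ n) (hF n).strictMono) hF0).dichotomy hle hh hk hrot hFψ
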